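/- Let $\eta=\mathrm{diag}(1,-1,-1,-1)$ be the Minkowski metric on $\mathbb R^{1,3}$ in the basis $p_0,\dots,p_3$; Greek indices run from $0$ to $3$ and repeated upper and lower indices are summed. Let $E=W^{1,q}_0([0,1],\mathbb R^{1,3})$ with $q=1$ or $q=2$ be the space of absolutely continuous curves $\sigma$ with $\sigma(0)=0$ and $\dot\sigma\in L_q((0,1),\mathbb R^4)$, normed by $\|\dot\sigma\|_{L_q}$, and let $E_0=\{\sigma\in E:\sigma(1)=0\}$. For $\sigma\in E$ and $r\in[0,1]$ put $\sigma^r(t)=\sigma(rt)$. Let $m,l\ge 0$, let $A=A_\mu dx^\mu$ be a $C^\infty$ $su(N)$-valued $1$-form on $\mathbb R^{1,3}$ and $\phi$ a $C^\infty$ $su(N)$-valued function on $\mathbb R^{1,3}$. Put $\nabla_\mu f=\partial_\mu f+[A_\mu,f]$ and $F_{\mu\nu}=\partial_\mu A_\nu-\partial_\nu A_\mu+[A_\mu,A_\nu]$. The Yang–Mills–Higgs equations are $$\nabla^\mu\nabla_\mu\phi-(m^2-l\,\mathrm{tr}(\phi^*\phi))\phi=0,\qquad \nabla^\mu F_{\mu\nu}-[\phi,\nabla_\nu\phi]=0.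 \tag{1}$$ For $\sigma\in E$ and $0\le s\le t\le 1$ let $U^A_{t,s}(\sigma)$ be the solution of $\frac{d}{dt}U_{t,s}=-A_\mu(\sigma(t))\dot\sigma^\mu(t)U_{t,s}$, $\frac{d}{ds}U_{t,s}=U_{t,s}A_\mu(\sigma(s))\dot\sigma^\mu(s)$, $U_{s,s}=I_N$ (in the Carathéodory sense), let $U^A_{0,1}=(U^A_{1,0})^{-1}$ and $\Phi(\sigma)=\Phi^{A,\phi}(\sigma)=U^A_{0,1}(\sigma)\phi(\sigma(1))U^A_{1,0}(\sigma)$. *Lévy d'Alembertian.* Let $V$ be a finite-dimensional real vector space. $T^2_E$ is the space of continuous $V$-valued bilinear maps $Q$ on $E\times E$ which for $u,v\in E_0$ have the form $$Q(u,v)=\int_0^1\!\!\int_0^1 Q^V_{\mu\nu}(t,s)u^\mu(t)v^\nu(s)\,dt\,ds+\int_0^1Q^L_{\mu\nu}(t)u^\mu(t)v^\nu(t)\,dt+\tfrac12\int_0^1Q^S_{\mu\nu}(t)(\dot u^\mu(t)v^\nu(t)+\dot v^\mu(t)u^\nu(t))\,dt$$ with $Q^V_{\mu\nu}\in L_1([0,1]^2,V)$,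 $Q^L_{\mu\nu}=Q^L_{\nu\mu}\in L_1([0,1],V)$, $Q^S_{\mu\nu}=-Q^S_{\nu\mu}\in L_\infty([0,1],V)$. The Lévy trace of such a $Q$ is $\mathrm{tr}_L Q=\int_0^1\eta^{\mu\nu}Q^L_{\mu\nu}(t)\,dt$. The domain of $\Box_L$ consists of all $f\in C^2(E,V)$ with $f''(\sigma)\in T^2_E$ for all $\sigma\in E$, and $\Box_Lf(\sigma)=\mathrm{tr}_L f''(\sigma)$. *Endpoint derivative.* The domain of $D_\mu$ consists of all $f\in C^1(E,V)$ such that for every $\sigma\in E$ there is a Borel measure $\rho_\sigma$ on $[0,1]$ with values in $V\times\mathbb R^4$ such that $f'(\sigma)u=\int_0^1(u(t),\rho_\sigma(dt))_{\mathbb R^4}$ for all $u\in E$; then $D_\mu f(\sigma)=(p_\mu,\rho_\sigma(\{1\}))_{\mathbb R^4}$. **Theorem.** The function $\Phi$ takes values in $su(N)$, $U^A_{1,0}$ is in the domain of $\Box_L$, $\Phi$ and all $D_\nu\Phi$ are in the domain of the $D_\mu$, and $r\mapsto[\Phi(\sigma^r),D_\nu\Phi(\sigma^r)]\dot\sigma^\nu(r)$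 is integrable on $[0,1]$ for each $\sigma\in E$. The pair $(A,\phi)$ is a solution of (1) if and only if for all $\sigma\in E$ $$\eta^{\mu\nu}D_\mu D_\nu\Phi(\sigma)-(m^2-l\,\mathrm{tr}(\Phi(\sigma)^*\Phi(\sigma)))\Phi(\sigma)=0$$ and $$\Box_LU^A_{1,0}(\sigma)+U^A_{1,0}(\sigma)\int_0^1[\Phi(\sigma^r),D_\nu\Phi(\sigma^r)]\dot\sigma^\nu(r)\,dr=0 .$$ -/

import Mathlib

open MeasureTheory
open scoped ContDiff ENNReal Matrix Matrix.Norms.L2Operator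

noncomputable section

namespace YMH

/-- The underlying real vector space `ℝ⁴` of the Minkowski space `ℝ^{1,3}`, with coordinates
indexed by `0, 1, 2, 3`. Its Euclidean norm only serves to fix the topology and the norms of the
spaces of curves. -/
abbrev Spacetime : Type := EuclideanSpace ℝ (Fin 4)

/-- The basis vectors `p_0, p_1, p_2, p_3`. -/
def p (μ : Fin 4) : Spacetime := EuclideanSpace.single μ 1

/-- The Minkowski metric `η = diag(1, -1, -1, -1)`; it equals its own inverse, so that the same
matrix gives `η_{μν}` and `η^{μν}`. -/
def η : Matrix (Fin 4) (Fin 4) ℝ := Matrix.diagonal ![1, -1, -1, -1]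

/-- The algebra `M_N(ℂ)`. -/
abbrev Mat (N : ℕ) : Type := Matrix (Fin N) (Fin N) ℂ

/-- The Lie algebra `su(N)`: anti-Hermitian matrices of trace zero. -/
def su (N : ℕ) : Set (Mat N) := {M | Mᴴ = -M ∧ M.trace = 0}

/-! ### The spaces of curves `W^{1,q}_0([0,1], ℝ^{1,3})` -/

/-- The extension of a curve on `[0,1]` to `ℝ` which is constant outside `[0,1]`. -/
def ext (σ : unitInterval → Spacetime) : ℝ → Spacetime := Set.IccExtend zero_le_one σ

/-- `σ` is absolutely continuous, `σ(0) = 0` and `σ̇ ∈ L_q((0,1), ℝ^{1,3})`. -/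
def IsSobolevCurve (q : ℝ≥0∞) (σ : unitInterval → Spacetime) : Prop :=
  AbsolutelyContinuousOnInterval (ext σ) 0 1 ∧ σ 0 = 0 ∧
    MemLp (deriv (ext σ)) q (volume.restrict (Set.Ioo 0 1))

theorem ext_add (σ τ : unitInterval → Spacetime) : ext (σ + τ) = ext σ + ext τ := rfl

theorem ext_smul (c : ℝ) (σ : unitInterval → Spacetime) : ext (c • σ) = c • ext σ := rfl

theorem ae_differentiableAt_ext {σ : unitInterval → Spacetime}
    (h : AbsolutelyContinuousOnInterval (ext σ) 0 1) :
    ∀ᵐ t ∂(volume.restrict (Set.Ioo (0 : ℝ) 1)), DifferentiableAt ℝ (ext σ) t := by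
  rw [ae_restrict_iff' measurableSet_Ioo]
  filter_upwards [h.boundedVariationOn.ae_differentiableAt_of_mem_uIcc] with t ht hmem
  exact ht (by rw [Set.uIcc_of_le zero_le_one]; exact Set.Ioo_subset_Icc_self hmem)

theorem deriv_ext_add {σ τ : unitInterval → Spacetime}
    (hσ : AbsolutelyContinuousOnInterval (ext σ) 0 1)
    (hτ : AbsolutelyContinuousOnInterval (ext τ) 0 1) :
    deriv (ext (σ + τ)) =ᵐ[volume.restrict (Set.Ioo 0 1)] deriv (ext σ) + deriv (ext τ) := by
  filter_upwards [ae_differentiableAt_ext hσ, ae_differentiableAt_ext hτ] with t h1 h2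
  rw [ext_add]
  exact deriv_add h1 h2

theorem deriv_ext_smul (c : ℝ) {σ : unitInterval → Spacetime}
    (hσ : AbsolutelyContinuousOnInterval (ext σ) 0 1) :
    deriv (ext (c • σ)) =ᵐ[volume.restrict (Set.Ioo 0 1)] c • deriv (ext σ) := by
  filter_upwards [ae_differentiableAt_ext hσ] with t h1
  rw [ext_smul]
  exact deriv_const_smul c h1

/-- The Sobolev curves as a linear subspace of all functions `[0,1] → ℝ^{1,3}`. -/
def sobolevSubmodule (q : ℝ≥0∞) : Submodule ℝ (unitInterval → Spacetime) where
  carrier := {σ | IsSobolevCurve q σ}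
  zero_mem' := by
    have h : ext 0 = fun _ => 0 := rfl
    refine ⟨?_, rfl, ?_⟩
    · rw [h]; exact (absolutelyContinuousOnInterval_iff _ _ _).2 fun ε hε => ⟨1, one_pos, fun _ _ _ => by simpa⟩
    · rw [h]; simp
  add_mem' := by
    rintro σ τ ⟨h1, h2, h3⟩ ⟨k1, k2, k3⟩
    refine ⟨?_, ?_, (memLp_congr_ae (deriv_ext_add h1 k1)).2 (h3.add k3)⟩
    · rw [ext_add]; exact h1.add k1
    · simp [h2, k2]
  smul_mem' := by
    rintro c σ ⟨h1, h2, h3⟩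
    refine ⟨?_, ?_, (memLp_congr_ae (deriv_ext_smul c h1)).2 (h3.const_smul c)⟩
    · exact h1.const_smul c
    · simp [h2]

/-- The space `E = W^{1,q}_0([0,1], ℝ^{1,3})`. -/
def Curve (q : ℝ≥0∞) : Type := sobolevSubmodule q

instance (q : ℝ≥0∞) : AddCommGroup (Curve q) := inferInstanceAs (AddCommGroup (sobolevSubmodule q))

instance (q : ℝ≥0∞) : Module ℝ (Curve q) := inferInstanceAs (Module ℝ (sobolevSubmodule q))

instance (q : ℝ≥0∞) : CoeFun (Curve q) (fun _ => unitInterval → Spacetime) := ⟨fun σ => σ.1⟩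

/-- The velocity `σ̇`, as a function on `ℝ` of which only the values on `(0,1)` matter. -/
def velocity {q : ℝ≥0∞} (σ : Curve q) : ℝ → Spacetime := deriv (ext σ)

theorem memLp_velocity {q : ℝ≥0∞} (σ : Curve q) :
    MemLp (velocity σ) q (volume.restrict (Set.Ioo 0 1)) := σ.2.2.2

/-- The map `σ ↦ σ̇` from `W^{1,q}_0` to `L_q`. -/
def velocityLp (q : ℝ≥0∞) :
    Curve q →ₗ[ℝ] Lp Spacetime q (volume.restrict (Set.Ioo (0 : ℝ) 1)) where
  toFun σ := (memLp_velocity σ).toLp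
  map_add' σ τ := by
    rw [← MemLp.toLp_add]
    exact MemLp.toLp_congr _ _ (deriv_ext_add σ.2.1 τ.2.1)
  map_smul' c σ := by
    rw [RingHom.id_apply, ← MemLp.toLp_const_smul]
    exact MemLp.toLp_congr _ _ (deriv_ext_smul c σ.2.1)

theorem velocityLp_injective (q : ℝ≥0∞) : Function.Injective (velocityLp q) := by
  refine (injective_iff_map_eq_zero _).2 fun σ hσ => ?_
  have h0 : deriv (ext σ) =ᵐ[volume.restrict (Set.Ioo 0 1)] 0 :=
    (MemLp.toLp_eq_toLp_iff (memLp_velocity σ) MemLp.zero).1 (hσ.trans (MemLp.toLp_zero _).symm)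
  have h1 : ∀ᵐ t ∂(volume.restrict (Set.Ioo (0 : ℝ) 1)), HasDerivAt (ext σ) 0 t := by
    filter_upwards [h0, ae_differentiableAt_ext σ.2.1] with t ht hd
    have := hd.hasDerivAt
    rwa [ht] at this
  rw [restrict_Ioo_eq_restrict_Icc, ae_restrict_iff' measurableSet_Icc] at h1
  obtain ⟨C, hC⟩ := σ.2.1.const_of_ae_hasDerivAt_zero
    (by rwa [Set.uIcc_of_le zero_le_one])
  rw [Set.uIcc_of_le zero_le_one] at hC
  have hval : ∀ t : unitInterval, σ t = C := fun t => by
    have := hC t t.2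
    rwa [ext, Set.IccExtend_val] at this
  have hC0 : C = 0 := by rw [← hval 0]; exact σ.2.2.1
  exact Subtype.ext (funext fun t => (hval t).trans hC0)

/-- The norm `‖σ‖ = ‖σ̇‖_{L_q}` of `W^{1,q}_0`. -/
instance (q : ℝ≥0∞) [Fact (1 ≤ q)] : NormedAddCommGroup (Curve q) :=
  NormedAddCommGroup.induced _ _ (velocityLp q) (velocityLp_injective q)

instance (q : ℝ≥0∞) [Fact (1 ≤ q)] : NormedSpace ℝ (Curve q) :=
  NormedSpace.induced ℝ _ _ (velocityLp q)

/-- The subspace `E_0` of the curves with `σ(1) = 0`, as a set. -/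
def closedCurves (q : ℝ≥0∞) : Set (Curve q) := {σ | σ 1 = 0}

theorem isSobolevCurve_rescale {q : ℝ≥0∞} {σ : unitInterval → Spacetime}
    (h : IsSobolevCurve q σ) (r : unitInterval) :
    IsSobolevCurve q (fun t => σ (r * t)) := by
  obtain ⟨h1, h2, h3⟩ := h
  have key : ∀ t ∈ Set.Icc (0 : ℝ) 1, ext (fun t => σ (r * t)) t = ext σ (r * t) := by
    intro t ht
    have hrt : (r : ℝ) * t ∈ Set.Icc (0 : ℝ) 1 := (r * ⟨t, ht⟩ : unitInterval).2
    rw [ext, ext, Set.IccExtend_of_mem _ _ ht, Set.IccExtend_of_mem _ _ hrt]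
    rfl
  rcases eq_or_lt_of_le r.2.1 with h0 | hr
  · have hr0 : r = 0 := Subtype.ext h0.symm
    subst hr0
    have he : ext (fun t => σ (0 * t)) = fun _ => 0 := by
      funext t; simp [ext, Set.IccExtend, h2]
    refine ⟨?_, by simpa using h2, ?_⟩
    · rw [he]; exact (absolutelyContinuousOnInterval_iff _ _ _).2 fun ε hε => ⟨1, one_pos, fun _ _ _ => by simpa⟩
    · rw [he]; simp
  refine ⟨?_, by simpa using h2, ?_⟩
  · rw [absolutelyContinuousOnInterval_iff] at h1 ⊢
    intro ε hε
    obtain ⟨δ, hδ, H⟩ := h1 ε hε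
    refine ⟨δ, hδ, fun I hI hlen => ?_⟩
    rw [AbsolutelyContinuousOnInterval.disjWithin, Set.mem_ofPred_eq,
      Set.uIcc_of_le zero_le_one] at hI
    obtain ⟨hmem, hdisj⟩ := hI
    have hsc : ∀ x ∈ Set.Icc (0 : ℝ) 1, (r : ℝ) * x ∈ Set.Icc (0 : ℝ) 1 :=
      fun x hx => (r * ⟨x, hx⟩ : unitInterval).2
    have := H (I.1, fun i => ((r : ℝ) * (I.2 i).1, (r : ℝ) * (I.2 i).2)) ?_ ?_
    · refine lt_of_eq_of_lt (Finset.sum_congr rfl fun i hi => ?_) this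
      rw [key _ (hmem i hi).1, key _ (hmem i hi).2]
    · rw [AbsolutelyContinuousOnInterval.disjWithin, Set.mem_ofPred_eq,
        Set.uIcc_of_le zero_le_one]
      refine ⟨fun i hi => ⟨hsc _ (hmem i hi).1, hsc _ (hmem i hi).2⟩, ?_⟩
      intro i hi j hj hij
      have := hdisj hi hj hij
      rw [Function.onFun, Set.disjoint_left] at this ⊢
      intro x hx hx'
      refine this (a := x / r) ?_ ?_
      · rw [Set.mem_uIoc] at hx ⊢
        simpa [lt_div_iff₀ hr, div_le_iff₀ hr, mul_comm] using hx
      · rw [Set.mem_uIoc] at hx' ⊢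
        simpa [lt_div_iff₀ hr, div_le_iff₀ hr, mul_comm] using hx'
    · refine lt_of_le_of_lt (Finset.sum_le_sum fun i _ => ?_) hlen
      simp only [Real.dist_eq, ← mul_sub, abs_mul, abs_of_pos hr]
      exact mul_le_of_le_one_left (abs_nonneg _) r.2.2
  · have hd : deriv (ext fun t => σ (r * t)) =ᵐ[volume.restrict (Set.Ioo 0 1)]
        fun t => (r : ℝ) • deriv (ext σ) (r * t) := by
      filter_upwards [ae_restrict_mem measurableSet_Ioo] with t ht
      have : ext (fun t => σ (r * t)) =ᶠ[nhds t] fun t => ext σ (r * t) := by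
        filter_upwards [Ioo_mem_nhds ht.1 ht.2] with s hs
        exact key s (Set.Ioo_subset_Icc_self hs)
      rw [this.deriv_eq]
      exact deriv_comp_mul_left (r : ℝ) (ext σ) t
    rw [memLp_congr_ae hd]
    refine MemLp.const_smul ?_ (r : ℝ)
    have hemb : MeasurableEmbedding (fun t : ℝ => (r : ℝ) * t) :=
      (Homeomorph.mulLeft₀ (r : ℝ) hr.ne').measurableEmbedding
    have hmap : (volume.restrict (Set.Ioo (0 : ℝ) 1)).map (fun t : ℝ => (r : ℝ) * t) =
        ENNReal.ofReal |(r : ℝ)⁻¹| • volume.restrict (Set.Ioo (0 : ℝ) r) := by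
      have hpre : (fun t : ℝ => (r : ℝ) * t) ⁻¹' Set.Ioo (0 : ℝ) r = Set.Ioo 0 1 := by
        ext t
        simp only [Set.mem_preimage, Set.mem_Ioo]
        constructor
        · rintro ⟨a, b⟩; exact ⟨by nlinarith, by nlinarith⟩
        · rintro ⟨a, b⟩; exact ⟨by positivity, by nlinarith⟩
      rw [← hpre, ← hemb.restrict_map, Real.map_volume_mul_left hr.ne', Measure.restrict_smul]
    have : MemLp (deriv (ext σ)) q
        ((volume.restrict (Set.Ioo (0 : ℝ) 1)).map (fun t : ℝ => (r : ℝ) * t)) := by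
      rw [hmap]
      refine MemLp.smul_measure (h3.mono_measure ?_) ENNReal.ofReal_ne_top
      exact Measure.restrict_mono (Set.Ioo_subset_Ioo_right r.2.2) le_rfl
    exact hemb.memLp_map_measure_iff.1 this

/-- The curve `σ^r(t) = σ(rt)`. -/
def rescale {q : ℝ≥0∞} (σ : Curve q) (r : unitInterval) : Curve q :=
  ⟨fun t => σ (r * t), isSobolevCurve_rescale σ.2 r⟩

/-! ### Connections and the Yang–Mills–Higgs equations -/

/-- The partial derivative `∂_μ f`. -/
def partialDeriv {N : ℕ} (μ : Fin 4) (f : Spacetime → Mat N) (x : Spacetime) : Mat N :=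
  fderiv ℝ f x (p μ)

/-- The covariant derivative `∇_μ f = ∂_μ f + [A_μ, f]`. -/
def nabla {N : ℕ} (A : Fin 4 → Spacetime → Mat N) (μ : Fin 4) (f : Spacetime → Mat N)
    (x : Spacetime) : Mat N :=
  partialDeriv μ f x + ⁅A μ x, f x⁆

/-- The curvature `F_{μν} = ∂_μ A_ν - ∂_ν A_μ + [A_μ, A_ν]`. -/
def curvature {N : ℕ} (A : Fin 4 → Spacetime → Mat N) (μ ν : Fin 4) (x : Spacetime) : Mat N :=
  partialDeriv μ (A ν) x - partialDeriv ν (A μ) x + ⁅A μ x, A ν x⁆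

/-- A smooth `su(N)`-valued field. -/
def IsSmoothSuField {N : ℕ} (f : Spacetime → Mat N) : Prop :=
  ContDiff ℝ ∞ f ∧ ∀ x, f x ∈ su N

/-- The Yang–Mills–Higgs equations
`∇^μ ∇_μ φ - (m² - l tr(φ* φ)) φ = 0` and `∇^μ F_{μν} - [φ, ∇_ν φ] = 0`. -/
def SolvesYangMillsHiggs {N : ℕ} (m l : ℝ) (A : Fin 4 → Spacetime → Mat N)
    (φ : Spacetime → Mat N) : Prop :=
  (∀ x, ∑ μ, ∑ ν, η μ ν • nabla A μ (nabla A ν φ) x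
      - ((m : ℂ) ^ 2 - (l : ℂ) * ((φ x)ᴴ * φ x).trace) • φ x = 0) ∧
  (∀ ν x, ∑ lam, ∑ μ, η lam μ • nabla A lam (curvature A μ ν) x - ⁅φ x, nabla A ν φ x⁆ = 0)

/-! ### Parallel transport -/

/-- The matrix `A_μ(σ(t)) σ̇^μ(t)`. -/
def connectionAlong {q : ℝ≥0∞} {N : ℕ} (A : Fin 4 → Spacetime → Mat N) (σ : Curve q) (t : ℝ) :
    Mat N :=
  ∑ μ, velocity σ t μ • A μ (ext σ t)

/-- `U t s`, `0 ≤ s ≤ t ≤ 1`, solves the system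
`d/dt U_{t,s} = - A_μ(σ(t)) σ̇^μ(t) U_{t,s}`, `d/ds U_{t,s} = U_{t,s} A_μ(σ(s)) σ̇^μ(s)`,
`U_{s,s} = I`. As `σ̇` is only integrable, solutions are understood in the sense of Carathéodory,
that is, as continuous solutions of the integrated equations. -/
structure IsParallelTransport {q : ℝ≥0∞} {N : ℕ} (A : Fin 4 → Spacetime → Mat N) (σ : Curve q)
    (U : ℝ → ℝ → Mat N) : Prop where
  continuousOn_left : ∀ s ∈ Set.Icc (0 : ℝ) 1, ContinuousOn (fun t => U t s) (Set.Icc s 1)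
  continuousOn_right : ∀ t ∈ Set.Icc (0 : ℝ) 1, ContinuousOn (fun s => U t s) (Set.Icc 0 t)
  left_eq : ∀ s t : ℝ, 0 ≤ s → s ≤ t → t ≤ 1 →
    U t s = 1 - ∫ τ in s..t, connectionAlong A σ τ * U τ s
  right_eq : ∀ s t : ℝ, 0 ≤ s → s ≤ t → t ≤ 1 →
    U t s = 1 - ∫ τ in s..t, U t τ * connectionAlong A σ τ

open Classical in
/-- The solution `U^A_{t,s}(σ)`, `0 ≤ s ≤ t ≤ 1`, of the system of parallel transport. -/
def transport {q : ℝ≥0∞} {N : ℕ} (A : Fin 4 → Spacetime → Mat N) (σ : Curve q) :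
    ℝ → ℝ → Mat N :=
  if h : ∃ U, IsParallelTransport A σ U then h.choose else 1

/-- The parallel transport `U^A_{1,0}` along the whole curve. -/
def U10 {q : ℝ≥0∞} {N : ℕ} (A : Fin 4 → Spacetime → Mat N) (σ : Curve q) : Mat N :=
  transport A σ 1 0

/-- `U^A_{0,1} = (U^A_{1,0})⁻¹`. -/
def U01 {q : ℝ≥0∞} {N : ℕ} (A : Fin 4 → Spacetime → Mat N) (σ : Curve q) : Mat N :=
  (U10 A σ)⁻¹

/-- `Φ^{A,φ}(σ) = U^A_{0,1}(σ) φ(σ(1)) U^A_{1,0}(σ)`. -/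
def Φ {q : ℝ≥0∞} {N : ℕ} (A : Fin 4 → Spacetime → Mat N) (φ : Spacetime → Mat N)
    (σ : Curve q) : Mat N :=
  U01 A σ * φ (σ 1) * U10 A σ

/-! ### The Lévy trace and the Lévy d'Alembertian -/

/-- On `E_0 × E_0` the bilinear map `Q` is the sum of a Volterra part with kernel `QV`, a Lévy part
with kernel `QL` and a singular part with kernel `QS`. -/
structure HasLevyKernels {q : ℝ≥0∞} [Fact (1 ≤ q)] {V : Type} [NormedAddCommGroup V]
    [NormedSpace ℝ V] (Q : Curve q →L[ℝ] Curve q →L[ℝ] V)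
    (QV : Fin 4 → Fin 4 → ℝ × ℝ → V) (QL QS : Fin 4 → Fin 4 → ℝ → V) : Prop where
  integrable_volterra : ∀ μ ν,
    IntegrableOn (QV μ ν) (Set.Icc (0 : ℝ) 1 ×ˢ Set.Icc (0 : ℝ) 1)
  integrable_levy : ∀ μ ν, IntegrableOn (QL μ ν) (Set.Icc (0 : ℝ) 1)
  memLp_singular : ∀ μ ν, MemLp (QS μ ν) ∞ (volume.restrict (Set.Icc (0 : ℝ) 1))
  levy_symm : ∀ μ ν t, QL μ ν t = QL ν μ t
  singular_antisymm : ∀ μ ν t, QS μ ν t = -QS ν μ t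
  eq_on : ∀ u ∈ closedCurves q, ∀ v ∈ closedCurves q,
    Q u v =
      (∫ t in (0 : ℝ)..1, ∫ s in (0 : ℝ)..1,
        ∑ μ, ∑ ν, (ext u t μ * ext v s ν) • QV μ ν (t, s))
      + (∫ t in (0 : ℝ)..1, ∑ μ, ∑ ν, (ext u t μ * ext v t ν) • QL μ ν t)
      + (1 / 2 : ℝ) • ∫ t in (0 : ℝ)..1, ∑ μ, ∑ ν,
          (velocity u t μ * ext v t ν + velocity v t μ * ext u t ν) • QS μ ν t

/-- The space `T²_E` of (`V`-valued) continuous bilinear maps with such a representation. -/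
def MemLevySpace {q : ℝ≥0∞} [Fact (1 ≤ q)] {V : Type} [NormedAddCommGroup V] [NormedSpace ℝ V]
    (Q : Curve q →L[ℝ] Curve q →L[ℝ] V) : Prop :=
  ∃ QL QV QS, HasLevyKernels Q QV QL QS

open Classical in
/-- The Lévy trace `∫_0^1 η^{μν} Q^L_{μν}(t) dt` of an element `Q` of `T²_E` generated by the
Minkowski metric; it does not depend on the representation of `Q`. -/
def levyTrace {q : ℝ≥0∞} [Fact (1 ≤ q)] {V : Type} [NormedAddCommGroup V] [NormedSpace ℝ V]
    (Q : Curve q →L[ℝ] Curve q →L[ℝ] V) : V :=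
  if h : MemLevySpace Q then ∫ t in (0 : ℝ)..1, ∑ μ, ∑ ν, η μ ν • h.choose μ ν t else 0

/-- The domain of the Lévy d'Alembertian: `f ∈ C²(E, V)` with `f''(σ) ∈ T²_E` for all `σ`. -/
def MemDomBox {q : ℝ≥0∞} [Fact (1 ≤ q)] {V : Type} [NormedAddCommGroup V] [NormedSpace ℝ V]
    (f : Curve q → V) : Prop :=
  ContDiff ℝ 2 f ∧ ∀ σ, MemLevySpace (fderiv ℝ (fderiv ℝ f) σ)

/-- The Lévy d'Alembertian `□_L f(σ)`, the Lévy trace of `f''(σ)`. -/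
def levyBox {q : ℝ≥0∞} [Fact (1 ≤ q)] {V : Type} [NormedAddCommGroup V] [NormedSpace ℝ V]
    (f : Curve q → V) (σ : Curve q) : V :=
  levyTrace (fderiv ℝ (fderiv ℝ f) σ)

/-! ### Endpoint derivatives -/

/-- `T(u) = ∫_0^1 (u(t), ρ(dt))` for all `u ∈ E`, where `ρ` is a Borel measure on `[0,1]` with values
in `V × ℝ⁴`, given by its components `ρ μ`. -/
def IsRepresentedBy {q : ℝ≥0∞} [Fact (1 ≤ q)] {V : Type} [NormedAddCommGroup V] [NormedSpace ℝ V]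
    (T : Curve q →L[ℝ] V) (ρ : Fin 4 → VectorMeasure unitInterval V) : Prop :=
  (∀ μ, IsFiniteMeasure (ρ μ).variation) ∧
    ∀ u : Curve q, T u = ∑ μ, (ρ μ).integral (fun t => u t μ) (ContinuousLinearMap.lsmul ℝ ℝ)

open Classical in
/-- The functional `S_h(T) = (h, ρ({1}))`, where `ρ` represents `T`; `ρ({1})` is determined
by `T`. -/
def endpointFunctional {q : ℝ≥0∞} [Fact (1 ≤ q)] {V : Type} [NormedAddCommGroup V]
    [NormedSpace ℝ V] (h : Spacetime) (T : Curve q →L[ℝ] V) : V :=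
  if hT : ∃ ρ, IsRepresentedBy T ρ then ∑ μ, h μ • hT.choose μ {1} else 0

/-- The domain of the endpoint derivations: `f ∈ C¹(E, V)` such that every `f'(σ)` is represented
by a measure. -/
def MemDomEndpoint {q : ℝ≥0∞} [Fact (1 ≤ q)] {V : Type} [NormedAddCommGroup V] [NormedSpace ℝ V]
    (f : Curve q → V) : Prop :=
  ContDiff ℝ 1 f ∧ ∀ σ, ∃ ρ, IsRepresentedBy (fderiv ℝ f σ) ρ

/-- The endpoint derivative `D_μ f(σ) = S_{p_μ}(f'(σ))`. -/
def D {q : ℝ≥0∞} [Fact (1 ≤ q)] {V : Type} [NormedAddCommGroup V] [NormedSpace ℝ V]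
    (μ : Fin 4) (f : Curve q → V) (σ : Curve q) : V :=
  endpointFunctional (p μ) (fderiv ℝ f σ)

/-- The integrand `[Φ(σ^r), D_ν Φ(σ^r)] σ̇^ν(r)`. -/
def currentIntegrand {q : ℝ≥0∞} [Fact (1 ≤ q)] {N : ℕ} (Ψ : Curve q → Mat N) (σ : Curve q)
    (r : ℝ) : Mat N :=
  ∑ ν, velocity σ r ν •
    ⁅Ψ (rescale σ (Set.projIcc 0 1 zero_le_one r)),
      D ν Ψ (rescale σ (Set.projIcc 0 1 zero_le_one r))⁆

end YMH

end

open YMH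

/-!
Trivialise along the curve. For a field `f` let `T f σ (t) = U_{0,t} f(σ(t)) U_{t,0}`, so that
`Φ(σ) = T φ σ (1)`. Translation turns the field theory on `ℝ^{1,3}` into calculus on the space of
curves: it is multiplicative, and the variation of `T f` in a direction `u` is `T (∇_μ f) u^μ` up to
integral terms coming from the curvature. Hence the endpoint derivative satisfies
`D_μ (T f (1)) = T (∇_μ f) (1)`, and the first equation says that the translate of the left-hand
side of the Higgs equation vanishes for all curves, that is, at all end points.

The Lévy kernel of the second derivative of `U_{1,0}` is `-U_{1,0}` times the symmetrised translate
of `∇_μ F_{νλ} σ̇^λ`, so the left-hand side of the second equation is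
`-U_{1,0} ∫_0^1 T J_ν (t) σ̇^ν(t) dt`, where `J_ν = ∇^μ F_{μν} - [φ, ∇_ν φ]`. If it vanishes for all
curves then, applied to the rescaled curves `σ^r`, all the partial integrals over `[0,r]` vanish,
hence so does the integrand; quadratic curves, whose end point and final velocity are arbitrary,
then give `J_ν(x) = 0` for each `ν` and `x`.
-/

noncomputable section

namespace YMH

/-! ### Absolutely continuous functions -/

section AbsolutelyContinuous

variable {X Y : Type*} [PseudoMetricSpace X] [PseudoMetricSpace Y] {a b : ℝ}

theorem absolutelyContinuousOnInterval_of_dist_le {f : ℝ → X} {g : ℝ → Y} {K : ℝ}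
    (hg : AbsolutelyContinuousOnInterval g a b)
    (h : ∀ x ∈ Set.uIcc a b, ∀ y ∈ Set.uIcc a b, dist (f x) (f y) ≤ K * dist (g x) (g y)) :
    AbsolutelyContinuousOnInterval f a b := by
  rw [absolutelyContinuousOnInterval_iff] at hg ⊢
  intro ε hε
  obtain ⟨δ, hδ, H⟩ := hg (ε / (|K| + 1)) (by positivity)
  refine ⟨δ, hδ, fun I hI hlen => ?_⟩
  have hsum := H I hI hlen
  rw [lt_div_iff₀ (by positivity), Finset.sum_mul] at hsum
  refine lt_of_le_of_lt (Finset.sum_le_sum fun i hi => ?_) hsum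
  refine (h _ (hI.1 i hi).1 _ (hI.1 i hi).2).trans ?_
  rw [mul_comm]
  gcongr
  exact (le_abs_self K).trans (by linarith)

theorem absolutelyContinuousOnInterval_prodMk {f : ℝ → X} {g : ℝ → Y}
    (hf : AbsolutelyContinuousOnInterval f a b) (hg : AbsolutelyContinuousOnInterval g a b) :
    AbsolutelyContinuousOnInterval (fun t => (f t, g t)) a b := by
  rw [absolutelyContinuousOnInterval_iff] at hf hg ⊢
  intro ε hε
  obtain ⟨δ, hδ, hfδ⟩ := hf (ε / 2) (half_pos hε)
  obtain ⟨δ', hδ', hgδ⟩ := hg (ε / 2) (half_pos hε)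
  refine ⟨min δ δ', lt_min hδ hδ', fun I hI hlen => ?_⟩
  have hf' := hfδ I hI (hlen.trans_le (min_le_left _ _))
  have hg' := hgδ I hI (hlen.trans_le (min_le_right _ _))
  refine lt_of_le_of_lt ?_ ((add_lt_add hf' hg').trans_eq (add_halves ε))
  rw [← Finset.sum_add_distrib]
  refine Finset.sum_le_sum fun i _ => ?_
  rw [Prod.dist_eq]
  exact max_le_add_of_nonneg dist_nonneg dist_nonneg

theorem absolutelyContinuousOnInterval_comp {V : Type*} [SeminormedAddCommGroup V] {F : V → Y}
    {f : ℝ → V} (hF : LocallyLipschitz F) (hf : AbsolutelyContinuousOnInterval f a b) :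
    AbsolutelyContinuousOnInterval (F ∘ f) a b := by
  have hK : IsCompact (f '' Set.uIcc a b) := isCompact_uIcc.image_of_continuousOn hf.continuousOn
  obtain ⟨K, hFK⟩ :=
    LocallyLipschitzOn.exists_lipschitzOnWith_of_compact hK hF.locallyLipschitzOn
  exact absolutelyContinuousOnInterval_of_dist_le hf fun x hx y hy =>
    hFK.dist_le_mul _ (Set.mem_image_of_mem f hx) _ (Set.mem_image_of_mem f hy)

variable {V : Type*} [NormedAddCommGroup V] [NormedSpace ℝ V]

theorem absolutelyContinuousOnInterval_integral {f : ℝ → V}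
    (hf : IntervalIntegrable f volume a b) :
    AbsolutelyContinuousOnInterval (fun t => ∫ s in a..t, f s) a b := by
  have hint : ∀ x ∈ Set.uIcc a b, IntervalIntegrable f volume a x := fun x hx =>
    hf.mono_set (Set.uIcc_subset_uIcc Set.left_mem_uIcc hx)
  have hnorm := hf.norm.absolutelyContinuousOnInterval_intervalIntegral Set.left_mem_uIcc
  refine absolutelyContinuousOnInterval_of_dist_le (K := 1) hnorm fun x hx y hy => ?_
  rw [dist_eq_norm, dist_eq_norm, one_mul,
    intervalIntegral.integral_interval_sub_left (hint x hx) (hint y hy),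
    intervalIntegral.integral_interval_sub_left (hint x hx).norm (hint y hy).norm]
  exact intervalIntegral.norm_integral_le_abs_integral_norm

theorem eq_add_integral_of_ae_hasDerivAt [CompleteSpace V] {f f' : ℝ → V}
    (hf : AbsolutelyContinuousOnInterval f a b) (hf' : IntervalIntegrable f' volume a b)
    (hderiv : ∀ᵐ t, t ∈ Set.uIcc a b → HasDerivAt f (f' t) t) {t : ℝ} (ht : t ∈ Set.uIcc a b) :
    f t = f a + ∫ s in a..t, f' s := by
  have hae : ∀ᵐ x, x ∈ Set.uIcc a b → HasDerivAt (f - fun t => ∫ s in a..t, f' s) 0 x := by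
    filter_upwards [hderiv, hf'.ae_hasDerivAt_integral] with x hfx hint hx
    simpa using (hfx hx).sub (hint hx a Set.left_mem_uIcc)
  obtain ⟨C, hC⟩ :=
    (hf.sub (absolutelyContinuousOnInterval_integral hf')).const_of_ae_hasDerivAt_zero hae
  have ha := hC a Set.left_mem_uIcc
  have ht := hC t ht
  simp only [Pi.sub_apply, intervalIntegral.integral_same, sub_zero] at ha ht
  rw [ha, ← ht, sub_add_cancel]

end AbsolutelyContinuous

/-! ### Primitives on the unit interval -/

theorem uIcc_zero_coe_subset (t : unitInterval) : Set.uIcc (0 : ℝ) t ⊆ Set.uIcc 0 1 :=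
  Set.uIcc_subset_uIcc Set.left_mem_uIcc (by rw [Set.uIcc_of_le zero_le_one]; exact t.2)

theorem ae_mem_Icc_of_ae_mem_Ioo {P : ℝ → Prop} {a b : ℝ} (h : ∀ᵐ t, t ∈ Set.Ioo a b → P t) :
    ∀ᵐ t, t ∈ Set.Icc a b → P t :=
  (ae_restrict_iff' measurableSet_Icc).1 <| by
    rwa [← restrict_Ioo_eq_restrict_Icc, ae_restrict_iff' measurableSet_Ioo]

/-- The extension of a continuous function on `[0,1]` which is constant outside `[0,1]`. -/
def extend {V : Type*} [TopologicalSpace V] (f : C(unitInterval, V)) : C(ℝ, V) :=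
  f.IccExtend zero_le_one

section Extend

variable {V : Type*} [TopologicalSpace V] (f : C(unitInterval, V))

theorem extend_apply (t : ℝ) : extend f t = f (Set.projIcc 0 1 zero_le_one t) := rfl

@[simp] theorem extend_coe (t : unitInterval) : extend f t = f t := by
  simp [extend_apply]

theorem extend_of_mem {t : ℝ} (ht : t ∈ Set.Icc (0 : ℝ) 1) : extend f t = f ⟨t, ht⟩ := by
  rw [extend_apply, Set.projIcc_of_mem]

end Extend

section ExtendRing

variable {R : Type*} [NormedRing R]

theorem extend_mul (f g : C(unitInterval, R)) (t : ℝ) :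
    extend (f * g) t = extend f t * extend g t := rfl

theorem extend_add (f g : C(unitInterval, R)) (t : ℝ) :
    extend (f + g) t = extend f t + extend g t := rfl

theorem extend_sub (f g : C(unitInterval, R)) (t : ℝ) :
    extend (f - g) t = extend f t - extend g t := rfl

theorem extend_neg (f : C(unitInterval, R)) (t : ℝ) : extend (-f) t = -extend f t := rfl

theorem extend_one (t : ℝ) : extend (1 : C(unitInterval, R)) t = 1 := rfl

theorem extend_sum {ι : Type*} (s : Finset ι) (f : ι → C(unitInterval, R)) (t : ℝ) :
    extend (∑ i ∈ s, f i) t = ∑ i ∈ s, extend (f i) t := by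
  simp only [extend_apply, ContinuousMap.sum_apply]

end ExtendRing

/-- The continuous function `f` on `[0,1]` is a primitive of the integrable function `a`. -/
structure IsPrimitive {V : Type*} [NormedAddCommGroup V] [NormedSpace ℝ V]
    (f : C(unitInterval, V)) (a : ℝ → V) : Prop where
  intervalIntegrable : IntervalIntegrable a volume 0 1
  eq_add : ∀ t : unitInterval, f t = f 0 + ∫ s in (0 : ℝ)..t, a s

/-- The primitive of an integrable function on `[0,1]` which vanishes at `0`. -/
def primitive {V : Type*} [NormedAddCommGroup V] [NormedSpace ℝ V] (a : ℝ → V)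
    (ha : IntervalIntegrable a volume 0 1) : C(unitInterval, V) where
  toFun t := ∫ s in (0 : ℝ)..t, a s
  continuous_toFun := by
    have h := (absolutelyContinuousOnInterval_integral ha).continuousOn
    rw [Set.uIcc_of_le zero_le_one, continuousOn_iff_continuous_domRestrict] at h
    exact h

section Primitive

variable {V : Type*} [NormedAddCommGroup V] [NormedSpace ℝ V] {a : ℝ → V}

theorem primitive_apply (ha : IntervalIntegrable a volume 0 1) (t : unitInterval) :
    primitive a ha t = ∫ s in (0 : ℝ)..t, a s := rfl

theorem primitive_zero (ha : IntervalIntegrable a volume 0 1) : primitive a ha 0 = 0 := by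
  simp [primitive_apply]

theorem isPrimitive_primitive (ha : IntervalIntegrable a volume 0 1) :
    IsPrimitive (primitive a ha) a where
  intervalIntegrable := ha
  eq_add t := by rw [primitive_zero, zero_add, primitive_apply]

end Primitive

namespace IsPrimitive

variable {V W : Type*} [NormedAddCommGroup V] [NormedSpace ℝ V] [NormedAddCommGroup W]
  [NormedSpace ℝ W] {f g : C(unitInterval, V)} {a b : ℝ → V}

theorem intervalIntegrable_zero_coe (hf : IsPrimitive f a) (t : unitInterval) :
    IntervalIntegrable a volume 0 t :=
  hf.intervalIntegrable.mono_set (uIcc_zero_coe_subset t)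

theorem const (c : V) : IsPrimitive (ContinuousMap.const unitInterval c) 0 where
  intervalIntegrable := by simp [Pi.zero_def]
  eq_add t := by simp

theorem add (hf : IsPrimitive f a) (hg : IsPrimitive g b) : IsPrimitive (f + g) (a + b) where
  intervalIntegrable := hf.1.add hg.1
  eq_add t := by
    simp only [Pi.add_apply, ContinuousMap.add_apply]
    rw [intervalIntegral.integral_add (hf.intervalIntegrable_zero_coe t)
      (hg.intervalIntegrable_zero_coe t), hf.2 t, hg.2 t]
    abel

theorem neg (hf : IsPrimitive f a) : IsPrimitive (-f) (-a) where
  intervalIntegrable := hf.1.neg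
  eq_add t := by
    simp only [Pi.neg_apply, intervalIntegral.integral_neg, ContinuousMap.neg_apply]
    rw [hf.2 t]
    abel

theorem smul (c : ℝ) (hf : IsPrimitive f a) : IsPrimitive (c • f) (c • a) where
  intervalIntegrable := hf.1.smul c
  eq_add t := by
    simp only [Pi.smul_apply, intervalIntegral.integral_smul, ContinuousMap.smul_apply]
    rw [hf.2 t, smul_add]

theorem sum {ι : Type*} (s : Finset ι) {f : ι → C(unitInterval, V)} {a : ι → ℝ → V}
    (h : ∀ i ∈ s, IsPrimitive (f i) (a i)) : IsPrimitive (∑ i ∈ s, f i) (∑ i ∈ s, a i) := by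
  induction s using Finset.cons_induction with
  | empty => exact const 0
  | cons i s hi ih =>
    rw [Finset.sum_cons, Finset.sum_cons]
    exact (h i (Finset.mem_cons_self _ _)).add
      (ih fun j hj => h j (Finset.mem_cons_of_mem hj))

theorem congr (hf : IsPrimitive f a) (hab : ∀ᵐ t, t ∈ Set.Ioo (0 : ℝ) 1 → a t = b t) :
    IsPrimitive f b := by
  have hae := ae_mem_Icc_of_ae_mem_Ioo hab
  refine ⟨hf.1.congr_ae ?_, fun t => (hf.2 t).trans ?_⟩
  · rw [Set.uIoc_of_le zero_le_one, Filter.EventuallyEq, ae_restrict_iff' measurableSet_Ioc]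
    filter_upwards [hae] with t h ht
    exact h (Set.Ioc_subset_Icc_self ht)
  · refine congrArg _ (intervalIntegral.integral_congr_ae ?_)
    filter_upwards [hae] with s h hs
    rw [Set.uIoc_of_le t.2.1] at hs
    exact h ⟨hs.1.le, hs.2.trans t.2.2⟩

theorem eq (hf : IsPrimitive f a) (hg : IsPrimitive g a) (h0 : f 0 = g 0) : f = g := by
  ext t
  rw [hf.2, hg.2, h0]

theorem norm_apply_le {k : ℝ → ℝ} (hf : IsPrimitive f a) (h0 : f 0 = 0)
    (hk : IntervalIntegrable k volume 0 1) (hak : ∀ t ∈ Set.Icc (0 : ℝ) 1, ‖a t‖ ≤ k t)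
    (t : unitInterval) : ‖f t‖ ≤ ∫ s in (0 : ℝ)..t, k s := by
  rw [hf.2, h0, zero_add]
  exact intervalIntegral.norm_integral_le_of_norm_le t.2.1
    (.of_forall fun s hs => hak s ⟨hs.1.le, hs.2.trans t.2.2⟩)
    (hk.mono_set (uIcc_zero_coe_subset t))

theorem norm_le {k : ℝ → ℝ} (hf : IsPrimitive f a) (h0 : f 0 = 0)
    (hk : IntervalIntegrable k volume 0 1) (hak : ∀ t ∈ Set.Icc (0 : ℝ) 1, ‖a t‖ ≤ k t) :
    ‖f‖ ≤ ∫ s in (0 : ℝ)..1, k s := by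
  have hk0 : ∀ t ∈ Set.Icc (0 : ℝ) 1, 0 ≤ k t := fun t ht => (norm_nonneg _).trans (hak t ht)
  refine (ContinuousMap.norm_le _ (intervalIntegral.integral_nonneg zero_le_one hk0)).2
    fun t => (hf.norm_apply_le h0 hk hak t).trans ?_
  refine intervalIntegral.integral_mono_interval le_rfl t.2.1 t.2.2 ?_ hk
  exact (ae_restrict_iff' measurableSet_Ioc).2
    (.of_forall fun s hs => hk0 s (Set.Ioc_subset_Icc_self hs))

theorem absolutelyContinuousOnInterval (hf : IsPrimitive f a) :
    AbsolutelyContinuousOnInterval (extend f) 0 1 := by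
  refine absolutelyContinuousOnInterval_of_dist_le (K := 1)
    (absolutelyContinuousOnInterval_integral hf.1) fun x hx y hy => le_of_eq ?_
  rw [Set.uIcc_of_le zero_le_one] at hx hy
  rw [one_mul, extend_of_mem f hx, extend_of_mem f hy, hf.2, hf.2 ⟨y, hy⟩, dist_add_left]

variable [CompleteSpace V]

theorem ae_hasDerivAt (hf : IsPrimitive f a) :
    ∀ᵐ t, t ∈ Set.Ioo (0 : ℝ) 1 → HasDerivAt (extend f) (a t) t := by
  filter_upwards [hf.1.ae_hasDerivAt_integral] with t h ht
  rw [Set.uIcc_of_le zero_le_one] at h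
  refine ((h (Set.Ioo_subset_Icc_self ht) 0 ⟨le_rfl, zero_le_one⟩).const_add
    (f 0)).congr_of_eventuallyEq ?_
  filter_upwards [Ioo_mem_nhds ht.1 ht.2] with s hs
  rw [extend_of_mem f (Set.Ioo_subset_Icc_self hs), hf.2]

theorem of_ae_hasDerivAt (hf : AbsolutelyContinuousOnInterval (extend f) 0 1)
    (ha : IntervalIntegrable a volume 0 1)
    (h : ∀ᵐ t, t ∈ Set.Ioo (0 : ℝ) 1 → HasDerivAt (extend f) (a t) t) : IsPrimitive f a where
  intervalIntegrable := ha
  eq_add t := by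
    have h0 : extend f 0 = f 0 := extend_coe f 0
    have huIcc : Set.uIcc (0 : ℝ) 1 = Set.Icc 0 1 := Set.uIcc_of_le zero_le_one
    have ht := eq_add_integral_of_ae_hasDerivAt hf ha (t := t)
      (huIcc ▸ ae_mem_Icc_of_ae_mem_Ioo h) (by rw [huIcc]; exact t.2)
    rwa [extend_coe, h0] at ht

theorem prodMk [CompleteSpace W] {g : C(unitInterval, W)} {b : ℝ → W} (hf : IsPrimitive f a)
    (hg : IsPrimitive g b) : IsPrimitive (f.prodMk g) fun t => (a t, b t) := by
  refine .of_ae_hasDerivAt (absolutelyContinuousOnInterval_prodMk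
    hf.absolutelyContinuousOnInterval hg.absolutelyContinuousOnInterval) ?_ ?_
  · exact ⟨hf.1.1.prodMk hg.1.1, hf.1.2.prodMk hg.1.2⟩
  · filter_upwards [hf.ae_hasDerivAt, hg.ae_hasDerivAt] with t hft hgt ht
    exact (hft ht).prodMk (hgt ht)

theorem comp_contDiff [CompleteSpace W] {F : V → W} (hF : ContDiff ℝ 1 F) (hf : IsPrimitive f a)
    {g : C(unitInterval, W)} (hg : ∀ t, g t = F (f t)) :
    IsPrimitive g fun t => fderiv ℝ F (extend f t) (a t) := by
  have hgF : ⇑(extend g) = F ∘ extend f := funext fun t => hg _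
  have hF' : Continuous (fderiv ℝ F) := hF.continuous_fderiv one_ne_zero
  refine .of_ae_hasDerivAt ?_ ?_ ?_
  · rw [hgF]
    exact absolutelyContinuousOnInterval_comp hF.locallyLipschitz hf.absolutelyContinuousOnInterval
  · obtain ⟨C, hC⟩ := isCompact_uIcc (a := (0 : ℝ)) (b := 1).exists_bound_of_continuousOn
      (hF'.comp (extend f).continuous).continuousOn
    have hmeas : AEStronglyMeasurable (fun t => fderiv ℝ F (extend f t) (a t))
        (volume.restrict (Set.uIoc 0 1)) :=
      (ContinuousLinearMap.apply ℝ W).flip.aestronglyMeasurable_comp₂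
        (hF'.comp (extend f).continuous).aestronglyMeasurable
        hf.1.aestronglyMeasurable_restrict_uIoc
    refine (hf.1.norm.const_mul C).mono_fun' hmeas ?_
    filter_upwards [ae_restrict_mem measurableSet_uIoc] with t ht
    exact (ContinuousLinearMap.le_opNorm _ _).trans
      (mul_le_mul_of_nonneg_right (hC t (Set.uIoc_subset_uIcc ht)) (norm_nonneg _))
  · filter_upwards [hf.ae_hasDerivAt] with t hft ht
    rw [hgF]
    exact (hF.differentiable one_ne_zero _).hasFDerivAt.comp_hasDerivAt t (hft ht)

theorem map [CompleteSpace W] (L : V →L[ℝ] W) {g : C(unitInterval, W)} (hf : IsPrimitive f a)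
    (hg : ∀ t, g t = L (f t)) : IsPrimitive g fun t => L (a t) := by
  simpa using hf.comp_contDiff L.contDiff hg

theorem mul {R : Type*} [NormedRing R] [NormedAlgebra ℝ R] [CompleteSpace R]
    {f g : C(unitInterval, R)} {a b : ℝ → R} (hf : IsPrimitive f a) (hg : IsPrimitive g b) :
    IsPrimitive (f * g) fun t => a t * extend g t + extend f t * b t := by
  refine ((hf.prodMk hg).comp_contDiff contDiff_mul (g := f * g) fun _ => rfl).congr
    (.of_forall fun t _ => ?_)
  have hmul := (hasFDerivAt_fst (𝕜 := ℝ) (p := (extend f t, extend g t))).mul'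
    (hasFDerivAt_snd (𝕜 := ℝ))
  refine (DFunLike.congr_fun hmul.fderiv _).trans ?_
  simp [add_comm]

theorem pow_succ {f : C(unitInterval, ℝ)} {a : ℝ → ℝ} (hf : IsPrimitive f a) (n : ℕ) :
    IsPrimitive (f ^ (n + 1)) fun t => (n + 1) * extend f t ^ n * a t := by
  refine (hf.comp_contDiff (contDiff_id.pow (n + 1)) fun _ => rfl).congr
    (.of_forall fun t _ => ?_)
  simp [mul_comm]

end IsPrimitive

/-! ### Velocities -/

section Velocity

variable {q : ℝ≥0∞}

theorem velocity_add_ae (σ τ : Curve q) : ∀ᵐ t, t ∈ Set.Ioo (0 : ℝ) 1 →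
    velocity (σ + τ) t = velocity σ t + velocity τ t :=
  (ae_restrict_iff' measurableSet_Ioo).1 (deriv_ext_add σ.2.1 τ.2.1)

theorem velocity_smul_ae (c : ℝ) (σ : Curve q) : ∀ᵐ t, t ∈ Set.Ioo (0 : ℝ) 1 →
    velocity (c • σ) t = c • velocity σ t :=
  (ae_restrict_iff' measurableSet_Ioo).1 (deriv_ext_smul c σ.2.1)

theorem hasDerivAt_ext_ae (σ : Curve q) : ∀ᵐ t, t ∈ Set.Ioo (0 : ℝ) 1 →
    HasDerivAt (ext σ) (velocity σ t) t := by
  filter_upwards [(ae_restrict_iff' measurableSet_Ioo).1 (ae_differentiableAt_ext σ.2.1)]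
    with t h ht
  exact (h ht).hasDerivAt

theorem continuous_curve (σ : Curve q) : Continuous (σ : unitInterval → Spacetime) := by
  have h := σ.2.1.continuousOn
  rw [Set.uIcc_of_le zero_le_one, continuousOn_iff_continuous_domRestrict] at h
  refine h.congr fun t => ?_
  simp [ext]

theorem isProbabilityMeasure_Ioo : IsProbabilityMeasure (volume.restrict (Set.Ioo (0 : ℝ) 1)) :=
  ⟨by simp⟩

variable [hq : Fact (1 ≤ q)]

theorem integrable_velocity (σ : Curve q) :
    Integrable (velocity σ) (volume.restrict (Set.Ioo (0 : ℝ) 1)) :=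
  have := isProbabilityMeasure_Ioo
  memLp_one_iff_integrable.1 ((memLp_velocity σ).mono_exponent hq.out)

theorem intervalIntegrable_velocity (σ : Curve q) :
    IntervalIntegrable (velocity σ) volume 0 1 := by
  rw [intervalIntegrable_iff_integrableOn_Ioo_of_le zero_le_one]
  exact integrable_velocity σ

theorem intervalIntegrable_velocity_apply (σ : Curve q) (μ : Fin 4) :
    IntervalIntegrable (fun t => velocity σ t μ) volume 0 1 := by
  have h := intervalIntegrable_velocity σ
  exact ⟨(EuclideanSpace.proj (𝕜 := ℝ) μ).integrable_comp h.1,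
    (EuclideanSpace.proj (𝕜 := ℝ) μ).integrable_comp h.2⟩

theorem integral_norm_velocity_le (σ : Curve q) : ∫ t in (0 : ℝ)..1, ‖velocity σ t‖ ≤ ‖σ‖ := by
  have := isProbabilityMeasure_Ioo
  have hnorm : ‖σ‖ = (eLpNorm (velocity σ) q (volume.restrict (Set.Ioo (0 : ℝ) 1))).toReal :=
    Lp.norm_toLp _ (memLp_velocity σ)
  rw [hnorm, intervalIntegral.integral_of_le zero_le_one, integral_Ioc_eq_integral_Ioo,
    integral_norm_eq_lintegral_enorm (integrable_velocity σ).1, ← eLpNorm_one_eq_lintegral_enorm]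
  exact ENNReal.toReal_mono (memLp_velocity σ).2.ne
    (eLpNorm_le_eLpNorm_of_exponent_le hq.out (integrable_velocity σ).1)

theorem isPrimitive_curve (σ : Curve q) :
    IsPrimitive ⟨σ, continuous_curve σ⟩ (velocity σ) :=
  .of_ae_hasDerivAt σ.2.1 (intervalIntegrable_velocity σ) (hasDerivAt_ext_ae σ)

/-- The embedding of the Sobolev curves into the continuous curves. -/
def toContinuousMap : Curve q →L[ℝ] C(unitInterval, Spacetime) :=
  LinearMap.mkContinuous
    { toFun := fun σ => ⟨σ, continuous_curve σ⟩
      map_add' := fun _ _ => rfl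
      map_smul' := fun _ _ => rfl } 1 fun σ =>
    ((isPrimitive_curve σ).norm_le σ.2.2.1 (intervalIntegrable_velocity σ).norm
      fun _ _ => le_rfl).trans <| by simpa using integral_norm_velocity_le σ

theorem isPrimitive_toContinuousMap (σ : Curve q) :
    IsPrimitive (toContinuousMap σ) (velocity σ) := isPrimitive_curve σ

/-- The coordinate `v^μ` of a curve `v`, with values in the scalar multiples of `1 : R`. -/
def coord {R : Type*} [NormedRing R] [NormedAlgebra ℝ R] (μ : Fin 4) :
    Curve q →L[ℝ] C(unitInterval, R) :=
  (((EuclideanSpace.proj (𝕜 := ℝ) μ).smulRight 1).compLeftContinuous ℝ unitInterval).comp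
    toContinuousMap

section Coord

variable {R : Type*} [NormedRing R] [NormedAlgebra ℝ R] (μ : Fin 4) (v : Curve q)

theorem coord_apply (t : unitInterval) : coord (R := R) μ v t = v t μ • (1 : R) := rfl

theorem extend_coord (t : ℝ) : extend (coord (R := R) μ v) t = ext v t μ • (1 : R) := rfl

theorem coord_apply_zero : coord (R := R) μ v 0 = 0 := by
  rw [coord_apply, show v 0 = 0 from v.2.2.1, PiLp.zero_apply, zero_smul]

theorem isPrimitive_coord [CompleteSpace R] :
    IsPrimitive (coord (R := R) μ v) fun s => velocity v s μ • 1 :=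
  (isPrimitive_toContinuousMap v).map ((EuclideanSpace.proj (𝕜 := ℝ) μ).smulRight 1) fun _ => rfl

end Coord

end Velocity

/-! ### Integration along a curve -/

section Integration

variable {q : ℝ≥0∞} {V : Type*} [NormedAddCommGroup V] [NormedSpace ℝ V]

theorem norm_velocity_smul_le (σ : Curve q) (μ : Fin 4) (g : C(unitInterval, V)) (t : ℝ) :
    ‖velocity σ t μ • extend g t‖ ≤ ‖velocity σ t‖ * ‖extend g t‖ := by
  rw [norm_smul]
  gcongr
  exact PiLp.norm_apply_le _ _

variable [Fact (1 ≤ q)]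

theorem intervalIntegrable_velocity_smul (σ : Curve q) (μ : Fin 4) (g : C(unitInterval, V)) :
    IntervalIntegrable (fun t => velocity σ t μ • extend g t) volume 0 1 :=
  (intervalIntegrable_velocity_apply σ μ).smul_continuousOn (extend g).continuous.continuousOn

theorem norm_primitive_velocity_smul_le (σ : Curve q) (μ : Fin 4) (g : C(unitInterval, V)) :
    ‖primitive _ (intervalIntegrable_velocity_smul σ μ g)‖ ≤ ‖σ‖ * ‖g‖ := by
  refine ((isPrimitive_primitive _).norm_le (primitive_zero _)
    ((intervalIntegrable_velocity σ).norm.mul_const ‖g‖) fun t _ => ?_).trans ?_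
  · exact (norm_velocity_smul_le σ μ g t).trans
      (mul_le_mul_of_nonneg_left (g.norm_coe_le_norm _) (norm_nonneg _))
  · rw [intervalIntegral.integral_mul_const]
    exact mul_le_mul_of_nonneg_right (integral_norm_velocity_le σ) (norm_nonneg _)

/-- The bounded bilinear map `(σ, g) ↦ (t ↦ ∫_0^t σ̇^μ(s) g(s) ds)`. -/
def integralAlong (μ : Fin 4) : Curve q →L[ℝ] C(unitInterval, V) →L[ℝ] C(unitInterval, V) :=
  LinearMap.mkContinuous₂
    (LinearMap.mk₂ ℝ (fun σ g => primitive _ (intervalIntegrable_velocity_smul σ μ g))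
      (fun σ τ g => by
        refine IsPrimitive.eq ((isPrimitive_primitive _).congr ?_)
          ((isPrimitive_primitive _).add (isPrimitive_primitive _)) (by simp [primitive_zero])
        filter_upwards [velocity_add_ae σ τ] with t h ht
        simp [h ht, add_smul])
      (fun c σ g => by
        refine IsPrimitive.eq ((isPrimitive_primitive _).congr ?_)
          ((isPrimitive_primitive _).smul c) (by simp [primitive_zero])
        filter_upwards [velocity_smul_ae c σ] with t h ht
        simp [h ht, smul_smul])
      (fun σ g h => IsPrimitive.eq
        ((isPrimitive_primitive _).congr (.of_forall fun t _ => smul_add (velocity σ t μ) _ _))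
        ((isPrimitive_primitive _).add (isPrimitive_primitive _)) (by simp [primitive_zero]))
      (fun c σ g => IsPrimitive.eq
        ((isPrimitive_primitive _).congr (.of_forall fun t _ => smul_comm (velocity σ t μ) c _))
        ((isPrimitive_primitive _).smul c) (by simp [primitive_zero])))
    1 fun σ g => by simpa using norm_primitive_velocity_smul_le σ μ g

variable (μ : Fin 4) (σ : Curve q) (g : C(unitInterval, V))

theorem isPrimitive_integralAlong :
    IsPrimitive (integralAlong μ σ g) fun s => velocity σ s μ • extend g s :=
  isPrimitive_primitive (intervalIntegrable_velocity_smul σ μ g)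

theorem integralAlong_apply_zero : integralAlong μ σ g 0 = 0 :=
  primitive_zero (intervalIntegrable_velocity_smul σ μ g)

end Integration

/-! ### Smoothness of composition operators -/

section Composition

universe u

variable {K : Type*} [TopologicalSpace K] [CompactSpace K] {E G : Type u} [NormedAddCommGroup E]
  [NormedSpace ℝ E] [NormedAddCommGroup G] [NormedSpace ℝ G]

/-- The pointwise application of a continuous family of operators to a continuous function. -/
def pointwiseApply : C(K, E →L[ℝ] G) →L[ℝ] C(K, E) →L[ℝ] C(K, G) :=
  LinearMap.mkContinuous₂
    (LinearMap.mk₂ ℝ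
      (fun (T : C(K, E →L[ℝ] G)) (h : C(K, E)) =>
        (⟨fun t => T t (h t), T.continuous.clm_apply h.continuous⟩ : C(K, G)))
      (fun _ _ _ => rfl) (fun _ _ _ => rfl)
      (fun T _ _ => ContinuousMap.ext fun t => map_add (T t) _ _)
      (fun c T _ => ContinuousMap.ext fun t => map_smul (T t) c _))
    1 fun T h => by
      rw [one_mul]
      refine (ContinuousMap.norm_le _ (by positivity)).2 fun t => ?_
      exact (T t).le_of_opNorm_le_of_le (T.norm_coe_le_norm t) (h.norm_coe_le_norm t)

theorem pointwiseApply_apply (T : C(K, E →L[ℝ] G)) (h : C(K, E)) (t : K) :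
    pointwiseApply T h t = T t (h t) := rfl

theorem hasFDerivAt_comp_left {F : C(E, G)} {F' : C(E, E →L[ℝ] G)}
    (hF : ∀ x, HasFDerivAt F (F' x) x) (f : C(K, E)) :
    HasFDerivAt (fun f : C(K, E) => F.comp f) (pointwiseApply (F'.comp f)) f := by
  refine .of_isLittleO (Asymptotics.IsLittleO.of_bound fun c hc => ?_)
  obtain ⟨δ, hδ, hF'⟩ : ∃ δ > 0, ∀ t : K, ∀ x, dist x (f t) < δ → dist (F' x) (F' (f t)) ≤ c := by
    obtain ⟨δ, hδ, h⟩ := Metric.mem_uniformity_dist.1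
      ((isCompact_range f.continuous).uniformContinuousAt_of_continuousAt F'
        (fun x _ => F'.continuous.continuousAt) (Metric.dist_mem_uniformity hc))
    refine ⟨δ, hδ, fun t x hx => ?_⟩
    rw [dist_comm]
    exact (h (dist_comm x (f t) ▸ hx) (Set.mem_range_self t)).le
  filter_upwards [Metric.ball_mem_nhds f hδ] with g hg
  refine (ContinuousMap.norm_le _ (by positivity)).2 fun t => ?_
  have hgt : ‖g t - f t‖ ≤ ‖g - f‖ := (g - f).norm_coe_le_norm t
  refine le_trans ?_ (mul_le_mul_of_nonneg_left hgt hc.le)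
  exact (convex_ball (f t) δ).norm_image_sub_le_of_norm_hasFDerivWithin_le'
    (fun x _ => (hF x).hasFDerivWithinAt)
    (fun x hx => by simpa [dist_eq_norm] using hF' t x hx) (Metric.mem_ball_self hδ)
    ((ContinuousMap.dist_apply_le_dist t).trans_lt hg)

theorem contDiff_comp_left {F : C(E, G)} {n : ℕ} (hF : ContDiff ℝ n F) :
    ContDiff ℝ n fun f : C(K, E) => F.comp f := by
  induction n generalizing G with
  | zero => exact contDiff_zero.2 F.continuous_postcomp
  | succ n ih =>
    rw [Nat.cast_succ, contDiff_succ_iff_hasFDerivAt] at hF ⊢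
    obtain ⟨F', hF', hderiv⟩ := hF
    exact ⟨_, pointwiseApply.contDiff.comp (ih (F := ⟨F', hF'.continuous⟩) hF'),
      hasFDerivAt_comp_left hderiv⟩

end Composition

section PartialDerivatives

variable {R : Type*} [NormedAddCommGroup R] [NormedSpace ℝ R]

/-- The partial derivative `∂_μ f` of a function with values in any normed space. -/
def pderiv (μ : Fin 4) (f : Spacetime → R) (x : Spacetime) : R := fderiv ℝ f x (p μ)

theorem contDiff_pderiv {f : Spacetime → R} (hf : ContDiff ℝ ∞ f) (μ : Fin 4) :
    ContDiff ℝ ∞ (pderiv μ f) :=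
  (hf.fderiv_right (m := ∞) (by simp)).clm_apply contDiff_const

theorem fderiv_apply_eq_sum_pderiv (f : Spacetime → R) (x v : Spacetime) :
    fderiv ℝ f x v = ∑ μ, v μ • pderiv μ f x := by
  have hv : v = ∑ μ, v μ • p μ := by
    ext i
    simp [p, Pi.single_apply]
  conv_lhs => rw [hv]
  simp [pderiv, map_sum]

end PartialDerivatives

section Pull

variable {q : ℝ≥0∞} [Fact (1 ≤ q)] {R : Type*} [NormedAddCommGroup R]

/-- The composition `f ∘ σ` as a continuous function on `[0,1]`; it is set to `0` if `f ∘ σ` is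
not continuous. -/
def pull (f : Spacetime → R) (σ : Curve q) : C(unitInterval, R) :=
  ContinuousMap.mkD (fun t => f (toContinuousMap σ t)) 0

theorem pull_eq_comp {f : Spacetime → R} (hf : Continuous f) (σ : Curve q) :
    pull f σ = (⟨f, hf⟩ : C(Spacetime, R)).comp (toContinuousMap σ) :=
  ContinuousMap.mkD_of_continuous (hf.comp (toContinuousMap σ).continuous)

theorem pull_apply {f : Spacetime → R} (hf : Continuous f) (σ : Curve q) (t : unitInterval) :
    pull f σ t = f (σ t) := by
  rw [pull_eq_comp hf]
  rfl

theorem extend_pull {f : Spacetime → R} (hf : Continuous f) (σ : Curve q) (t : ℝ) :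
    extend (pull f σ) t = f (ext σ t) :=
  pull_apply hf σ _

theorem isPrimitive_pull [NormedSpace ℝ R] [CompleteSpace R] {f : Spacetime → R}
    (hf : ContDiff ℝ ∞ f) (σ : Curve q) :
    IsPrimitive (pull f σ) fun s => ∑ μ, velocity σ s μ • extend (pull (pderiv μ f) σ) s := by
  refine ((isPrimitive_toContinuousMap σ).comp_contDiff (hf.of_le (by simp))
    (pull_apply hf.continuous σ)).congr (.of_forall fun t _ => ?_)
  simp only [extend_pull (contDiff_pderiv hf _).continuous]
  exact fderiv_apply_eq_sum_pderiv f _ _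

end Pull

section PullDeriv

variable {q : ℝ≥0∞} [Fact (1 ≤ q)]

theorem contDiff_pull {R : Type} [NormedAddCommGroup R] [NormedSpace ℝ R] {f : Spacetime → R}
    (hf : ContDiff ℝ ∞ f) (n : ℕ) : ContDiff ℝ n (pull (q := q) f) := by
  rw [show pull (q := q) f = fun σ => (⟨f, hf.continuous⟩ : C(Spacetime, R)).comp
    (toContinuousMap σ) from funext (pull_eq_comp hf.continuous)]
  exact (contDiff_comp_left (hf.of_le (by exact_mod_cast le_top))).comp toContinuousMap.contDiff

theorem hasFDerivAt_pull {R : Type} [NormedAddCommGroup R] [NormedSpace ℝ R] {f : Spacetime → R}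
    (hf : ContDiff ℝ ∞ f) (σ : Curve q) : HasFDerivAt (pull f) (fderiv ℝ (pull f) σ) σ :=
  ((contDiff_pull hf 1).differentiable (by simp) σ).hasFDerivAt

theorem fderiv_pull_apply {R : Type} [NormedRing R] [NormedAlgebra ℝ R] {f : Spacetime → R}
    (hf : ContDiff ℝ ∞ f) (σ v : Curve q) :
    fderiv ℝ (pull f) σ v = ∑ μ, pull (pderiv μ f) σ * coord μ v := by
  let F : C(Spacetime, R) := ⟨f, hf.continuous⟩
  let F' : C(Spacetime, Spacetime →L[ℝ] R) := ⟨fderiv ℝ f, hf.continuous_fderiv (by simp)⟩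
  have hF : ∀ x, HasFDerivAt F (F' x) x := fun x => (hf.differentiable (by simp) x).hasFDerivAt
  have hpull : HasFDerivAt (pull f)
      ((pointwiseApply (F'.comp (toContinuousMap σ))).comp toContinuousMap) σ := by
    rw [show pull (q := q) f = fun σ => F.comp (toContinuousMap σ) from
      funext (pull_eq_comp hf.continuous)]
    exact (hasFDerivAt_comp_left hF _).comp σ toContinuousMap.hasFDerivAt
  rw [hpull.fderiv]
  ext t
  simp only [ContinuousMap.sum_apply, ContinuousMap.mul_apply, coord_apply, mul_smul_comm, mul_one,
    pull_apply (contDiff_pderiv hf _).continuous]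
  exact fderiv_apply_eq_sum_pderiv f (σ t) (v t)

end PullDeriv

/-! ### Linear differential equations along a curve -/

section Operators

variable {E : Type*} [NormedAddCommGroup E] [NormedSpace ℝ E]

theorem isUnit_one_sub_of_norm_pow_lt_one {R : Type*} [NormedRing R] [HasSummableGeomSeries R]
    {x : R} {n : ℕ} (h : ‖x ^ n‖ < 1) : IsUnit (1 - x) := by
  have hfactor : (1 - x) * ∑ i ∈ Finset.range n, x ^ i = 1 - x ^ n := mul_neg_geom_sum x n
  have hcomm : Commute (1 - x) (∑ i ∈ Finset.range n, x ^ i) :=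
    .sum_right _ _ _ fun i _ => ((Commute.one_left x).sub_left (.refl x)).pow_right i
  exact (hcomm.isUnit_mul_iff.1 (hfactor ▸ isUnit_one_sub_of_norm_lt_one h)).1

theorem contDiff_ringInverse_comp {R : Type*} [NormedRing R] [NormedAlgebra ℝ R]
    [HasSummableGeomSeries R] {f : E → R} {n : ℕ∞ω} (hf : ContDiff ℝ n f)
    (hunit : ∀ x, IsUnit (f x)) : ContDiff ℝ n fun x => Ring.inverse (f x) := by
  refine contDiff_iff_contDiffAt.2 fun x => ?_
  obtain ⟨u, hu⟩ := hunit x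
  exact (hu ▸ contDiffAt_ringInverse ℝ u).comp x hf.contDiffAt

variable {V : Type*} [NormedAddCommGroup V] [NormedSpace ℝ V]
  {T : C(unitInterval, V) →L[ℝ] C(unitInterval, V)} {k : ℝ → ℝ}

theorem norm_pow_apply_le_of_norm_apply_le_integral (hk : IntervalIntegrable k volume 0 1)
    (hk0 : ∀ t, 0 ≤ k t)
    (hT : ∀ g (t : unitInterval), ‖T g t‖ ≤ ∫ s in (0 : ℝ)..t, k s * ‖extend g s‖)
    (n : ℕ) (g : C(unitInterval, V)) (t : unitInterval) :
    ‖(T ^ n) g t‖ ≤ primitive k hk t ^ n / n.factorial * ‖g‖ := by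
  induction n generalizing t with
  | zero => simpa using g.norm_coe_le_norm t
  | succ n ih =>
    have hpow := ((isPrimitive_primitive hk).pow_succ n).eq_add t
    simp only [ContinuousMap.pow_apply, primitive_zero, zero_pow n.succ_ne_zero, zero_add] at hpow
    calc ‖(T ^ (n + 1)) g t‖
      _ = ‖T ((T ^ n) g) t‖ := by rw [pow_succ', mul_apply_eq_comp]
      _ ≤ ∫ s in (0 : ℝ)..t, k s * ‖extend ((T ^ n) g) s‖ := hT _ t
      _ ≤ ∫ s in (0 : ℝ)..t, k s * (extend (primitive k hk) s ^ n / n.factorial * ‖g‖) := by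
        have hkt := hk.mono_set (uIcc_zero_coe_subset t)
        refine intervalIntegral.integral_mono_on t.2.1
          (hkt.mul_continuousOn (by fun_prop)) (hkt.mul_continuousOn (by fun_prop)) fun s _ => ?_
        exact mul_le_mul_of_nonneg_left (ih _) (hk0 s)
      _ = primitive k hk t ^ (n + 1) / (n + 1).factorial * ‖g‖ := by
        rw [hpow, Nat.factorial_succ, div_mul_eq_mul_div, ← intervalIntegral.integral_mul_const,
          ← intervalIntegral.integral_div]
        refine intervalIntegral.integral_congr fun s _ => ?_
        push_cast
        field_simp

theorem isUnit_one_sub_of_norm_apply_le_integral [CompleteSpace V]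
    (hk : IntervalIntegrable k volume 0 1) (hk0 : ∀ t, 0 ≤ k t)
    (hT : ∀ g (t : unitInterval), ‖T g t‖ ≤ ∫ s in (0 : ℝ)..t, k s * ‖extend g s‖) :
    IsUnit (1 - T) := by
  obtain ⟨n, hn⟩ := ((FloorSemiring.tendsto_pow_div_factorial_atTop
    (‖primitive k hk‖)).eventually_lt_const (zero_lt_one)).exists
  refine isUnit_one_sub_of_norm_pow_lt_one (n := n) (x := T) (lt_of_le_of_lt ?_ hn)
  refine ContinuousLinearMap.opNorm_le_bound _ (by positivity) fun g => ?_
  refine (ContinuousMap.norm_le _ (by positivity)).2 fun t => ?_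
  refine (norm_pow_apply_le_of_norm_apply_le_integral hk hk0 hT n g t).trans ?_
  gcongr
  · exact intervalIntegral.integral_nonneg t.2.1 fun s _ => hk0 s
  · exact (le_abs_self _).trans ((primitive k hk).norm_coe_le_norm t)

end Operators

section Volterra

variable {q : ℝ≥0∞} [Fact (1 ≤ q)] {V : Type*} [NormedAddCommGroup V] [NormedSpace ℝ V]

/-- The Volterra operator `g ↦ (t ↦ ∑ ν, ∫_0^t σ̇^ν(s) B_ν(s) g(s) ds)`. -/
def volterra (B : Fin 4 → C(unitInterval, V →L[ℝ] V)) (σ : Curve q) :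
    C(unitInterval, V) →L[ℝ] C(unitInterval, V) :=
  ∑ ν, (integralAlong ν σ).comp (pointwiseApply (B ν))

variable (B : Fin 4 → C(unitInterval, V →L[ℝ] V)) (σ : Curve q)

theorem volterra_apply (g : C(unitInterval, V)) :
    volterra B σ g = ∑ ν, integralAlong ν σ (pointwiseApply (B ν) g) := by
  simp [volterra]

theorem isPrimitive_volterra (g : C(unitInterval, V)) :
    IsPrimitive (volterra B σ g)
      fun s => ∑ ν, velocity σ s ν • extend (B ν) s (extend g s) := by
  rw [volterra_apply]
  exact (IsPrimitive.sum _ fun ν _ => isPrimitive_integralAlong ν σ _).congr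
    (.of_forall fun t _ => by simp [extend_apply, pointwiseApply_apply])

theorem volterra_apply_zero (g : C(unitInterval, V)) : volterra B σ g 0 = 0 := by
  simp [volterra_apply, integralAlong_apply_zero]

theorem norm_volterra_apply_le (g : C(unitInterval, V)) (t : unitInterval) :
    ‖volterra B σ g t‖ ≤
      ∫ s in (0 : ℝ)..t, (∑ ν, ‖B ν‖) * ‖velocity σ s‖ * ‖extend g s‖ := by
  refine (isPrimitive_volterra B σ g).norm_apply_le (volterra_apply_zero B σ g) ?_ ?_ t
  · exact ((intervalIntegrable_velocity σ).norm.const_mul _).mul_continuousOn (by fun_prop)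
  · refine fun s _ => (norm_sum_le _ _).trans ?_
    rw [mul_assoc, Finset.sum_mul]
    refine Finset.sum_le_sum fun ν _ => ?_
    calc ‖velocity σ s ν • extend (B ν) s (extend g s)‖
      _ ≤ ‖velocity σ s‖ * (‖B ν‖ * ‖extend g s‖) := by
        rw [norm_smul]
        gcongr
        · exact PiLp.norm_apply_le _ _
        · exact (extend (B ν) s).le_of_opNorm_le ((B ν).norm_coe_le_norm _) _
      _ = ‖B ν‖ * (‖velocity σ s‖ * ‖extend g s‖) := by ring

variable [CompleteSpace V]

theorem isUnit_one_sub_volterra : IsUnit (1 - volterra B σ) :=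
  isUnit_one_sub_of_norm_apply_le_integral ((intervalIntegrable_velocity σ).norm.const_mul _)
    (fun _ => by positivity) (norm_volterra_apply_le B σ)

/-- The solution of the Cauchy problem `g' = ∑ ν, σ̇^ν B_ν g`, `g(0) = c`. -/
def solution (c : V) : C(unitInterval, V) :=
  Ring.inverse (1 - volterra B σ) (.const _ c)

variable {B σ}

theorem solution_eq (c : V) : solution B σ c = .const _ c + volterra B σ (solution B σ c) := by
  have h := congrArg (fun T => T (.const _ c))
    (Ring.mul_inverse_cancel _ (isUnit_one_sub_volterra B σ))
  exact sub_eq_iff_eq_add.1 h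

theorem solution_apply_zero (c : V) : solution B σ c 0 = c := by
  rw [solution_eq, ContinuousMap.add_apply, volterra_apply_zero, add_zero,
    ContinuousMap.const_apply]

theorem isPrimitive_solution (c : V) : IsPrimitive (solution B σ c)
    fun s => ∑ ν, velocity σ s ν • extend (B ν) s (extend (solution B σ c) s) := by
  have h := (IsPrimitive.const c).add (isPrimitive_volterra B σ (solution B σ c))
  rw [← solution_eq, zero_add] at h
  exact h

theorem eq_of_sub_volterra_eq {f g : C(unitInterval, V)}
    (h : f - volterra B σ f = g - volterra B σ g) : f = g := by
  have hinv (f) : Ring.inverse (1 - volterra B σ) (f - volterra B σ f) = f :=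
    congrArg (fun T => T f) (Ring.inverse_mul_cancel _ (isUnit_one_sub_volterra B σ))
  rw [← hinv f, h, hinv]

theorem eq_of_isPrimitive_linear {b : ℝ → V} {f g : C(unitInterval, V)}
    (hf : IsPrimitive f fun s => b s + ∑ ν, velocity σ s ν • extend (B ν) s (extend f s))
    (hg : IsPrimitive g fun s => b s + ∑ ν, velocity σ s ν • extend (B ν) s (extend g s))
    (h0 : f 0 = g 0) : f = g := by
  refine eq_of_sub_volterra_eq (B := B) (σ := σ) (IsPrimitive.eq (a := b) ?_ ?_ ?_)
  · rw [sub_eq_add_neg]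
    exact (hf.add (isPrimitive_volterra B σ f).neg).congr (.of_forall fun t _ => by simp)
  · rw [sub_eq_add_neg]
    exact (hg.add (isPrimitive_volterra B σ g).neg).congr (.of_forall fun t _ => by simp)
  · simp [volterra_apply_zero, h0]

theorem contDiff_solution {n : ℕ∞ω} {B : Curve q → Fin 4 → C(unitInterval, V →L[ℝ] V)}
    (hB : ∀ ν, ContDiff ℝ n fun σ => B σ ν) (c : V) :
    ContDiff ℝ n fun σ => solution (B σ) σ c := by
  have hvolterra : ContDiff ℝ n fun σ => 1 - volterra (B σ) σ :=
    contDiff_const.sub <| ContDiff.sum fun ν _ =>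
      (integralAlong ν).contDiff.clm_comp (pointwiseApply.contDiff.comp (hB ν))
  exact (contDiff_ringInverse_comp hvolterra fun σ => isUnit_one_sub_volterra _ σ).clm_apply
    contDiff_const

end Volterra

/-! ### Parallel transport -/

section Multiplication

variable {K : Type*} [TopologicalSpace K] [CompactSpace K] {R : Type*} [NormedRing R]
  [NormedAlgebra ℝ R]

/-- The family of operators of left multiplication by the values of a function. -/
def leftMul : C(K, R) →L[ℝ] C(K, R →L[ℝ] R) :=
  (ContinuousLinearMap.mul ℝ R).compLeftContinuous ℝ K

/-- The family of operators of right multiplication by the values of a function. -/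
def rightMul : C(K, R) →L[ℝ] C(K, R →L[ℝ] R) :=
  (ContinuousLinearMap.mul ℝ R).flip.compLeftContinuous ℝ K

theorem contDiff_leftMul {n : ℕ∞ω} : ContDiff ℝ n (leftMul (K := K) (R := R)) :=
  ContinuousLinearMap.contDiff _

theorem contDiff_rightMul {n : ℕ∞ω} : ContDiff ℝ n (rightMul (K := K) (R := R)) :=
  ContinuousLinearMap.contDiff _

end Multiplication

section Transport

variable {q : ℝ≥0∞} [Fact (1 ≤ q)] {R : Type*} [NormedRing R] [NormedAlgebra ℝ R]

/-- The density `A_ν(σ) σ̇^ν` of the connection form along `σ`. -/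
def connectionDensity (A : Fin 4 → Spacetime → R) (σ : Curve q) (s : ℝ) : R :=
  ∑ ν, velocity σ s ν • extend (pull (A ν) σ) s

theorem sum_velocity_smul_leftMul_neg (A : Fin 4 → Spacetime → R) (σ : Curve q) (s : ℝ) (x : R) :
    ∑ ν, velocity σ s ν • extend (leftMul (-pull (A ν) σ)) s x
      = -(connectionDensity A σ s * x) := by
  simp only [connectionDensity, Finset.sum_mul, smul_mul_assoc, ← Finset.sum_neg_distrib,
    ← smul_neg, ← neg_mul]
  rfl

theorem sum_velocity_smul_rightMul (A : Fin 4 → Spacetime → R) (σ : Curve q) (s : ℝ) (x : R) :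
    ∑ ν, velocity σ s ν • extend (rightMul (pull (A ν) σ)) s x = x * connectionDensity A σ s := by
  simp only [connectionDensity, Finset.mul_sum, mul_smul_comm]
  rfl

variable [CompleteSpace R]

/-- The parallel transport `t ↦ U_{t,0}`, the solution of `U' = -A_ν(σ) σ̇^ν U`, `U(0) = 1`. -/
def transportMap (A : Fin 4 → Spacetime → R) (σ : Curve q) : C(unitInterval, R) :=
  solution (fun ν => leftMul (-pull (A ν) σ)) σ 1

/-- The inverse parallel transport `t ↦ U_{0,t}`, the solution of `V' = V A_ν(σ) σ̇^ν`,
`V(0) = 1`. -/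
def invTransport (A : Fin 4 → Spacetime → R) (σ : Curve q) : C(unitInterval, R) :=
  solution (fun ν => rightMul (pull (A ν) σ)) σ 1

variable (A : Fin 4 → Spacetime → R) (σ : Curve q)

theorem transportMap_apply_zero : transportMap A σ 0 = 1 := solution_apply_zero 1

theorem invTransport_apply_zero : invTransport A σ 0 = 1 := solution_apply_zero 1

theorem isPrimitive_transportMap : IsPrimitive (transportMap A σ)
    fun s => -(connectionDensity A σ s * extend (transportMap A σ) s) :=
  (isPrimitive_solution 1).congr (.of_forall fun _ _ => sum_velocity_smul_leftMul_neg ..)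

theorem isPrimitive_invTransport : IsPrimitive (invTransport A σ)
    fun s => extend (invTransport A σ) s * connectionDensity A σ s :=
  (isPrimitive_solution 1).congr (.of_forall fun _ _ => sum_velocity_smul_rightMul ..)

theorem invTransport_mul_transportMap : invTransport A σ * transportMap A σ = 1 := by
  refine IsPrimitive.eq (((isPrimitive_invTransport A σ).mul (isPrimitive_transportMap A σ)).congr
    (.of_forall fun t _ => ?_)) (.const 1) ?_
  · simp [mul_assoc]
  · simp [transportMap_apply_zero, invTransport_apply_zero]

theorem transportMap_mul_invTransport : transportMap A σ * invTransport A σ = 1 := by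
  -- Both sides solve `W' = W a - a W`, where `a` is the connection density.
  have hcommutator (s : ℝ) (x : R) : ∑ ν, velocity σ s ν •
      extend (leftMul (-pull (A ν) σ) + rightMul (pull (A ν) σ)) s x =
        -(connectionDensity A σ s * x) + x * connectionDensity A σ s := by
    rw [← sum_velocity_smul_leftMul_neg, ← sum_velocity_smul_rightMul, ← Finset.sum_add_distrib]
    exact Finset.sum_congr rfl fun ν _ => smul_add ..
  refine eq_of_isPrimitive_linear (b := 0)
    (B := fun ν => leftMul (-pull (A ν) σ) + rightMul (pull (A ν) σ)) (σ := σ) ?_ ?_ ?_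
  · refine ((isPrimitive_transportMap A σ).mul (isPrimitive_invTransport A σ)).congr
      (.of_forall fun t _ => ?_)
    rw [hcommutator, Pi.zero_apply, zero_add, extend_mul]
    simp only [neg_mul, mul_assoc]
  · refine (IsPrimitive.const 1).congr (.of_forall fun t _ => ?_)
    rw [hcommutator, Pi.zero_apply, zero_add, extend_one, mul_one, one_mul, neg_add_cancel]
  · simp [transportMap_apply_zero, invTransport_apply_zero]

end Transport

section TransportSmooth

variable {q : ℝ≥0∞} [Fact (1 ≤ q)] {R : Type} [NormedRing R] [NormedAlgebra ℝ R] [CompleteSpace R]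
  {A : Fin 4 → Spacetime → R} (hA : ∀ μ, ContDiff ℝ ∞ (A μ))
include hA

theorem contDiff_transportMap (n : ℕ) : ContDiff ℝ n (transportMap (q := q) A) := by
  have hB (ν : Fin 4) : ContDiff ℝ n fun σ : Curve q => leftMul (-pull (A ν) σ) :=
    contDiff_leftMul.comp (contDiff_pull (hA ν) n).neg
  exact contDiff_solution hB 1

theorem contDiff_invTransport (n : ℕ) : ContDiff ℝ n (invTransport (q := q) A) := by
  have hB (ν : Fin 4) : ContDiff ℝ n fun σ : Curve q => rightMul (pull (A ν) σ) :=
    contDiff_rightMul.comp (contDiff_pull (hA ν) n)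
  exact contDiff_solution hB 1

end TransportSmooth

/-! ### Variation of the curve -/

section Covariant

variable {R : Type*} [NormedRing R] [NormedAlgebra ℝ R]

/-- The covariant derivative `∇_μ f = ∂_μ f + [A_μ, f]`, in any normed algebra. -/
def covDeriv (A : Fin 4 → Spacetime → R) (μ : Fin 4) (f : Spacetime → R) (x : Spacetime) : R :=
  pderiv μ f x + ⁅A μ x, f x⁆

/-- The field strength `F_{μν} = ∂_μ A_ν - ∂_ν A_μ + [A_μ, A_ν]`, in any normed algebra. -/
def fieldStrength (A : Fin 4 → Spacetime → R) (μ ν : Fin 4) (x : Spacetime) : R :=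
  pderiv μ (A ν) x - pderiv ν (A μ) x + ⁅A μ x, A ν x⁆

theorem fieldStrength_antisymm (A : Fin 4 → Spacetime → R) (μ ν : Fin 4) :
    fieldStrength A μ ν = -fieldStrength A ν μ := by
  funext x
  simp only [fieldStrength, Pi.neg_apply, Ring.lie_def]
  abel

theorem contDiff_lie {f g : Spacetime → R} {n : ℕ∞ω} (hf : ContDiff ℝ n f) (hg : ContDiff ℝ n g) :
    ContDiff ℝ n fun x => ⁅f x, g x⁆ := by
  simp only [Ring.lie_def]
  exact (hf.mul hg).sub (hg.mul hf)

variable {A : Fin 4 → Spacetime → R} (hA : ∀ μ, ContDiff ℝ ∞ (A μ))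
include hA

theorem contDiff_covDeriv {f : Spacetime → R} (hf : ContDiff ℝ ∞ f) (μ : Fin 4) :
    ContDiff ℝ ∞ (covDeriv A μ f) :=
  (contDiff_pderiv hf μ).add (contDiff_lie (hA μ) hf)

theorem contDiff_fieldStrength (μ ν : Fin 4) : ContDiff ℝ ∞ (fieldStrength A μ ν) :=
  ((contDiff_pderiv (hA ν) μ).sub (contDiff_pderiv (hA μ) ν)).add (contDiff_lie (hA μ) (hA ν))

variable {q : ℝ≥0∞} [Fact (1 ≤ q)]

theorem pull_covDeriv {f : Spacetime → R} (hf : ContDiff ℝ ∞ f) (μ : Fin 4) (σ : Curve q) :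
    pull (covDeriv A μ f) σ = pull (pderiv μ f) σ + ⁅pull (A μ) σ, pull f σ⁆ := by
  ext t
  rw [pull_apply (contDiff_covDeriv hA hf μ).continuous, ContinuousMap.add_apply,
    pull_apply (contDiff_pderiv hf μ).continuous, covDeriv]
  simp only [Ring.lie_def, ContinuousMap.sub_apply, ContinuousMap.mul_apply,
    pull_apply (hA μ).continuous, pull_apply hf.continuous]

theorem pull_fieldStrength (μ ν : Fin 4) (σ : Curve q) :
    pull (fieldStrength A μ ν) σ = pull (pderiv μ (A ν)) σ - pull (pderiv ν (A μ)) σ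
      + ⁅pull (A μ) σ, pull (A ν) σ⁆ := by
  ext t
  rw [pull_apply (contDiff_fieldStrength hA μ ν).continuous, fieldStrength]
  simp only [Ring.lie_def, ContinuousMap.add_apply, ContinuousMap.sub_apply,
    ContinuousMap.mul_apply, pull_apply (contDiff_pderiv (hA _) _).continuous,
    pull_apply (hA _).continuous]

end Covariant

section Contraction

variable {q : ℝ≥0∞} [Fact (1 ≤ q)] {R : Type*} [NormedRing R] [NormedAlgebra ℝ R]

/-- The contraction `A_μ(σ) u^μ` of the connection form with a vector field `u` along `σ`. -/
def contraction (A : Fin 4 → Spacetime → R) (σ u : Curve q) : C(unitInterval, R) :=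
  ∑ μ, pull (A μ) σ * coord μ u

/-- The derivative `A_ν(σ) u̇^ν + ∂_μ A_ν(σ) u^μ σ̇^ν` of the density `A_ν(σ) σ̇^ν` in the
direction `u`. -/
def connectionVariation (A : Fin 4 → Spacetime → R) (σ u : Curve q) (s : ℝ) : R :=
  ∑ ν, (velocity u s ν • extend (pull (A ν) σ) s
    + velocity σ s ν • ∑ μ, ext u s μ • extend (pull (pderiv μ (A ν)) σ) s)

/-- The density `F_{μν}(σ) u^μ σ̇^ν`. -/
def fieldStrengthDensity (A : Fin 4 → Spacetime → R) (σ u : Curve q) (s : ℝ) : R :=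
  ∑ μ, ∑ ν, velocity σ s ν • ext u s μ • extend (pull (fieldStrength A μ ν) σ) s

theorem extend_contraction (A : Fin 4 → Spacetime → R) (σ u : Curve q) (s : ℝ) :
    extend (contraction A σ u) s = ∑ μ, ext u s μ • extend (pull (A μ) σ) s := by
  simp only [contraction, extend_apply, ContinuousMap.sum_apply, ContinuousMap.mul_apply,
    coord_apply, mul_smul_comm, mul_one]
  rfl

theorem contraction_apply_zero (A : Fin 4 → Spacetime → R) (σ u : Curve q) :
    contraction A σ u 0 = 0 := by
  simp [contraction, ContinuousMap.sum_apply, coord_apply_zero]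

theorem lie_sum_smul_sum_smul (a b : Fin 4 → ℝ) (x y : Fin 4 → R) :
    ⁅∑ μ, a μ • x μ, ∑ ν, b ν • y ν⁆ = ∑ μ, ∑ ν, b ν • a μ • ⁅x μ, y ν⁆ := by
  simp only [Ring.lie_def, Finset.sum_mul_sum, smul_sub, Finset.sum_sub_distrib, mul_smul_comm,
    smul_mul_assoc]
  congr 1
  rw [Finset.sum_comm]
  simp only [smul_comm (b _)]

/-- Cartan's formula `d(A_μ u^μ) + F(u, σ̇) = δ_u(A(σ̇)) + [A(u), A(σ̇)]` along a curve. -/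
theorem isPrimitive_contraction [CompleteSpace R] {A : Fin 4 → Spacetime → R}
    (hA : ∀ μ, ContDiff ℝ ∞ (A μ)) (σ u : Curve q) :
    IsPrimitive (contraction A σ u) fun s => connectionVariation A σ u s
      + ⁅extend (contraction A σ u) s, connectionDensity A σ s⁆
      - fieldStrengthDensity A σ u s := by
  refine (IsPrimitive.sum _ fun μ _ => (isPrimitive_pull (hA μ) σ).mul
    (isPrimitive_coord μ u)).congr (.of_forall fun t _ => ?_)
  have hF : fieldStrengthDensity A σ u t = 
      ∑ ν, velocity σ t ν • ∑ μ, ext u t μ • extend (pull (pderiv μ (A ν)) σ) t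
      - ∑ μ, ∑ ν, velocity σ t ν • ext u t μ • extend (pull (pderiv ν (A μ)) σ) t
      + ⁅extend (contraction A σ u) t, connectionDensity A σ t⁆ := by
    rw [extend_contraction, connectionDensity, lie_sum_smul_sum_smul]
    simp only [fieldStrengthDensity, pull_fieldStrength hA, Finset.smul_sum]
    rw [Finset.sum_comm (f := fun ν μ => velocity σ t ν • ext u t μ •
      extend (pull (pderiv μ (A ν)) σ) t)]
    simp only [← Finset.sum_sub_distrib, ← Finset.sum_add_distrib, ← smul_sub, ← smul_add]
    rfl
  rw [hF, connectionVariation, Finset.sum_add_distrib]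
  simp only [Finset.sum_apply, extend_coord, mul_smul_comm, mul_one, Finset.smul_sum,
    smul_comm (ext u t _) (velocity σ t _),
    Finset.sum_add_distrib]
  abel

end Contraction

section Translate

variable {q : ℝ≥0∞} [Fact (1 ≤ q)] {R : Type*} [NormedRing R] [NormedAlgebra ℝ R]

/-- The parallel translate `U_{0,t} f(σ(t)) U_{t,0}` of `f` along `σ` to its initial point. -/
def translate (A : Fin 4 → Spacetime → R) (f : Spacetime → R) (σ : Curve q) :
    C(unitInterval, R) :=
  invTransport A σ * pull f σ * transportMap A σ

/-- The density `U_{0,t} F_{μν}(σ(t)) U_{t,0} σ̇^ν(t)`. -/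
def curvatureDensity (A : Fin 4 → Spacetime → R) (σ : Curve q) (μ : Fin 4) (t : ℝ) : R :=
  ∑ ν, velocity σ t ν • extend (translate A (fieldStrength A μ ν) σ) t

/-- The function `t ↦ ∫_0^t U_{0,s} F_{μν}(σ(s)) U_{s,0} u^μ(s) σ̇^ν(s) ds`. -/
def curvatureIntegral (A : Fin 4 → Spacetime → R) (σ u : Curve q) : C(unitInterval, R) :=
  ∑ μ, ∑ ν, integralAlong ν σ (translate A (fieldStrength A μ ν) σ * coord μ u)

variable (A : Fin 4 → Spacetime → R) (σ u : Curve q)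

theorem isPrimitive_curvatureIntegral : IsPrimitive (curvatureIntegral A σ u)
    fun s => ∑ μ, ext u s μ • curvatureDensity A σ μ s := by
  refine (IsPrimitive.sum _ fun μ _ => IsPrimitive.sum _ fun ν _ =>
    isPrimitive_integralAlong ν σ _).congr (.of_forall fun t _ => ?_)
  simp only [Finset.sum_apply, extend_mul, extend_coord, curvatureDensity, mul_smul_comm, mul_one,
    Finset.smul_sum, smul_comm (ext u t _)]

theorem curvatureIntegral_apply_zero : curvatureIntegral A σ u 0 = 0 := by
  simp [curvatureIntegral, ContinuousMap.sum_apply, integralAlong_apply_zero]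

theorem transportMap_mul_sum_curvatureDensity [CompleteSpace R] (s : ℝ) :
    extend (transportMap A σ) s * ∑ μ, ext u s μ • curvatureDensity A σ μ s
      = fieldStrengthDensity A σ u s * extend (transportMap A σ) s := by
  have hcancel (f : Spacetime → R) : extend (transportMap A σ) s * extend (translate A f σ) s
      = extend (pull f σ) s * extend (transportMap A σ) s := by
    rw [← extend_mul, ← extend_mul, translate, mul_assoc, ← mul_assoc,
      transportMap_mul_invTransport, one_mul]
  simp only [fieldStrengthDensity, curvatureDensity, Finset.mul_sum, Finset.sum_mul,
    Finset.smul_sum, mul_smul_comm, smul_mul_assoc, hcancel, smul_comm (ext u s _)]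

end Translate

section FDeriv

variable {q : ℝ≥0∞} [Fact (1 ≤ q)] {R : Type} [NormedRing R] [NormedAlgebra ℝ R] [CompleteSpace R]
  {A : Fin 4 → Spacetime → R} (hA : ∀ μ, ContDiff ℝ ∞ (A μ))
include hA

theorem hasFDerivAt_transportMap (σ : Curve q) :
    HasFDerivAt (transportMap A) (fderiv ℝ (transportMap A) σ) σ :=
  ((contDiff_transportMap hA 1).differentiable (by simp) σ).hasFDerivAt

theorem hasFDerivAt_invTransport (σ : Curve q) :
    HasFDerivAt (invTransport A) (fderiv ℝ (invTransport A) σ) σ :=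
  ((contDiff_invTransport hA 1).differentiable (by simp) σ).hasFDerivAt

theorem fderiv_transportMap_eq_neg_sum (σ u : Curve q) :
    fderiv ℝ (transportMap A) σ u = -∑ ν, (integralAlong ν u (pull (A ν) σ * transportMap A σ)
      + integralAlong ν σ (contraction (fun μ => pderiv μ (A ν)) σ u * transportMap A σ
        + pull (A ν) σ * fderiv ℝ (transportMap A) σ u)) := by
  have hintegral : (fun σ : Curve q => transportMap A σ +
      ∑ ν, integralAlong ν σ (pull (A ν) σ * transportMap A σ)) = fun _ => .const _ 1 := by
    funext σ
    refine IsPrimitive.eq (((isPrimitive_transportMap A σ).add (.sum _ fun ν _ =>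
      isPrimitive_integralAlong ν σ _)).congr (.of_forall fun t _ => ?_)) (.const 1) ?_
    · simp [connectionDensity, Finset.sum_mul, extend_mul]
    · simp [ContinuousMap.sum_apply, transportMap_apply_zero, integralAlong_apply_zero]
  have hderiv := (hasFDerivAt_transportMap hA σ).add
    (HasFDerivAt.fun_sum (u := Finset.univ) fun ν _ => (integralAlong ν).hasFDerivAt.clm_apply
      ((hasFDerivAt_pull (hA ν) σ).mul' (hasFDerivAt_transportMap hA σ)))
  have happly := DFunLike.congr_fun (hderiv.unique (hintegral ▸ hasFDerivAt_const _ σ)) u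
  refine eq_neg_of_add_eq_zero_left (Eq.trans ?_ happly)
  simp only [_root_.add_apply, _root_.sum_apply, _root_.smul_apply, ContinuousLinearMap.comp_apply,
    ContinuousLinearMap.flip_apply, smul_eq_mul, op_smul_eq_mul, fderiv_pull_apply (hA _),
    contraction, Pi.mul_apply]
  congr 1
  exact Finset.sum_congr rfl fun ν _ => by rw [add_comm, add_comm (_ * _)]

theorem isPrimitive_fderiv_transportMap (σ u : Curve q) :
    IsPrimitive (fderiv ℝ (transportMap A) σ u) fun s =>
      -(connectionVariation A σ u s * extend (transportMap A σ) s)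
        + -(connectionDensity A σ s * extend (fderiv ℝ (transportMap A) σ u) s) := by
  have h := (IsPrimitive.sum Finset.univ fun ν _ =>
    (isPrimitive_integralAlong ν u (pull (A ν) σ * transportMap A σ)).add
      (isPrimitive_integralAlong ν σ (contraction (fun μ => pderiv μ (A ν)) σ u * transportMap A σ
        + pull (A ν) σ * fderiv ℝ (transportMap A) σ u))).neg
  rw [← fderiv_transportMap_eq_neg_sum hA] at h
  refine h.congr (.of_forall fun t _ => ?_)
  simp only [Pi.neg_apply, Pi.add_apply, Finset.sum_apply, extend_add, extend_mul,
    extend_contraction, connectionVariation, connectionDensity, Finset.sum_add_distrib,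
    Finset.sum_mul, smul_add, add_mul, smul_mul_assoc]
  abel

theorem fderiv_transportMap_apply_zero (σ u : Curve q) :
    fderiv ℝ (transportMap A) σ u 0 = 0 := by
  rw [fderiv_transportMap_eq_neg_sum hA]
  simp [ContinuousMap.sum_apply, integralAlong_apply_zero]

theorem fderiv_transportMap (σ u : Curve q) :
    fderiv ℝ (transportMap A) σ u = -(contraction A σ u * transportMap A σ
      + transportMap A σ * curvatureIntegral A σ u) := by
  refine eq_of_isPrimitive_linear (B := fun ν => leftMul (-pull (A ν) σ)) (σ := σ)
    (b := fun s => -(connectionVariation A σ u s * extend (transportMap A σ) s)) ?_ ?_ ?_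
  · refine (isPrimitive_fderiv_transportMap hA σ u).congr (.of_forall fun t _ => ?_)
    rw [sum_velocity_smul_leftMul_neg]
  · have hU := isPrimitive_transportMap A σ
    refine (((isPrimitive_contraction hA σ u).mul hU).add
      (hU.mul (isPrimitive_curvatureIntegral A σ u))).neg.congr (.of_forall fun t _ => ?_)
    simp only [sum_velocity_smul_leftMul_neg, Pi.neg_apply, Pi.add_apply, extend_neg, extend_add,
      extend_mul, transportMap_mul_sum_curvatureDensity, Ring.lie_def]
    noncomm_ring
  · simp [fderiv_transportMap_apply_zero hA, contraction_apply_zero, curvatureIntegral_apply_zero]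

theorem fderiv_invTransport (σ u : Curve q) :
    fderiv ℝ (invTransport A) σ u = invTransport A σ * contraction A σ u
      + curvatureIntegral A σ u * invTransport A σ := by
  have hderiv := (hasFDerivAt_invTransport hA σ).mul' (hasFDerivAt_transportMap hA σ)
  rw [show invTransport A * transportMap A = fun _ : Curve q => 1 from
    funext (invTransport_mul_transportMap A)] at hderiv
  have hinv : fderiv ℝ (invTransport A) σ u * transportMap A σ
      = invTransport A σ * contraction A σ u * transportMap A σ + curvatureIntegral A σ u := by
    have happly := DFunLike.congr_fun (hderiv.unique (hasFDerivAt_const _ σ)) u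
    simp only [_root_.add_apply, _root_.smul_apply, _root_.zero_apply, smul_eq_mul,
      op_smul_eq_mul, fderiv_transportMap hA] at happly
    rw [eq_neg_of_add_eq_zero_right happly, neg_eq_iff_eq_neg]
    refine (mul_neg (invTransport A σ) _).trans ?_
    rw [mul_add, ← mul_assoc, ← mul_assoc, invTransport_mul_transportMap, one_mul]
  calc fderiv ℝ (invTransport A) σ u
    _ = fderiv ℝ (invTransport A) σ u * transportMap A σ * invTransport A σ := by
      rw [mul_assoc, transportMap_mul_invTransport, mul_one]
    _ = _ := by
      rw [hinv, add_mul, mul_assoc _ (transportMap A σ), transportMap_mul_invTransport, mul_one]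

theorem contDiff_translate {f : Spacetime → R} (hf : ContDiff ℝ ∞ f) (n : ℕ) :
    ContDiff ℝ n (translate (q := q) A f) :=
  ((contDiff_invTransport hA n).mul (contDiff_pull hf n)).mul (contDiff_transportMap hA n)

theorem fderiv_translate {f : Spacetime → R} (hf : ContDiff ℝ ∞ f) (σ u : Curve q) :
    fderiv ℝ (translate A f) σ u = (∑ μ, translate A (covDeriv A μ f) σ * coord μ u)
      + ⁅curvatureIntegral A σ u, translate A f σ⁆ := by
  have hderiv := ((hasFDerivAt_invTransport hA σ).mul' (hasFDerivAt_pull hf σ)).mul'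
    (hasFDerivAt_transportMap hA σ)
  have hcomm (μ : Fin 4) (p : C(unitInterval, R)) : coord μ u * p = p * coord μ u := by
    ext t
    simp [coord_apply]
  have hpull : fderiv ℝ (pull f) σ u + ⁅contraction A σ u, pull f σ⁆
      = ∑ μ, pull (covDeriv A μ f) σ * coord μ u := by
    simp only [fderiv_pull_apply hf, pull_covDeriv hA hf, contraction, Ring.lie_def,
      Finset.sum_mul, Finset.mul_sum, ← Finset.sum_sub_distrib, ← Finset.sum_add_distrib]
    refine Finset.sum_congr rfl fun μ _ => ?_
    rw [mul_assoc, hcomm]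
    ext t
    simp only [ContinuousMap.add_apply, ContinuousMap.sub_apply, ContinuousMap.mul_apply]
    noncomm_ring
  have hsum : ∑ μ, translate A (covDeriv A μ f) σ * coord μ u
      = invTransport A σ * (∑ μ, pull (covDeriv A μ f) σ * coord μ u) * transportMap A σ := by
    simp only [Finset.mul_sum, Finset.sum_mul, translate, mul_assoc, hcomm]
  rw [hsum, ← hpull]
  refine (DFunLike.congr_fun hderiv.fderiv u).trans ?_
  simp only [_root_.add_apply, _root_.smul_apply, smul_eq_mul, op_smul_eq_mul,
    fderiv_transportMap hA, fderiv_invTransport hA, Ring.lie_def, translate, Pi.mul_apply]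
  ext t
  simp only [ContinuousMap.add_apply, ContinuousMap.sub_apply, ContinuousMap.neg_apply,
    ContinuousMap.mul_apply]
  noncomm_ring

end FDeriv

/-! ### The second derivative of the parallel transport -/

section Eval

variable {E V : Type*} [NormedAddCommGroup E] [NormedSpace ℝ E] [NormedAddCommGroup V]
  [NormedSpace ℝ V]

theorem hasFDerivAt_eval {F : E → C(unitInterval, V)} {F' : E →L[ℝ] C(unitInterval, V)} {x : E}
    (hF : HasFDerivAt F F' x) (t : unitInterval) :
    HasFDerivAt (fun y => F y t) ((ContinuousMap.evalCLM ℝ t).comp F') x :=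
  HasFDerivAt.comp x (g := fun f : C(unitInterval, V) => f t)
    (ContinuousMap.evalCLM (M := V) ℝ t).hasFDerivAt hF

theorem contDiff_eval {F : E → C(unitInterval, V)} {n : ℕ∞ω} (hF : ContDiff ℝ n F)
    (t : unitInterval) : ContDiff ℝ n fun y => F y t :=
  ContDiff.comp (g := fun f : C(unitInterval, V) => f t)
    (ContinuousMap.evalCLM (M := V) ℝ t).contDiff hF

theorem IsPrimitive.apply_one {f : C(unitInterval, V)} {a : ℝ → V} (hf : IsPrimitive f a)
    (h0 : f 0 = 0) : f 1 = ∫ t in (0 : ℝ)..1, a t := by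
  rw [hf.eq_add, h0, zero_add]
  rfl

end Eval

section Holonomy

variable {q : ℝ≥0∞} [Fact (1 ≤ q)] {R : Type*} [NormedRing R] [NormedAlgebra ℝ R]

/-- The parallel transport `U_{1,0}(σ)` along the whole curve. -/
def holonomy (A : Fin 4 → Spacetime → R) (σ : Curve q) : R :=
  transportMap A σ 1

/-- The part of the variation of `curvatureIntegral A σ u` in the direction `v` in which `σ̇` is
varied; it carries the kernel `Q^S` of the second derivative. -/
def singularForm (A : Fin 4 → Spacetime → R) (σ v u : Curve q) : C(unitInterval, R) :=
  ∑ μ, ∑ ν, integralAlong ν v (translate A (fieldStrength A μ ν) σ * coord μ u)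

/-- The part of the variation of `curvatureIntegral A σ u` in the direction `v` in which the
curvature is differentiated; it carries the kernel `Q^L` of the second derivative. -/
def levyForm (A : Fin 4 → Spacetime → R) (σ v u : Curve q) : C(unitInterval, R) :=
  ∑ μ, ∑ ν, integralAlong ν σ
    ((∑ κ, translate A (covDeriv A κ (fieldStrength A μ ν)) σ * coord κ v) * coord μ u)

/-- The part of the variation of `curvatureIntegral A σ u` in the direction `v` in which the
parallel transport is varied; it contributes to the kernel `Q^V` of the second derivative. -/
def commutatorForm (A : Fin 4 → Spacetime → R) (σ v u : Curve q) : C(unitInterval, R) :=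
  ∑ μ, ∑ ν, integralAlong ν σ
    (⁅curvatureIntegral A σ v, translate A (fieldStrength A μ ν) σ⁆ * coord μ u)

variable (A : Fin 4 → Spacetime → R) (σ u v : Curve q)

theorem singularForm_apply_zero : singularForm A σ v u 0 = 0 := by
  simp [singularForm, ContinuousMap.sum_apply, integralAlong_apply_zero]

theorem levyForm_apply_zero : levyForm A σ v u 0 = 0 := by
  simp [levyForm, ContinuousMap.sum_apply, integralAlong_apply_zero]

theorem commutatorForm_apply_zero : commutatorForm A σ v u 0 = 0 := by
  simp [commutatorForm, ContinuousMap.sum_apply, integralAlong_apply_zero]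

theorem isPrimitive_commutatorForm :
    IsPrimitive (commutatorForm A σ v u) fun t =>
      ⁅extend (curvatureIntegral A σ v) t, ∑ μ, ext u t μ • curvatureDensity A σ μ t⁆ := by
  refine (IsPrimitive.sum _ fun μ _ => IsPrimitive.sum _ fun ν _ =>
    isPrimitive_integralAlong ν σ _).congr (.of_forall fun t _ => ?_)
  simp only [Finset.sum_apply, extend_mul, extend_sub, extend_coord, mul_smul_comm, mul_one,
    curvatureDensity, Ring.lie_def, Finset.smul_sum, Finset.mul_sum, Finset.sum_mul,
    smul_mul_assoc, smul_sub, Finset.sum_sub_distrib, smul_comm (ext u t _)]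

theorem isPrimitive_levyForm :
    IsPrimitive (levyForm A σ v u) fun t => ∑ μ, ∑ ν, (ext v t μ * ext u t ν) •
      ∑ κ, velocity σ t κ • extend (translate A (covDeriv A μ (fieldStrength A ν κ)) σ) t := by
  refine (IsPrimitive.sum _ fun μ _ => IsPrimitive.sum _ fun ν _ =>
    isPrimitive_integralAlong ν σ _).congr (.of_forall fun t _ => ?_)
  simp only [Finset.sum_apply, extend_mul, extend_sum, extend_coord, mul_smul_comm, mul_one,
    Finset.smul_sum]
  refine .trans ?_ Finset.sum_comm
  refine Finset.sum_congr rfl fun ν _ => Finset.sum_comm.trans ?_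
  refine Finset.sum_congr rfl fun μ _ => Finset.sum_congr rfl fun κ _ => ?_
  module

theorem extend_translate_fieldStrength_antisymm {A : Fin 4 → Spacetime → R}
    (hA : ∀ μ, ContDiff ℝ ∞ (A μ)) (σ : Curve q) (μ ν : Fin 4) (t : ℝ) :
    extend (translate A (fieldStrength A μ ν) σ) t
      = -extend (translate A (fieldStrength A ν μ) σ) t := by
  simp only [translate, extend_mul, extend_pull (contDiff_fieldStrength hA _ _).continuous]
  rw [fieldStrength_antisymm A μ ν, Pi.neg_apply, mul_neg, neg_mul]

theorem isPrimitive_singularForm {A : Fin 4 → Spacetime → R} (hA : ∀ μ, ContDiff ℝ ∞ (A μ))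
    (σ v u : Curve q) :
    IsPrimitive (singularForm A σ v u) fun t => -∑ μ, ∑ ν, (velocity v t μ * ext u t ν) •
      extend (translate A (fieldStrength A μ ν) σ) t := by
  refine (IsPrimitive.sum _ fun μ _ => IsPrimitive.sum _ fun ν _ =>
    isPrimitive_integralAlong ν v _).congr (.of_forall fun t _ => ?_)
  simp only [Finset.sum_apply, extend_mul, extend_coord, mul_smul_comm, mul_one,
    ← Finset.sum_neg_distrib, smul_smul]
  refine Finset.sum_comm.trans ?_
  refine Finset.sum_congr rfl fun μ _ => Finset.sum_congr rfl fun ν _ => ?_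
  rw [extend_translate_fieldStrength_antisymm hA σ ν μ, smul_neg]

theorem coord_apply_one_of_mem_closedCurves {u : Curve q} (hu : u ∈ closedCurves q) (μ : Fin 4) :
    coord (R := R) μ u 1 = 0 := by
  rw [coord_apply, show u 1 = 0 from hu]
  simp

end Holonomy

section SecondDerivative

variable {q : ℝ≥0∞} [Fact (1 ≤ q)] {R : Type} [NormedRing R] [NormedAlgebra ℝ R] [CompleteSpace R]
  {A : Fin 4 → Spacetime → R} (hA : ∀ μ, ContDiff ℝ ∞ (A μ))
include hA

theorem contDiff_holonomy (n : ℕ) : ContDiff ℝ n (holonomy (q := q) A) :=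
  contDiff_eval (contDiff_transportMap hA n) 1

theorem hasFDerivAt_holonomy (σ : Curve q) :
    HasFDerivAt (holonomy A)
      ((ContinuousMap.evalCLM ℝ 1).comp (fderiv ℝ (transportMap A) σ)) σ :=
  hasFDerivAt_eval (hasFDerivAt_transportMap hA σ) 1

theorem fderiv_transportMap_apply_one_of_mem_closedCurves (σ : Curve q) {u : Curve q}
    (hu : u ∈ closedCurves q) :
    fderiv ℝ (transportMap A) σ u 1 = -(holonomy A σ * curvatureIntegral A σ u 1) := by
  rw [fderiv_transportMap hA]
  simp [contraction, ContinuousMap.sum_apply, coord_apply_one_of_mem_closedCurves hu, holonomy]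

theorem fderiv_holonomy_of_mem_closedCurves (σ : Curve q) {u : Curve q}
    (hu : u ∈ closedCurves q) :
    fderiv ℝ (holonomy A) σ u = -(holonomy A σ * curvatureIntegral A σ u 1) := by
  rw [(hasFDerivAt_holonomy hA σ).fderiv]
  exact fderiv_transportMap_apply_one_of_mem_closedCurves hA σ hu

theorem hasFDerivAt_translate {f : Spacetime → R} (hf : ContDiff ℝ ∞ f) (σ : Curve q) :
    HasFDerivAt (translate A f) (fderiv ℝ (translate A f) σ) σ :=
  ((contDiff_translate hA hf 1).differentiable (by simp) σ).hasFDerivAt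

theorem exists_hasFDerivAt_curvatureIntegral (σ u : Curve q) :
    ∃ L : Curve q →L[ℝ] C(unitInterval, R),
      HasFDerivAt (fun τ => curvatureIntegral A τ u) L σ ∧
      ∀ v, L v = singularForm A σ v u + levyForm A σ v u + commutatorForm A σ v u := by
  have hterm (μ ν : Fin 4) : HasFDerivAt (fun τ : Curve q =>
      integralAlong ν τ (translate A (fieldStrength A μ ν) τ * coord μ u)) _ σ :=
    (integralAlong ν).hasFDerivAt.clm_apply
      ((hasFDerivAt_translate hA (contDiff_fieldStrength hA μ ν) σ).mul_const' (coord μ u))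
  refine ⟨_, HasFDerivAt.fun_sum (u := Finset.univ) fun μ _ =>
    HasFDerivAt.fun_sum (u := Finset.univ) fun ν _ => hterm μ ν, fun v => ?_⟩
  simp only [_root_.add_apply, _root_.sum_apply, ContinuousLinearMap.comp_apply,
    ContinuousLinearMap.flip_apply, _root_.smul_apply, op_smul_eq_mul,
    fderiv_translate hA (contDiff_fieldStrength hA _ _), add_mul, map_add,
    Finset.sum_add_distrib, singularForm, levyForm, commutatorForm]
  abel

theorem fderiv_fderiv_holonomy (σ : Curve q) {u v : Curve q} (hu : u ∈ closedCurves q)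
    (hv : v ∈ closedCurves q) :
    fderiv ℝ (fderiv ℝ (holonomy A)) σ v u = holonomy A σ *
      (curvatureIntegral A σ v 1 * curvatureIntegral A σ u 1 - commutatorForm A σ v u 1
        - levyForm A σ v u 1 - singularForm A σ v u 1) := by
  obtain ⟨L, hL, hLv⟩ := exists_hasFDerivAt_curvatureIntegral hA σ u
  have hdiff : DifferentiableAt ℝ (fderiv ℝ (holonomy (q := q) A)) σ :=
    ((contDiff_holonomy hA 2).fderiv_right (m := 1) (by norm_num)).differentiable (by simp) σ
  have hleft : HasFDerivAt (fun τ => fderiv ℝ (holonomy A) τ u) _ σ :=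
    hdiff.hasFDerivAt.clm_apply (hasFDerivAt_const u σ)
  have hright := ((hasFDerivAt_holonomy hA σ).mul' (hasFDerivAt_eval hL 1)).neg
  have heq : (fun τ => fderiv ℝ (holonomy A) τ u)
      = -(holonomy A * fun τ => curvatureIntegral A τ u 1) :=
    funext fun τ => fderiv_holonomy_of_mem_closedCurves hA τ hu
  have happly := DFunLike.congr_fun (hleft.unique (heq ▸ hright)) v
  simp only [_root_.add_apply, ContinuousLinearMap.comp_apply, _root_.neg_apply,
    ContinuousLinearMap.flip_apply, _root_.zero_apply, map_zero, zero_add, map_add,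
    _root_.smul_apply, op_smul_eq_mul, smul_eq_mul, ContinuousMap.evalCLM_apply, hLv,
    fderiv_transportMap_apply_one_of_mem_closedCurves hA σ hv] at happly
  rw [happly]
  noncomm_ring

end SecondDerivative

/-! ### The kernels of the second derivative -/

section OrderedProduct

variable {R : Type*} [NormedRing R] [NormedAlgebra ℝ R] [CompleteSpace R]
  {F G : C(unitInterval, R)} {a b : ℝ → R}

theorem IsPrimitive.const_mul (h : R) (hF : IsPrimitive F a) :
    IsPrimitive (.const _ h * F) fun t => h * a t :=
  hF.map (ContinuousLinearMap.mul ℝ R h) fun _ => rfl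

theorem integral_const_mul_of_intervalIntegrable {s t : ℝ} (hb : IntervalIntegrable b volume s t)
    (h : R) : ∫ r in s..t, h * b r = h * ∫ r in s..t, b r :=
  (ContinuousLinearMap.mul ℝ R h).intervalIntegral_comp_comm hb

theorem integral_mul_const_of_intervalIntegrable {s t : ℝ} (hb : IntervalIntegrable b volume s t)
    (h : R) : ∫ r in s..t, b r * h = (∫ r in s..t, b r) * h :=
  ((ContinuousLinearMap.mul ℝ R).flip h).intervalIntegral_comp_comm hb

theorem integral_const_mul_ordered_mul (hG : IsPrimitive G b) (hG0 : G 0 = 0) (h x : R) {t : ℝ}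
    (ht : t ∈ Set.Icc (0 : ℝ) 1) :
    (∫ s in (0 : ℝ)..1, h * if s ≤ t then x * b s else b s * x)
      = h * (x * extend G t + (G 1 - extend G t) * x) := by
  have hGt : extend G t = ∫ s in (0 : ℝ)..t, b s := by
    rw [extend_of_mem _ ht, hG.eq_add, hG0, zero_add]
  have hmem : t ∈ Set.uIcc (0 : ℝ) 1 := by rwa [Set.uIcc_of_le zero_le_one]
  have hb0 : IntervalIntegrable b volume 0 t :=
    hG.intervalIntegrable.mono_set (Set.uIcc_subset_uIcc Set.left_mem_uIcc hmem)
  have hb1 : IntervalIntegrable b volume t 1 :=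
    hG.intervalIntegrable.mono_set (Set.uIcc_subset_uIcc hmem Set.right_mem_uIcc)
  have hlower : Set.EqOn (fun s => x * b s) (fun s => if s ≤ t then x * b s else b s * x)
      (Set.uIoc 0 t) := fun s hs => by
    rw [Set.uIoc_of_le ht.1] at hs
    simp only [if_pos hs.2]
  have hupper : Set.EqOn (fun s => b s * x) (fun s => if s ≤ t then x * b s else b s * x)
      (Set.uIoc t 1) := fun s hs => by
    rw [Set.uIoc_of_le ht.2] at hs
    simp only [if_neg hs.1.not_ge]
  have hlower_int := (hb0.continuousOn_mul (g := fun _ => x) continuousOn_const).congr hlower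
  have hupper_int := (hb1.mul_continuousOn (g := fun _ => x) continuousOn_const).congr hupper
  rw [integral_const_mul_of_intervalIntegrable (hlower_int.trans hupper_int),
    ← intervalIntegral.integral_add_adjacent_intervals hlower_int hupper_int,
    ← intervalIntegral.integral_congr_ae (.of_forall hlower),
    ← intervalIntegral.integral_congr_ae (.of_forall hupper),
    integral_const_mul_of_intervalIntegrable hb0, integral_mul_const_of_intervalIntegrable hb1,
    hG.apply_one hG0, hGt, intervalIntegral.integral_interval_sub_left hG.intervalIntegrable hb0]

theorem integral_integral_const_mul_ordered_mul (hF : IsPrimitive F a) (hF0 : F 0 = 0)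
    (hG : IsPrimitive G b) (hG0 : G 0 = 0) (h : R) :
    (∫ t in (0 : ℝ)..1, ∫ s in (0 : ℝ)..1, h * if s ≤ t then a t * b s else b s * a t)
      = h * (G 1 * F 1 + ∫ t in (0 : ℝ)..1, ⁅a t, extend G t⁆) := by
  have ha := hF.intervalIntegrable
  have hconst : IntervalIntegrable (fun t => G 1 * a t) volume 0 1 :=
    ha.continuousOn_mul continuousOn_const
  have hlie : IntervalIntegrable (fun t => ⁅a t, extend G t⁆) volume 0 1 :=
    (ha.mul_continuousOn (extend G).continuous.continuousOn).sub
      (ha.continuousOn_mul (extend G).continuous.continuousOn)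
  have hinner : Set.EqOn
      (fun t => ∫ s in (0 : ℝ)..1, h * if s ≤ t then a t * b s else b s * a t)
      (fun t => h * (G 1 * a t + ⁅a t, extend G t⁆)) (Set.uIcc 0 1) := fun t ht => by
    rw [Set.uIcc_of_le zero_le_one] at ht
    simp only [integral_const_mul_ordered_mul hG hG0 h (a t) ht, Ring.lie_def]
    noncomm_ring
  rw [intervalIntegral.integral_congr hinner,
    integral_const_mul_of_intervalIntegrable (hconst.add hlie),
    intervalIntegral.integral_add hconst hlie, integral_const_mul_of_intervalIntegrable ha,
    ← hF.apply_one hF0]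

end OrderedProduct

section LevyKernels

variable {q : ℝ≥0∞} [Fact (1 ≤ q)] {R : Type*} [NormedRing R] [NormedAlgebra ℝ R]

/-- The kernel `Q^V` of the second derivative of the parallel transport: the product of the
curvature densities at the two times, in the order prescribed by the transport. -/
def volterraKernel (A : Fin 4 → Spacetime → R) (σ : Curve q) (μ ν : Fin 4) (x : ℝ × ℝ) : R :=
  holonomy A σ * if x.2 ≤ x.1 then curvatureDensity A σ μ x.1 * curvatureDensity A σ ν x.2
    else curvatureDensity A σ ν x.2 * curvatureDensity A σ μ x.1

/-- The kernel `Q^L` of the second derivative of the parallel transport, the symmetrization of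
`-U_{1,0} U_{0,t} (∇_μ F_{νκ})(σ(t)) U_{t,0} σ̇^κ(t)` in `μ` and `ν`. -/
def levyKernel (A : Fin 4 → Spacetime → R) (σ : Curve q) (μ ν : Fin 4) (t : ℝ) : R :=
  (-(1 / 2) : ℝ) • (holonomy A σ *
    (∑ κ, velocity σ t κ • extend (translate A (covDeriv A μ (fieldStrength A ν κ)) σ) t
      + ∑ κ, velocity σ t κ • extend (translate A (covDeriv A ν (fieldStrength A μ κ)) σ) t))

/-- The kernel `Q^S` of the second derivative of the parallel transport. -/
def singularKernel (A : Fin 4 → Spacetime → R) (σ : Curve q) (μ ν : Fin 4) (t : ℝ) : R :=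
  holonomy A σ * extend (translate A (fieldStrength A μ ν) σ) t

variable (A : Fin 4 → Spacetime → R) (σ : Curve q)

theorem levyKernel_symm (μ ν : Fin 4) (t : ℝ) : levyKernel A σ μ ν t = levyKernel A σ ν μ t := by
  simp only [levyKernel, add_comm]

theorem intervalIntegrable_sum_velocity_smul (f : Fin 4 → C(unitInterval, R)) :
    IntervalIntegrable (fun t => ∑ ν, velocity σ t ν • extend (f ν) t) volume 0 1 := by
  refine (IsPrimitive.sum Finset.univ fun ν _ =>
    isPrimitive_integralAlong ν σ (f ν)).intervalIntegrable.congr fun t _ => ?_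
  simp only [Finset.sum_apply]

theorem integrableOn_curvatureDensity (μ : Fin 4) :
    IntegrableOn (curvatureDensity A σ μ) (Set.Icc 0 1) :=
  (intervalIntegrable_iff_integrableOn_Icc_of_le zero_le_one).1
    (intervalIntegrable_sum_velocity_smul σ _)

theorem integrableOn_volterraKernel (μ ν : Fin 4) :
    IntegrableOn (volterraKernel A σ μ ν) (Set.Icc (0 : ℝ) 1 ×ˢ Set.Icc (0 : ℝ) 1) := by
  rw [IntegrableOn, Measure.volume_eq_prod, ← Measure.prod_restrict]
  have hlower :=
    (integrableOn_curvatureDensity A σ μ).mul_prod (integrableOn_curvatureDensity A σ ν)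
  have hupper :=
    ((integrableOn_curvatureDensity A σ ν).mul_prod (integrableOn_curvatureDensity A σ μ)).swap
  have hmeas : MeasurableSet {x : ℝ × ℝ | x.2 ≤ x.1} :=
    measurableSet_le measurable_snd measurable_fst
  refine ((Integrable.piecewise hmeas hlower.integrableOn hupper.integrableOn).const_mul'
    (holonomy A σ)).congr (.of_forall fun x => ?_)
  by_cases hx : x.2 ≤ x.1 <;> simp [volterraKernel, Set.piecewise, hx]

theorem integrableOn_levyKernel (μ ν : Fin 4) :
    IntegrableOn (levyKernel A σ μ ν) (Set.Icc (0 : ℝ) 1) := by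
  have hint (μ ν : Fin 4) := (intervalIntegrable_iff_integrableOn_Icc_of_le zero_le_one).1
    (intervalIntegrable_sum_velocity_smul σ
      fun κ => translate A (covDeriv A μ (fieldStrength A ν κ)) σ)
  exact (((hint μ ν).add (hint ν μ)).const_mul' (holonomy A σ)).smul (-(1 / 2) : ℝ)

theorem memLp_singularKernel (μ ν : Fin 4) :
    MemLp (singularKernel A σ μ ν) ∞ (volume.restrict (Set.Icc (0 : ℝ) 1)) := by
  have hcont : Continuous (singularKernel A σ μ ν) :=
    continuous_const.mul (extend (translate A (fieldStrength A μ ν) σ)).continuous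
  refine memLp_top_of_bound hcont.aestronglyMeasurable
    (‖holonomy A σ‖ * ‖translate A (fieldStrength A μ ν) σ‖) (.of_forall fun t => ?_)
  refine (norm_mul_le _ _).trans ?_
  gcongr
  exact (translate A (fieldStrength A μ ν) σ).norm_coe_le_norm _

theorem mul_sum_smul_mul_sum_smul {ι : Type*} [Fintype ι] (h : R) (x y : ι → ℝ) (k l : ι → R) :
    h * ((∑ i, x i • k i) * ∑ j, y j • l j) = ∑ i, ∑ j, (x i * y j) • (h * (k i * l j)) := by
  simp only [Finset.sum_mul_sum, smul_mul_smul_comm]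
  simp only [Finset.mul_sum, mul_smul_comm]

variable [CompleteSpace R] (u v : Curve q)

theorem commutatorForm_sub_comm :
    commutatorForm A σ u v - commutatorForm A σ v u
      = ⁅curvatureIntegral A σ u, curvatureIntegral A σ v⁆ := by
  have hu := isPrimitive_curvatureIntegral A σ u
  have hv := isPrimitive_curvatureIntegral A σ v
  rw [Ring.lie_def, sub_eq_add_neg, sub_eq_add_neg]
  refine ((isPrimitive_commutatorForm A σ v u).add (isPrimitive_commutatorForm A σ u v).neg).eq
    (((hu.mul hv).add (hv.mul hu).neg).congr (.of_forall fun t _ => ?_)) ?_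
  · simp only [Pi.add_apply, Pi.neg_apply, Ring.lie_def]
    abel
  · simp [commutatorForm_apply_zero, curvatureIntegral_apply_zero]

theorem integral_volterraKernel :
    ∫ t in (0 : ℝ)..1, ∫ s in (0 : ℝ)..1,
        ∑ μ, ∑ ν, (ext u t μ * ext v s ν) • volterraKernel A σ μ ν (t, s)
      = holonomy A σ * (curvatureIntegral A σ v 1 * curvatureIntegral A σ u 1
        - commutatorForm A σ v u 1) := by
  have hsum (t s : ℝ) : ∑ μ, ∑ ν, (ext u t μ * ext v s ν) • volterraKernel A σ μ ν (t, s)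
      = holonomy A σ * if s ≤ t then
          (∑ μ, ext u t μ • curvatureDensity A σ μ t) * ∑ ν, ext v s ν • curvatureDensity A σ ν s
        else (∑ ν, ext v s ν • curvatureDensity A σ ν s)
          * ∑ μ, ext u t μ • curvatureDensity A σ μ t := by
    by_cases hst : s ≤ t
    · simp only [volterraKernel, if_pos hst, mul_sum_smul_mul_sum_smul]
    · simp only [volterraKernel, if_neg hst, mul_sum_smul_mul_sum_smul, mul_comm (ext u t _)]
      exact Finset.sum_comm
  have hcomm : commutatorForm A σ v u 1 = -∫ t in (0 : ℝ)..1,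
      ⁅∑ μ, ext u t μ • curvatureDensity A σ μ t, extend (curvatureIntegral A σ v) t⁆ := by
    rw [(isPrimitive_commutatorForm A σ u v).apply_one (commutatorForm_apply_zero A σ u v),
      ← intervalIntegral.integral_neg]
    simp only [Ring.lie_def, neg_sub]
  simp only [hsum]
  rw [integral_integral_const_mul_ordered_mul
    (isPrimitive_curvatureIntegral A σ u) (curvatureIntegral_apply_zero A σ u)
    (isPrimitive_curvatureIntegral A σ v) (curvatureIntegral_apply_zero A σ v),
    hcomm, sub_neg_eq_add]

theorem integral_levyKernel :
    ∫ t in (0 : ℝ)..1, ∑ μ, ∑ ν, (ext u t μ * ext v t ν) • levyKernel A σ μ ν t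
      = (-(1 / 2) : ℝ) • (holonomy A σ * (levyForm A σ u v 1 + levyForm A σ v u 1)) := by
  have hprim := ((((isPrimitive_levyForm A σ v u).add (isPrimitive_levyForm A σ u v)).const_mul
    (holonomy A σ)).smul (-(1 / 2) : ℝ)).apply_one (by simp [levyForm_apply_zero])
  refine (Eq.trans ?_ hprim.symm).trans rfl
  congr 1 with t
  simp only [Pi.smul_apply, Pi.add_apply]
  rw [Finset.sum_comm (f := fun μ ν => (ext v t μ * ext u t ν) • _)]
  simp only [levyKernel, ← Finset.sum_add_distrib, Finset.mul_sum, Finset.smul_sum, mul_add]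
  refine Finset.sum_congr rfl fun μ _ => Finset.sum_congr rfl fun ν _ =>
    Finset.sum_congr rfl fun κ _ => ?_
  simp only [mul_smul_comm]
  module

theorem integral_singularKernel {A : Fin 4 → Spacetime → R} (hA : ∀ μ, ContDiff ℝ ∞ (A μ)) :
    ∫ t in (0 : ℝ)..1, ∑ μ, ∑ ν,
        (velocity u t μ * ext v t ν + velocity v t μ * ext u t ν) • singularKernel A σ μ ν t
      = -(holonomy A σ * (singularForm A σ u v 1 + singularForm A σ v u 1)) := by
  have hprim := (((isPrimitive_singularForm hA σ u v).add
    (isPrimitive_singularForm hA σ v u)).const_mul (holonomy A σ)).neg.apply_one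
    (by simp [singularForm_apply_zero])
  refine (Eq.trans ?_ hprim.symm).trans rfl
  congr 1 with t
  simp only [Pi.neg_apply, Pi.add_apply, singularKernel, ← neg_add, mul_neg, neg_neg,
    ← Finset.sum_add_distrib, ← add_smul, Finset.mul_sum, mul_smul_comm]

end LevyKernels

section LevyRepresentation

variable {q : ℝ≥0∞} [Fact (1 ≤ q)] {R : Type} [NormedRing R] [NormedAlgebra ℝ R] [CompleteSpace R]
  {A : Fin 4 → Spacetime → R} (hA : ∀ μ, ContDiff ℝ ∞ (A μ))
include hA

/-- The form of `fderiv_fderiv_holonomy` that is manifestly symmetric in `u` and `v`, as the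
symmetry conditions on the kernels require. -/
theorem fderiv_fderiv_holonomy_symm (σ : Curve q) {u v : Curve q} (hu : u ∈ closedCurves q)
    (hv : v ∈ closedCurves q) :
    fderiv ℝ (fderiv ℝ (holonomy A)) σ u v = holonomy A σ *
        (curvatureIntegral A σ v 1 * curvatureIntegral A σ u 1 - commutatorForm A σ v u 1)
      + (-(1 / 2) : ℝ) • (holonomy A σ * (levyForm A σ u v 1 + levyForm A σ v u 1))
      + (-(1 / 2) : ℝ) • (holonomy A σ * (singularForm A σ u v 1 + singularForm A σ v u 1)) := by
  have hsymm : fderiv ℝ (fderiv ℝ (holonomy A)) σ u v = fderiv ℝ (fderiv ℝ (holonomy A)) σ v u :=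
    (contDiff_holonomy hA 2).contDiffAt.isSymmSndFDerivAt (by simp) u v
  have hcomm : curvatureIntegral A σ u 1 * curvatureIntegral A σ v 1 - commutatorForm A σ u v 1
      = curvatureIntegral A σ v 1 * curvatureIntegral A σ u 1 - commutatorForm A σ v u 1 :=
    sub_eq_sub_iff_sub_eq_sub.2
      (congrArg (fun f : C(unitInterval, R) => f 1) (commutatorForm_sub_comm A σ u v)).symm
  have huv := fderiv_fderiv_holonomy hA σ hv hu
  have hvu := fderiv_fderiv_holonomy hA σ hu hv
  rw [hcomm] at huv
  have hhalf : fderiv ℝ (fderiv ℝ (holonomy A)) σ u v = (1 / 2 : ℝ) •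
      (fderiv ℝ (fderiv ℝ (holonomy A)) σ u v + fderiv ℝ (fderiv ℝ (holonomy A)) σ v u) := by
    rw [← hsymm]
    module
  rw [hhalf, huv, hvu]
  simp only [mul_sub, mul_add]
  module

theorem hasLevyKernels_holonomy (σ : Curve q) :
    HasLevyKernels (fderiv ℝ (fderiv ℝ (holonomy A)) σ) (volterraKernel A σ) (levyKernel A σ)
      (singularKernel A σ) where
  integrable_volterra := integrableOn_volterraKernel A σ
  integrable_levy := integrableOn_levyKernel A σ
  memLp_singular := memLp_singularKernel A σ
  levy_symm := levyKernel_symm A σ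
  singular_antisymm μ ν t := by
    rw [singularKernel, singularKernel, extend_translate_fieldStrength_antisymm hA σ μ ν, mul_neg]
  eq_on u hu v hv := by
    rw [fderiv_fderiv_holonomy_symm hA σ hu hv, integral_volterraKernel, integral_levyKernel,
      integral_singularKernel σ u v hA, smul_neg, neg_smul (1 / 2 : ℝ), neg_smul (1 / 2 : ℝ)]

end LevyRepresentation

/-! ### Smooth curves -/

section SmoothCurve

variable {q : ℝ≥0∞} {γ : ℝ → Spacetime} (hγ : ContDiff ℝ 1 γ) (h0 : γ 0 = 0)

theorem ext_restrict (γ : ℝ → Spacetime) {t : ℝ} (ht : t ∈ Set.Icc (0 : ℝ) 1) :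
    ext (fun t => γ t) t = γ t := by
  rw [ext, Set.IccExtend_of_mem _ _ ht]

theorem deriv_ext_restrict (γ : ℝ → Spacetime) {t : ℝ} (ht : t ∈ Set.Ioo (0 : ℝ) 1) :
    deriv (ext fun t => γ t) t = deriv γ t := by
  refine Filter.EventuallyEq.deriv_eq ?_
  filter_upwards [Ioo_mem_nhds ht.1 ht.2] with s hs
  exact ext_restrict γ (Set.Ioo_subset_Icc_self hs)

include hγ h0 in
theorem isSobolevCurve_of_contDiff : IsSobolevCurve q fun t => γ t := by
  refine ⟨?_, h0, ?_⟩
  · refine absolutelyContinuousOnInterval_of_dist_le (K := 1)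
      (hγ.contDiffOn (s := Set.uIcc 0 1)).absolutelyContinuousOnInterval fun x hx y hy => ?_
    rw [Set.uIcc_of_le zero_le_one] at hx hy
    rw [ext_restrict γ hx, ext_restrict γ hy, one_mul]
  · have hderiv : deriv (ext fun t => γ t) =ᵐ[volume.restrict (Set.Ioo 0 1)] deriv γ := by
      filter_upwards [ae_restrict_mem measurableSet_Ioo] with t ht
      exact deriv_ext_restrict γ ht
    rw [memLp_congr_ae hderiv]
    have hcont : Continuous (deriv γ) := hγ.continuous_deriv_one
    obtain ⟨C, hC⟩ := isCompact_Icc.exists_bound_of_continuousOn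
      (hcont.continuousOn (s := Set.Icc (0 : ℝ) 1))
    have := isProbabilityMeasure_Ioo
    refine MemLp.of_bound hcont.aestronglyMeasurable C ?_
    filter_upwards [ae_restrict_mem measurableSet_Ioo] with t ht
    exact hC t (Set.Ioo_subset_Icc_self ht)

/-- A continuously differentiable curve starting at the origin, as an element of `W^{1,q}_0`. -/
def smoothCurve {q : ℝ≥0∞} {γ : ℝ → Spacetime} (hγ : ContDiff ℝ 1 γ) (h0 : γ 0 = 0) : Curve q :=
  ⟨fun t => γ t, isSobolevCurve_of_contDiff hγ h0⟩

theorem smoothCurve_apply (t : unitInterval) : (smoothCurve hγ h0 : Curve q) t = γ t := rfl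

theorem ext_smoothCurve {t : ℝ} (ht : t ∈ Set.Icc (0 : ℝ) 1) :
    ext (smoothCurve hγ h0 : Curve q) t = γ t :=
  ext_restrict γ ht

theorem velocity_smoothCurve {t : ℝ} (ht : t ∈ Set.Ioo (0 : ℝ) 1) :
    velocity (smoothCurve hγ h0 : Curve q) t = deriv γ t :=
  deriv_ext_restrict γ ht

end SmoothCurve

/-! ### Uniqueness of the Lévy trace -/

section RiemannLebesgue

variable {E : Type*} [NormedAddCommGroup E] [NormedSpace ℂ E] {s : Set ℝ}

theorem tendsto_setIntegral_exp_smul_cocompact (hs : MeasurableSet s) (f : ℝ → E) :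
    Filter.Tendsto (fun w : ℝ => ∫ t in s, Complex.exp ((w * t : ℝ) * Complex.I) • f t)
      (Filter.cocompact ℝ) (nhds 0) := by
  have hc : -(2 * Real.pi)⁻¹ ≠ 0 := neg_ne_zero.2 (inv_ne_zero Real.two_pi_pos.ne')
  refine ((Real.tendsto_integral_exp_smul_cocompact (s.indicator f)).comp
    (Homeomorph.mulLeft₀ _ hc).isClosedEmbedding.tendsto_cocompact).congr fun w => ?_
  rw [← integral_indicator hs]
  refine integral_congr_ae (.of_forall fun t => ?_)
  have hphase : 2 * Real.pi * -(t * (-(2 * Real.pi)⁻¹ * w)) = w * t := by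
    field_simp
  simp only [Homeomorph.coe_mulLeft₀, Circle.smul_def, Real.fourierChar_apply, hphase]
  by_cases ht : t ∈ s <;> simp [ht]

theorem integrableOn_exp_smul {f : ℝ → E} (hf : IntegrableOn f s) (w : ℝ) :
    IntegrableOn (fun t : ℝ => Complex.exp ((w * t : ℝ) * Complex.I) • f t) s := by
  have hcont : Continuous fun t : ℝ => Complex.exp ((w * t : ℝ) * Complex.I) := by fun_prop
  exact Integrable.bdd_smul hf 1 hcont.aestronglyMeasurable
    (.of_forall fun t => (Complex.norm_exp_ofReal_mul_I _).le)

theorem tendsto_setIntegral_cos_smul_cocompact (hs : MeasurableSet s) {f : ℝ → E}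
    (hf : IntegrableOn f s) :
    Filter.Tendsto (fun w : ℝ => ∫ t in s, Real.cos (w * t) • f t)
      (Filter.cocompact ℝ) (nhds 0) := by
  have hexp := tendsto_setIntegral_exp_smul_cocompact hs f
  have hlim := (hexp.add (hexp.comp (Homeomorph.neg ℝ).isClosedEmbedding.tendsto_cocompact)
    ).const_smul (1 / 2 : ℂ)
  rw [add_zero, smul_zero] at hlim
  refine hlim.congr fun w => ?_
  have hint := integrableOn_exp_smul hf
  simp only [Function.comp_apply, Homeomorph.coe_neg]
  rw [← integral_add (hint w) (hint (-w)), ← integral_smul]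
  refine integral_congr_ae (.of_forall fun t => ?_)
  simp only [← add_smul, smul_smul, ← Complex.coe_smul (Real.cos _), Complex.ofReal_cos,
    Complex.cos, neg_mul, Complex.ofReal_neg]
  congr 1
  ring

theorem tendsto_setIntegral_sin_smul_cocompact (hs : MeasurableSet s) {f : ℝ → E}
    (hf : IntegrableOn f s) :
    Filter.Tendsto (fun w : ℝ => ∫ t in s, Real.sin (w * t) • f t)
      (Filter.cocompact ℝ) (nhds 0) := by
  have hexp := tendsto_setIntegral_exp_smul_cocompact hs f
  have hlim := ((hexp.comp (Homeomorph.neg ℝ).isClosedEmbedding.tendsto_cocompact).sub hexp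
    ).const_smul (Complex.I / 2)
  rw [sub_zero, smul_zero] at hlim
  refine hlim.congr fun w => ?_
  have hint := integrableOn_exp_smul hf
  simp only [Function.comp_apply, Homeomorph.coe_neg]
  rw [← integral_sub (hint (-w)) (hint w), ← integral_smul]
  refine integral_congr_ae (.of_forall fun t => ?_)
  simp only [← sub_smul, smul_smul, ← Complex.coe_smul (Real.sin _), Complex.ofReal_sin,
    Complex.sin, neg_mul, Complex.ofReal_neg]
  congr 1
  ring

theorem tendsto_setIntegral_sin_mul_sin_smul_cocompact (hs : MeasurableSet s) {f : ℝ × ℝ → E}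
    (hf : IntegrableOn f (s ×ˢ s)) :
    Filter.Tendsto (fun w : ℝ => ∫ x in s, ∫ y in s,
      (Real.sin (w * x) * Real.sin (w * y)) • f (x, y)) (Filter.cocompact ℝ) (nhds 0) := by
  rw [IntegrableOn, Measure.volume_eq_prod, ← Measure.prod_restrict] at hf
  rw [← integral_zero ℝ E (μ := volume.restrict s)]
  have : (Filter.cocompact ℝ).IsCountablyGenerated := by
    rw [cocompact_eq_atBot_atTop]
    infer_instance
  refine tendsto_integral_filter_of_dominated_convergence (fun x => ∫ y in s, ‖f (x, y)‖)
    (.of_forall fun w => ?_) (.of_forall fun w => ?_) hf.integral_norm_prod_left ?_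
  · have hcont : Continuous fun z : ℝ × ℝ => Real.sin (w * z.1) * Real.sin (w * z.2) := by
      fun_prop
    exact (hcont.aestronglyMeasurable.smul hf.1).integral_prod_right'
  · filter_upwards [hf.prod_right_ae] with x hx
    refine norm_integral_le_of_norm_le hx.norm (.of_forall fun y => ?_)
    rw [norm_smul, norm_mul]
    exact mul_le_of_le_one_left (norm_nonneg _)
      (mul_le_one₀ (Real.abs_sin_le_one _) (norm_nonneg _) (Real.abs_sin_le_one _))
  · filter_upwards [hf.prod_right_ae] with x hx
    refine squeeze_zero_norm (fun w => ?_)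
      (by simpa using (tendsto_setIntegral_sin_smul_cocompact hs hx).norm)
    simp only [mul_smul]
    rw [integral_smul, norm_smul]
    exact mul_le_of_le_one_left (norm_nonneg _) (Real.abs_sin_le_one _)

end RiemannLebesgue

section SineCurve

theorem p_apply (μ ν : Fin 4) : p μ ν = if ν = μ then 1 else 0 := by
  simp [p]

theorem contDiff_sine (μ : Fin 4) (n : ℕ) :
    ContDiff ℝ 1 fun t : ℝ => Real.sin (Real.pi * n * t) • p μ :=
  (Real.contDiff_sin.comp (contDiff_const.mul contDiff_id)).smul contDiff_const

/-- The closed curve `t ↦ sin(nπt) p_μ`, a test curve which isolates the kernel `Q^L_{μμ}` as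
`n → ∞`. -/
def sineCurve (q : ℝ≥0∞) (μ : Fin 4) (n : ℕ) : Curve q :=
  smoothCurve (contDiff_sine μ n) (by simp)

variable {q : ℝ≥0∞} (μ : Fin 4) (n : ℕ)

theorem sineCurve_mem_closedCurves : sineCurve q μ n ∈ closedCurves q := by
  change Real.sin (Real.pi * n * ((1 : unitInterval) : ℝ)) • p μ = 0
  rw [Set.Icc.coe_one, mul_one, mul_comm, Real.sin_nat_mul_pi, zero_smul]

theorem ext_sineCurve_apply (ν : Fin 4) {t : ℝ} (ht : t ∈ Set.Icc (0 : ℝ) 1) :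
    ext (sineCurve q μ n) t ν = if ν = μ then Real.sin (Real.pi * n * t) else 0 := by
  rw [sineCurve, ext_smoothCurve _ _ ht, PiLp.smul_apply, p_apply, smul_ite, smul_zero,
    smul_eq_mul, mul_one]

theorem velocity_sineCurve_apply_of_ne {ν : Fin 4} {t : ℝ} (ht : t ∈ Set.Ioo (0 : ℝ) 1)
    (hν : ν ≠ μ) : velocity (sineCurve q μ n) t ν = 0 := by
  rw [sineCurve, velocity_smoothCurve _ _ ht, deriv_smul_const (by fun_prop), PiLp.smul_apply,
    p_apply, if_neg hν, smul_zero]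

variable {V : Type*} [NormedAddCommGroup V] [NormedSpace ℝ V]

theorem sum_ext_sineCurve_smul {s t : ℝ} (ht : t ∈ Set.Icc (0 : ℝ) 1)
    (hs : s ∈ Set.Icc (0 : ℝ) 1) (K : Fin 4 → Fin 4 → V) :
    ∑ κ, ∑ ν, (ext (sineCurve q μ n) t κ * ext (sineCurve q μ n) s ν) • K κ ν
      = (Real.sin (Real.pi * n * t) * Real.sin (Real.pi * n * s)) • K μ μ := by
  simp [ext_sineCurve_apply _ _ _ ht, ext_sineCurve_apply _ _ _ hs]

theorem sum_velocity_sineCurve_smul_of_antisymm {t : ℝ} (ht : t ∈ Set.Ioo (0 : ℝ) 1)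
    {K : Fin 4 → Fin 4 → V} (hK : ∀ κ ν, K κ ν = -K ν κ) :
    ∑ κ, ∑ ν, (velocity (sineCurve q μ n) t κ * ext (sineCurve q μ n) t ν
      + velocity (sineCurve q μ n) t κ * ext (sineCurve q μ n) t ν) • K κ ν = 0 := by
  refine Finset.sum_eq_zero fun κ _ => Finset.sum_eq_zero fun ν _ => ?_
  rcases ne_or_eq κ μ with hκ | rfl
  · simp [velocity_sineCurve_apply_of_ne μ n ht hκ]
  rcases ne_or_eq ν κ with hν | rfl
  · simp [ext_sineCurve_apply _ _ _ (Set.Ioo_subset_Icc_self ht), hν]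
  · have := IsAddTorsionFree.of_isTorsionFree ℝ V
    rw [self_eq_neg.1 (hK ν ν), smul_zero]

end SineCurve

section LevyTrace

theorem intervalIntegral_eq_setIntegral_Icc {V : Type*} [NormedAddCommGroup V] [NormedSpace ℝ V]
    (f : ℝ → V) : ∫ t in (0 : ℝ)..1, f t = ∫ t in Set.Icc (0 : ℝ) 1, f t := by
  rw [intervalIntegral.integral_of_le zero_le_one, integral_Icc_eq_integral_Ioc]

theorem sum_η_smul {V : Type*} [AddCommGroup V] [Module ℝ V] (f : Fin 4 → Fin 4 → V) :
    ∑ μ, ∑ ν, η μ ν • f μ ν = ∑ μ, η μ μ • f μ μ := by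
  refine Finset.sum_congr rfl fun μ _ => Finset.sum_eq_single μ (fun ν _ hν => ?_) (by simp)
  rw [η, Matrix.diagonal_apply_ne _ hν.symm, zero_smul]

theorem tendsto_const_mul_natCast_cocompact {c : ℝ} (hc : 0 < c) :
    Filter.Tendsto (fun n : ℕ => c * n) Filter.atTop (Filter.cocompact ℝ) :=
  (tendsto_natCast_atTop_atTop.const_mul_atTop hc).mono_right atTop_le_cocompact

theorem setIntegral_sin_sq_smul {V : Type*} [NormedAddCommGroup V] [NormedSpace ℝ V]
    {f : ℝ → V} {s : Set ℝ} (hf : IntegrableOn f s) (w : ℝ) :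
    ∫ t in s, (Real.sin (w * t) * Real.sin (w * t)) • f t
      = (1 / 2 : ℝ) • (∫ t in s, f t) - (1 / 2 : ℝ) • ∫ t in s, Real.cos (2 * w * t) • f t := by
  have hcos : IntegrableOn (fun t => Real.cos (2 * w * t) • f t) s := by
    have hcont : Continuous fun t : ℝ => Real.cos (2 * w * t) := by fun_prop
    exact Integrable.bdd_smul hf 1 hcont.aestronglyMeasurable
      (.of_forall fun t => Real.abs_cos_le_one _)
  rw [← smul_sub, ← integral_sub hf hcos, ← integral_smul]
  refine integral_congr_ae (.of_forall fun t => ?_)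
  have hsin : Real.sin (w * t) * Real.sin (w * t) = (1 / 2) * (1 - Real.cos (2 * w * t)) := by
    rw [mul_assoc 2, Real.cos_two_mul, Real.cos_sq']
    ring
  simp only [hsin, mul_smul, sub_smul, one_smul]

variable {q : ℝ≥0∞} [Fact (1 ≤ q)]

theorem HasLevyKernels.apply_sineCurve {V : Type} [NormedAddCommGroup V] [NormedSpace ℝ V]
    {Q : Curve q →L[ℝ] Curve q →L[ℝ] V}
    {QV : Fin 4 → Fin 4 → ℝ × ℝ → V} {QL QS : Fin 4 → Fin 4 → ℝ → V}
    (h : HasLevyKernels Q QV QL QS) (μ : Fin 4) (n : ℕ) :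
    Q (sineCurve q μ n) (sineCurve q μ n)
      = (∫ t in Set.Icc (0 : ℝ) 1, ∫ s in Set.Icc (0 : ℝ) 1,
          (Real.sin (Real.pi * n * t) * Real.sin (Real.pi * n * s)) • QV μ μ (t, s))
        + ∫ t in Set.Icc (0 : ℝ) 1,
          (Real.sin (Real.pi * n * t) * Real.sin (Real.pi * n * t)) • QL μ μ t := by
  have hmem := sineCurve_mem_closedCurves (q := q) μ n
  have hsingular := (intervalIntegral.integral_congr_Ioo_of_le (μ := volume) zero_le_one
    fun t ht => sum_velocity_sineCurve_smul_of_antisymm (q := q) μ n ht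
      (K := fun κ ν => QS κ ν t) (h.singular_antisymm · · t)).trans intervalIntegral.integral_zero
  rw [h.eq_on _ hmem _ hmem, hsingular, smul_zero, add_zero]
  simp only [intervalIntegral_eq_setIntegral_Icc]
  congr 1 <;> refine setIntegral_congr_fun measurableSet_Icc fun t ht => ?_
  · exact setIntegral_congr_fun measurableSet_Icc fun s hs =>
      sum_ext_sineCurve_smul μ n ht hs fun κ ν => QV κ ν (t, s)
  · exact sum_ext_sineCurve_smul μ n ht ht fun κ ν => QL κ ν t

variable {V : Type} [NormedAddCommGroup V] [NormedSpace ℂ V] {Q : Curve q →L[ℝ] Curve q →L[ℝ] V}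
  {QV : Fin 4 → Fin 4 → ℝ × ℝ → V} {QL QS : Fin 4 → Fin 4 → ℝ → V}

theorem HasLevyKernels.tendsto_sineCurve (h : HasLevyKernels Q QV QL QS) (μ : Fin 4) :
    Filter.Tendsto (fun n => Q (sineCurve q μ n) (sineCurve q μ n)) Filter.atTop
      (nhds ((1 / 2 : ℝ) • ∫ t in (0 : ℝ)..1, QL μ μ t)) := by
  have hpi := Real.pi_pos
  have hvolterra := (tendsto_setIntegral_sin_mul_sin_smul_cocompact measurableSet_Icc
    (h.integrable_volterra μ μ)).comp (tendsto_const_mul_natCast_cocompact hpi)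
  have hcos := (tendsto_setIntegral_cos_smul_cocompact measurableSet_Icc
    (h.integrable_levy μ μ)).comp (tendsto_const_mul_natCast_cocompact (mul_pos two_pos hpi))
  have hlevy := (tendsto_const_nhds (x := (1 / 2 : ℝ) • ∫ t in Set.Icc (0 : ℝ) 1,
    QL μ μ t)).sub (hcos.const_smul (1 / 2 : ℝ))
  rw [intervalIntegral_eq_setIntegral_Icc]
  convert hvolterra.add hlevy using 2 with n
  · rw [h.apply_sineCurve, setIntegral_sin_sq_smul (h.integrable_levy μ μ)]
    simp only [Function.comp_apply, mul_assoc]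
  · rw [smul_zero, zero_add, sub_zero]

theorem HasLevyKernels.integral_sum_η_smul (h : HasLevyKernels Q QV QL QS) :
    ∫ t in (0 : ℝ)..1, ∑ μ, ∑ ν, η μ ν • QL μ ν t
      = ∑ μ, η μ μ • ∫ t in (0 : ℝ)..1, QL μ μ t := by
  simp only [sum_η_smul]
  rw [intervalIntegral.integral_finsetSum]
  · simp only [intervalIntegral.integral_smul]
  · exact fun μ _ => ((intervalIntegrable_iff_integrableOn_Icc_of_le zero_le_one).2
      (h.integrable_levy μ μ)).smul (η μ μ)

theorem HasLevyKernels.levyTrace_eq (h : HasLevyKernels Q QV QL QS) :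
    levyTrace Q = ∫ t in (0 : ℝ)..1, ∑ μ, ∑ ν, η μ ν • QL μ ν t := by
  have hQ : MemLevySpace Q := ⟨QL, QV, QS, h⟩
  obtain ⟨QV', QS', h'⟩ := hQ.choose_spec
  rw [levyTrace, dif_pos hQ, h.integral_sum_η_smul, h'.integral_sum_η_smul]
  refine Finset.sum_congr rfl fun μ _ => congrArg (η μ μ • ·) ?_
  exact smul_right_injective V (one_div_ne_zero (two_ne_zero (α := ℝ)))
    (tendsto_nhds_unique (h'.tendsto_sineCurve μ) (h.tendsto_sineCurve μ))

end LevyTrace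

/-! ### Endpoint derivatives -/

section VectorMeasure

variable {X V : Type*} [MeasurableSpace X] [NormedAddCommGroup V] [NormedSpace ℝ V]
  [CompleteSpace V]

theorem vectorMeasure_integral_indicator_const (ρ : VectorMeasure X V)
    [IsFiniteMeasure ρ.variation] {s : Set X} (hs : MeasurableSet s) (c : ℝ) :
    ρ.integral (s.indicator fun _ => c) (ContinuousLinearMap.lsmul ℝ ℝ) = c • ρ s := by
  rw [VectorMeasure.integral_eq_setToFun, setToFun_indicator_const _ hs (measure_ne_top _ _)]
  rfl

variable {ρ : Measure X} {d : X → V} (hd : Integrable d ρ)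
include hd

theorem isFiniteMeasure_variation_withDensityᵥ :
    IsFiniteMeasure (ρ.withDensityᵥ d).variation := by
  rw [Measure.variation_withDensityᵥ hd]
  exact isFiniteMeasure_withDensity hd.2.ne

theorem integral_withDensityᵥ_simpleFunc (f : SimpleFunc X ℝ) :
    (ρ.withDensityᵥ d).integral f (ContinuousLinearMap.lsmul ℝ ℝ) = ∫ x, f x • d x ∂ρ := by
  have hfinite := isFiniteMeasure_variation_withDensityᵥ hd
  classical
  induction f using SimpleFunc.induction with
  | const c hs =>
    rw [SimpleFunc.coe_piecewise, SimpleFunc.coe_const, SimpleFunc.coe_const,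
      Function.const_zero, Set.piecewise_eq_indicator]
    refine (vectorMeasure_integral_indicator_const _ hs c).trans ?_
    rw [withDensityᵥ_apply hd hs, ← integral_smul, ← integral_indicator hs]
    refine integral_congr_ae (.of_forall fun x => ?_)
    simp only [Set.indicator_apply, ite_smul, zero_smul, Function.const_apply]
  | @add f g _ hf hg =>
    have hint (h : SimpleFunc X ℝ) : Integrable (fun x => h x • d x) ρ := by
      obtain ⟨C, hC⟩ := h.exists_forall_norm_le
      exact hd.bdd_smul C h.aestronglyMeasurable (.of_forall hC)
    rw [SimpleFunc.coe_add]
    refine (VectorMeasure.integral_fun_add f.integrable_of_isFiniteMeasure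
      g.integrable_of_isFiniteMeasure).trans ?_
    rw [hf, hg, ← integral_add (hint f) (hint g)]
    simp only [Pi.add_apply, add_smul]

theorem integral_withDensityᵥ {f : X → ℝ} (hf : StronglyMeasurable f) {C : ℝ} (hC0 : 0 ≤ C)
    (hC : ∀ x, ‖f x‖ ≤ C) :
    (ρ.withDensityᵥ d).integral f (ContinuousLinearMap.lsmul ℝ ℝ) = ∫ x, f x • d x ∂ρ := by
  have hfinite := isFiniteMeasure_variation_withDensityᵥ hd
  have hbound (n : ℕ) (x : X) := hf.norm_approxBounded_le hC0 n x
  have htendsto (x : X) := hf.tendsto_approxBounded_of_norm_le (hC x)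
  have hleft := VectorMeasure.tendsto_integral_of_dominated_convergence
    (μ := ρ.withDensityᵥ d) (B := ContinuousLinearMap.lsmul ℝ ℝ) (fun _ => C)
    (fun n => (hf.approxBounded C n).aestronglyMeasurable) (integrable_const _)
    (fun n => .of_forall (hbound n)) (.of_forall htendsto)
  have hright := tendsto_integral_of_dominated_convergence (fun x => C * ‖d x‖)
    (fun n => (hf.approxBounded C n).aestronglyMeasurable.smul hd.aestronglyMeasurable)
    (hd.norm.const_mul C)
    (fun n => .of_forall fun x => (norm_smul_le _ _).trans
      (mul_le_mul_of_nonneg_right (hbound n x) (norm_nonneg _)))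
    (.of_forall fun x => (htendsto x).smul_const (d x))
  simp only [integral_withDensityᵥ_simpleFunc hd] at hleft
  exact tendsto_nhds_unique hleft hright

end VectorMeasure

section AtomDensity

variable {V : Type*} [NormedAddCommGroup V]

theorem integrable_unitInterval {d : ℝ → V} (hd : IntervalIntegrable d volume 0 1) :
    Integrable (fun t : unitInterval => d t) :=
  (integrableOn_iff_comap_subtypeVal measurableSet_Icc).1
    ((intervalIntegrable_iff_integrableOn_Icc_of_le zero_le_one).1 hd)

variable [NormedSpace ℝ V]

theorem integral_unitInterval (d : ℝ → V) :
    ∫ t : unitInterval, d t = ∫ t in (0 : ℝ)..1, d t :=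
  (integral_subtype_comap measurableSet_Icc d).trans (intervalIntegral_eq_setIntegral_Icc d).symm

/-- The vector measure on `[0, 1]` with an atom of mass `c` at `1` and density `d` with respect to
Lebesgue measure; such measures represent the derivatives of `Φ` and of `D_ν Φ`. -/
def atomDensity (c : V) (d : ℝ → V) : VectorMeasure unitInterval V :=
  VectorMeasure.dirac 1 c + volume.withDensityᵥ fun t : unitInterval => d t

variable (c : V) {d : ℝ → V} (hd : IntervalIntegrable d volume 0 1)
include hd

theorem atomDensity_singleton_one : atomDensity c d {1} = c := by
  rw [atomDensity, _root_.add_apply, VectorMeasure.dirac_apply_of_mem (measurableSet_singleton _)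
    (Set.mem_singleton _), withDensityᵥ_apply (integrable_unitInterval hd)
    (measurableSet_singleton _), Measure.restrict_zero_set (measure_singleton _),
    integral_zero_measure, add_zero]

variable [CompleteSpace V]

theorem isFiniteMeasure_variation_atomDensity : IsFiniteMeasure (atomDensity c d).variation := by
  have := isFiniteMeasure_variation_withDensityᵥ (integrable_unitInterval hd)
  exact isFiniteMeasure_of_le _ VectorMeasure.variation_add_le

theorem integral_atomDensity (f : C(unitInterval, ℝ)) :
    (atomDensity c d).integral f (ContinuousLinearMap.lsmul ℝ ℝ) =
      f 1 • c + ∫ t in (0 : ℝ)..1, extend f t • d t := by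
  have hd' := integrable_unitInterval hd
  have := isFiniteMeasure_variation_withDensityᵥ hd'
  have hf : StronglyMeasurable f := f.continuous.stronglyMeasurable
  have hint (ρ : Measure unitInterval) [IsFiniteMeasure ρ] : Integrable f ρ :=
    .of_bound hf.aestronglyMeasurable ‖f‖ (.of_forall f.norm_coe_le_norm)
  refine (VectorMeasure.integral_add_vectorMeasure (hint _) (hint _)).trans ?_
  rw [VectorMeasure.integral_dirac,
    integral_withDensityᵥ hd' hf (norm_nonneg f) f.norm_coe_le_norm, ← integral_unitInterval]
  simp only [extend_coe]
  rfl

end AtomDensity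

section Endpoint

theorem contDiff_monomial (μ : Fin 4) (n : ℕ) : ContDiff ℝ 1 fun t : ℝ => t ^ (n + 1) • p μ :=
  (contDiff_id.pow (n + 1)).smul contDiff_const

/-- The curve `t ↦ t ^ (n + 1) p_μ`, a test curve which isolates the atom at `1` of a representing
measure as `n → ∞`. -/
def monomialCurve (q : ℝ≥0∞) (μ : Fin 4) (n : ℕ) : Curve q :=
  smoothCurve (contDiff_monomial μ n) (by simp)

theorem monomialCurve_apply (q : ℝ≥0∞) (μ ν : Fin 4) (n : ℕ) (t : unitInterval) :
    monomialCurve q μ n t ν = if ν = μ then (t : ℝ) ^ (n + 1) else 0 := by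
  rw [monomialCurve, smoothCurve_apply, PiLp.smul_apply, p_apply]
  simp

theorem tendsto_pow_succ_indicator_one (t : unitInterval) :
    Filter.Tendsto (fun n : ℕ => (t : ℝ) ^ (n + 1)) Filter.atTop
      (nhds (({1} : Set unitInterval).indicator (fun _ => 1) t)) := by
  rcases eq_or_ne t 1 with rfl | ht
  · simp
  · rw [Set.indicator_of_notMem (by simpa using ht)]
    exact (tendsto_pow_atTop_nhds_zero_of_lt_one t.2.1
      (unitInterval.lt_one_iff_ne_one.2 ht)).comp (Filter.tendsto_add_atTop_nat 1)

variable {q : ℝ≥0∞} [Fact (1 ≤ q)] {V : Type} [NormedAddCommGroup V] [NormedSpace ℝ V]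
  [CompleteSpace V] {T : Curve q →L[ℝ] V}

theorem isRepresentedBy_atomDensity {c : Fin 4 → V} {d : Fin 4 → ℝ → V}
    (hd : ∀ μ, IntervalIntegrable (d μ) volume 0 1)
    (hT : ∀ u : Curve q, T u = ∑ μ, u 1 μ • c μ + ∫ t in (0 : ℝ)..1, ∑ μ, ext u t μ • d μ t) :
    IsRepresentedBy T fun μ => atomDensity (c μ) (d μ) := by
  refine ⟨fun μ => isFiniteMeasure_variation_atomDensity _ (hd μ), fun u => ?_⟩
  have hcomponent (μ : Fin 4) : (atomDensity (c μ) (d μ)).integral (fun t => u t μ)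
      (ContinuousLinearMap.lsmul ℝ ℝ) = u 1 μ • c μ + ∫ t in (0 : ℝ)..1, ext u t μ • d μ t := by
    have hcoord : (fun t => u t μ) = coord (R := ℝ) μ u := funext fun t => (mul_one _).symm
    rw [hcoord, integral_atomDensity (c μ) (hd μ)]
    simp only [coord_apply, extend_coord, smul_eq_mul, mul_one]
  rw [hT, Finset.sum_congr rfl fun μ _ => hcomponent μ, Finset.sum_add_distrib,
    intervalIntegral.integral_finsetSum]
  exact fun μ _ => (hd μ).continuousOn_smul
    (((EuclideanSpace.proj μ).continuous.comp (continuous_curve u).Icc_extend').continuousOn)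

variable {ρ : Fin 4 → VectorMeasure unitInterval V} (h : IsRepresentedBy T ρ)
include h

theorem IsRepresentedBy.tendsto_monomialCurve (μ : Fin 4) :
    Filter.Tendsto (fun n => T (monomialCurve q μ n)) Filter.atTop (nhds (ρ μ {1})) := by
  have hfinite := h.1 μ
  have happly (n : ℕ) : T (monomialCurve q μ n) =
      (ρ μ).integral (fun t : unitInterval => (t : ℝ) ^ (n + 1))
        (ContinuousLinearMap.lsmul ℝ ℝ) := by
    rw [h.2, Finset.sum_eq_single μ]
    · simp only [monomialCurve_apply, if_true]
    · intro ν _ hν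
      simp only [monomialCurve_apply, if_neg hν]
      exact VectorMeasure.integral_zero
    · simp
  simp only [happly]
  rw [← one_smul ℝ (ρ μ {1}),
    ← vectorMeasure_integral_indicator_const (ρ μ) (measurableSet_singleton _) 1]
  refine VectorMeasure.tendsto_integral_of_dominated_convergence (fun _ => 1)
    (fun n => Continuous.aestronglyMeasurable (by fun_prop)) (integrable_const _)
    (fun n => .of_forall fun t => ?_) (.of_forall tendsto_pow_succ_indicator_one)
  rw [norm_pow, Real.norm_of_nonneg t.2.1]
  exact pow_le_one₀ t.2.1 t.2.2

theorem IsRepresentedBy.endpointFunctional_eq (μ : Fin 4) :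
    endpointFunctional (p μ) T = ρ μ {1} := by
  have hT : ∃ ρ, IsRepresentedBy T ρ := ⟨ρ, h⟩
  rw [endpointFunctional, dif_pos hT, Finset.sum_eq_single μ]
  · rw [p_apply, if_pos rfl, one_smul]
    exact tendsto_nhds_unique (hT.choose_spec.tendsto_monomialCurve μ) (h.tendsto_monomialCurve μ)
  · intro ν _ hν
    rw [p_apply, if_neg hν, zero_smul]
  · simp

end Endpoint

section EndpointTranslate

variable {q : ℝ≥0∞} [Fact (1 ≤ q)] {R : Type} [NormedRing R] [NormedAlgebra ℝ R]

theorem intervalIntegrable_lie_curvatureDensity (A : Fin 4 → Spacetime → R) (σ : Curve q)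
    (μ : Fin 4) (b : R) :
    IntervalIntegrable (fun t => ⁅curvatureDensity A σ μ t, b⁆) volume 0 1 := by
  have hint : IntervalIntegrable (curvatureDensity A σ μ) volume 0 1 :=
    intervalIntegrable_sum_velocity_smul σ _
  exact (hint.mul_const b).sub (hint.const_mul b)

variable [CompleteSpace R]

theorem lie_curvatureIntegral_apply_one (A : Fin 4 → Spacetime → R) (σ u : Curve q) (b : R) :
    ⁅curvatureIntegral A σ u 1, b⁆ =
      ∫ t in (0 : ℝ)..1, ∑ μ, ext u t μ • ⁅curvatureDensity A σ μ t, b⁆ := by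
  let L : R →L[ℝ] R := (ContinuousLinearMap.mul ℝ R).flip b - ContinuousLinearMap.mul ℝ R b
  have hL (a : R) : L a = ⁅a, b⁆ := rfl
  have hprim := isPrimitive_curvatureIntegral A σ u
  rw [← hL, hprim.apply_one (curvatureIntegral_apply_zero A σ u),
    ← L.intervalIntegral_comp_comm hprim.intervalIntegrable]
  simp only [← hL, map_sum, map_smul]

variable {A : Fin 4 → Spacetime → R} (hA : ∀ μ, ContDiff ℝ ∞ (A μ)) {f : Spacetime → R}
  (hf : ContDiff ℝ ∞ f)
include hA hf

theorem fderiv_translate_apply_one (σ u : Curve q) :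
    fderiv ℝ (fun σ : Curve q => translate A f σ 1) σ u =
      ∑ μ, u 1 μ • translate A (covDeriv A μ f) σ 1 +
        ∫ t in (0 : ℝ)..1, ∑ μ, ext u t μ • ⁅curvatureDensity A σ μ t, translate A f σ 1⁆ := by
  have hderiv : HasFDerivAt (translate A f) (fderiv ℝ (translate A f) σ) σ :=
    ((contDiff_translate hA hf 1).differentiable one_ne_zero σ).hasFDerivAt
  rw [(hasFDerivAt_eval hderiv 1).fderiv, ContinuousLinearMap.comp_apply,
    fderiv_translate hA hf, ← lie_curvatureIntegral_apply_one]
  change (∑ μ, translate A (covDeriv A μ f) σ * coord μ u : C(unitInterval, R)) 1 + _ = _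
  simp only [ContinuousMap.sum_apply, ContinuousMap.mul_apply, coord_apply, mul_smul_comm, mul_one]
  rfl

theorem isRepresentedBy_translate (σ : Curve q) :
    IsRepresentedBy (fderiv ℝ (fun σ : Curve q => translate A f σ 1) σ) fun μ =>
      atomDensity (translate A (covDeriv A μ f) σ 1)
        fun t => ⁅curvatureDensity A σ μ t, translate A f σ 1⁆ :=
  isRepresentedBy_atomDensity (fun μ => intervalIntegrable_lie_curvatureDensity A σ μ _)
    (fderiv_translate_apply_one hA hf σ)

theorem memDomEndpoint_translate : MemDomEndpoint fun σ : Curve q => translate A f σ 1 :=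
  ⟨contDiff_eval (contDiff_translate hA hf 1) 1,
    fun σ => ⟨_, isRepresentedBy_translate hA hf σ⟩⟩

theorem D_translate (μ : Fin 4) :
    D μ (fun σ : Curve q => translate A f σ 1) = fun σ => translate A (covDeriv A μ f) σ 1 :=
  funext fun σ => ((isRepresentedBy_translate hA hf σ).endpointFunctional_eq μ).trans
    (atomDensity_singleton_one _ (intervalIntegrable_lie_curvatureDensity A σ μ _))

end EndpointTranslate

/-! ### Rescaling -/

section Dilate

variable {V : Type*} [TopologicalSpace V]

/-- The function `t ↦ f(rt)`. -/
def dilate (r : unitInterval) (f : C(unitInterval, V)) : C(unitInterval, V) :=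
  f.comp (ContinuousMap.mulLeft r)

theorem dilate_apply (r : unitInterval) (f : C(unitInterval, V)) (t : unitInterval) :
    dilate r f t = f (r * t) := rfl

theorem mul_mem_Icc (r : unitInterval) {t : ℝ} (ht : t ∈ Set.Icc (0 : ℝ) 1) :
    (r : ℝ) * t ∈ Set.Icc (0 : ℝ) 1 :=
  (r * ⟨t, ht⟩ : unitInterval).2

theorem extend_dilate (r : unitInterval) (f : C(unitInterval, V)) {t : ℝ}
    (ht : t ∈ Set.Icc (0 : ℝ) 1) : extend (dilate r f) t = extend f (r * t) := by
  rw [extend_of_mem _ ht, extend_of_mem _ (mul_mem_Icc r ht)]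
  rfl

end Dilate

section IsPrimitive

variable {V : Type*} [NormedAddCommGroup V] [NormedSpace ℝ V] {f : C(unitInterval, V)}
  {a b : ℝ → V}

theorem IsPrimitive.comp_mul_left (hf : IsPrimitive f a) (r : unitInterval) :
    IsPrimitive (dilate r f) fun t => (r : ℝ) • a (r * t) where
  intervalIntegrable := by
    rcases eq_or_ne (r : ℝ) 0 with hr | hr
    · simp [hr]
    · have h := (hf.intervalIntegrable_zero_coe r).comp_mul_left (c := (r : ℝ))
      rw [zero_div, div_self hr] at h
      exact h.smul (r : ℝ)
  eq_add t := by
    rw [dilate_apply, dilate_apply, mul_zero, hf.eq_add, intervalIntegral.integral_smul,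
      intervalIntegral.smul_integral_comp_mul_left, mul_zero]
    rfl

theorem IsPrimitive.eqOn_of_continuousOn [CompleteSpace V] (ha : IsPrimitive f a)
    (hb : IsPrimitive f b) (hac : ContinuousOn a (Set.Icc 0 1))
    (hbc : ContinuousOn b (Set.Icc 0 1)) : Set.EqOn a b (Set.Icc 0 1) := by
  refine Measure.eqOn_Icc_of_ae_eq volume zero_ne_one ?_ hac hbc
  rw [← restrict_Ioo_eq_restrict_Icc, Filter.EventuallyEq, ae_restrict_iff' measurableSet_Ioo]
  filter_upwards [ha.ae_hasDerivAt, hb.ae_hasDerivAt] with t hta htb ht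
  exact (hta ht).unique (htb ht)

end IsPrimitive

section RescaleCurve

variable {q : ℝ≥0∞} (σ : Curve q) (r : unitInterval)

theorem ext_rescale {t : ℝ} (ht : t ∈ Set.Icc (0 : ℝ) 1) :
    ext (rescale σ r) t = ext σ (r * t) := by
  rw [ext, ext, Set.IccExtend_of_mem _ _ ht, Set.IccExtend_of_mem _ _ (mul_mem_Icc r ht)]
  rfl

theorem velocity_rescale {t : ℝ} (ht : t ∈ Set.Ioo (0 : ℝ) 1) :
    velocity (rescale σ r) t = (r : ℝ) • velocity σ (r * t) := by
  have h : ext (rescale σ r) =ᶠ[nhds t] fun t => ext σ (r * t) := by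
    filter_upwards [Ioo_mem_nhds ht.1 ht.2] with s hs
    exact ext_rescale σ r (Set.Ioo_subset_Icc_self hs)
  rw [velocity, h.deriv_eq]
  exact deriv_comp_mul_left (r : ℝ) (ext σ) t

theorem sum_velocity_rescale_smul {V : Type*} [NormedAddCommGroup V] [NormedSpace ℝ V]
    (g : Fin 4 → C(unitInterval, V)) {t : ℝ} (ht : t ∈ Set.Ioo (0 : ℝ) 1) :
    ∑ ν, velocity (rescale σ r) t ν • extend (dilate r (g ν)) t
      = (r : ℝ) • ∑ ν, velocity σ (r * t) ν • extend (g ν) (r * t) := by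
  rw [Finset.smul_sum, velocity_rescale σ r ht]
  refine Finset.sum_congr rfl fun ν _ => ?_
  rw [extend_dilate r _ (Set.Ioo_subset_Icc_self ht), smul_smul]
  rfl

theorem pull_rescale [Fact (1 ≤ q)] {V : Type*} [NormedAddCommGroup V] {f : Spacetime → V}
    (hf : Continuous f) : pull f (rescale σ r) = dilate r (pull f σ) := by
  ext t
  rw [pull_apply hf, dilate_apply, pull_apply hf]
  rfl

end RescaleCurve

section RescaleTransport

variable {q : ℝ≥0∞} [Fact (1 ≤ q)] {R : Type*} [NormedRing R] [NormedAlgebra ℝ R]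
  {A : Fin 4 → Spacetime → R} (hA : ∀ μ, Continuous (A μ)) (σ : Curve q) (r : unitInterval)
include hA

theorem connectionDensity_rescale {t : ℝ} (ht : t ∈ Set.Ioo (0 : ℝ) 1) :
    connectionDensity A (rescale σ r) t = (r : ℝ) • connectionDensity A σ (r * t) := by
  simp only [connectionDensity, pull_rescale σ r (hA _)]
  exact sum_velocity_rescale_smul σ r _ ht

variable [CompleteSpace R]

theorem transportMap_rescale : transportMap A (rescale σ r) = dilate r (transportMap A σ) := by
  refine eq_of_isPrimitive_linear (b := 0) (σ := rescale σ r)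
    (B := fun ν => leftMul (-pull (A ν) (rescale σ r))) ?_ ?_ ?_
  · refine (isPrimitive_transportMap A (rescale σ r)).congr (.of_forall fun t _ => ?_)
    rw [sum_velocity_smul_leftMul_neg, Pi.zero_apply, zero_add]
  · refine ((isPrimitive_transportMap A σ).comp_mul_left r).congr (.of_forall fun t ht => ?_)
    rw [sum_velocity_smul_leftMul_neg, Pi.zero_apply, zero_add, connectionDensity_rescale hA σ r ht,
      extend_dilate r _ (Set.Ioo_subset_Icc_self ht), smul_neg, smul_mul_assoc]
  · rw [dilate_apply, mul_zero, transportMap_apply_zero, transportMap_apply_zero]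

theorem invTransport_rescale : invTransport A (rescale σ r) = dilate r (invTransport A σ) := by
  refine left_inv_eq_right_inv (invTransport_mul_transportMap A (rescale σ r)) ?_
  rw [transportMap_rescale hA]
  exact congrArg (dilate r) (transportMap_mul_invTransport A σ)

theorem translate_rescale {f : Spacetime → R} (hf : Continuous f) :
    translate A f (rescale σ r) = dilate r (translate A f σ) := by
  rw [translate, invTransport_rescale hA, pull_rescale σ r hf, transportMap_rescale hA]
  rfl

theorem translate_rescale_apply_one {f : Spacetime → R} (hf : Continuous f) :
    translate A f (rescale σ r) 1 = translate A f σ r := by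
  rw [translate_rescale hA σ r hf, dilate_apply, mul_one]

end RescaleTransport

/-! ### Translated fields -/

theorem conj_lie_conj {R : Type*} [Ring R] {u v : R} (h : u * v = 1) (x y : R) :
    ⁅v * x * u, v * y * u⁆ = v * ⁅x, y⁆ * u := by
  have hmul (x y : R) : v * x * u * (v * y * u) = v * (x * y) * u := by
    calc v * x * u * (v * y * u) = v * x * (u * v) * y * u := by noncomm_ring
      _ = v * (x * y) * u := by rw [h]; noncomm_ring
  rw [Ring.lie_def, Ring.lie_def, hmul, hmul, mul_sub, sub_mul]

section Translate

variable {q : ℝ≥0∞} [Fact (1 ≤ q)] {R : Type*} [NormedRing R] [NormedAlgebra ℝ R]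
  {A : Fin 4 → Spacetime → R} {f g : Spacetime → R} {σ : Curve q}

theorem translate_apply (hf : Continuous f) (t : unitInterval) :
    translate A f σ t = invTransport A σ t * f (σ t) * transportMap A σ t := by
  rw [translate, ContinuousMap.mul_apply, ContinuousMap.mul_apply, pull_apply hf]

variable [CompleteSpace R]

theorem transportMap_mul_invTransport_apply (t : unitInterval) :
    transportMap A σ t * invTransport A σ t = 1 :=
  congrArg (· t) (transportMap_mul_invTransport A σ)

theorem invTransport_mul_transportMap_apply (t : unitInterval) :
    invTransport A σ t * transportMap A σ t = 1 :=
  congrArg (· t) (invTransport_mul_transportMap A σ)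

theorem translate_lie (hf : Continuous f) (hg : Continuous g) (t : unitInterval) :
    translate A (fun x => ⁅f x, g x⁆) σ t = ⁅translate A f σ t, translate A g σ t⁆ := by
  have hlie : Continuous fun x => ⁅f x, g x⁆ := by
    simp only [Ring.lie_def]
    fun_prop
  rw [translate_apply hlie, translate_apply hf, translate_apply hg,
    conj_lie_conj (transportMap_mul_invTransport_apply t)]

theorem translate_apply_eq_zero_iff (hf : Continuous f) {t : unitInterval} :
    translate A f σ t = 0 ↔ f (σ t) = 0 := by
  rw [translate_apply hf]
  refine ⟨fun h => ?_, fun h => by rw [h, mul_zero, zero_mul]⟩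
  have hconj : transportMap A σ t * (invTransport A σ t * f (σ t) * transportMap A σ t)
      * invTransport A σ t = f (σ t) := by
    rw [← mul_assoc, ← mul_assoc, transportMap_mul_invTransport_apply, one_mul, mul_assoc,
      transportMap_mul_invTransport_apply, mul_one]
  rw [← hconj, h, mul_zero, zero_mul]

end Translate

/-! ### Transported integrals -/

section TransportedIntegral

variable {q : ℝ≥0∞} [Fact (1 ≤ q)] {R : Type*} [NormedRing R] [NormedAlgebra ℝ R]

/-- The integral `t ↦ ∫_0^t U_{0,s} f_ν(σ(s)) U_{s,0} σ̇^ν(s) ds` of a `1`-form `f` along `σ`,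
transported back to the starting point. -/
def transportedIntegral (A f : Fin 4 → Spacetime → R) (σ : Curve q) : C(unitInterval, R) :=
  ∑ ν, integralAlong ν σ (translate A (f ν) σ)

variable {A f : Fin 4 → Spacetime → R}

theorem isPrimitive_transportedIntegral (A f : Fin 4 → Spacetime → R) (σ : Curve q) :
    IsPrimitive (transportedIntegral A f σ)
      fun s => ∑ ν, velocity σ s ν • extend (translate A (f ν) σ) s :=
  (IsPrimitive.sum Finset.univ fun ν _ => isPrimitive_integralAlong ν σ _).congr
    (.of_forall fun _ _ => Finset.sum_apply ..)

theorem transportedIntegral_apply_zero (A f : Fin 4 → Spacetime → R) (σ : Curve q) :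
    transportedIntegral A f σ 0 = 0 := by
  rw [transportedIntegral, ContinuousMap.sum_apply]
  exact Finset.sum_eq_zero fun ν _ => integralAlong_apply_zero ν σ _

variable [CompleteSpace R]

theorem transportedIntegral_rescale (hA : ∀ μ, Continuous (A μ)) (hf : ∀ ν, Continuous (f ν))
    (σ : Curve q) (r : unitInterval) :
    transportedIntegral A f (rescale σ r) = dilate r (transportedIntegral A f σ) := by
  refine (isPrimitive_transportedIntegral A f (rescale σ r)).eq
    (((isPrimitive_transportedIntegral A f σ).comp_mul_left r).congr
      (.of_forall fun t ht => ?_)) ?_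
  · simp only [translate_rescale hA σ r (hf _)]
    exact (sum_velocity_rescale_smul σ r _ ht).symm
  · rw [dilate_apply, mul_zero, transportedIntegral_apply_zero, transportedIntegral_apply_zero]

theorem transportedIntegral_eq_zero (hA : ∀ μ, Continuous (A μ)) (hf : ∀ ν, Continuous (f ν))
    (h : ∀ σ : Curve q, transportedIntegral A f σ 1 = 0) (σ : Curve q) :
    transportedIntegral A f σ = 0 := by
  ext r
  rw [ContinuousMap.zero_apply, ← h (rescale σ r), transportedIntegral_rescale hA hf, dilate_apply,
    mul_one]

theorem contDiff_quadratic (x w : Spacetime) :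
    ContDiff ℝ 1 fun t : ℝ => t • x + (t * (t - 1)) • (w - x) := by
  fun_prop

theorem hasDerivAt_quadratic (x w : Spacetime) (t : ℝ) :
    HasDerivAt (fun t : ℝ => t • x + (t * (t - 1)) • (w - x)) (x + (2 * t - 1) • (w - x)) t := by
  have h := ((hasDerivAt_id t).smul_const x).add
    (((hasDerivAt_id t).mul ((hasDerivAt_id t).sub_const 1)).smul_const (w - x))
  simp only [id_eq, one_mul, one_smul, mul_one] at h
  convert! h using 3
  ring

/-- The quadratic curve which ends at `x` with velocity `w`. -/
def curveTo (q : ℝ≥0∞) (x w : Spacetime) : Curve q :=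
  smoothCurve (contDiff_quadratic x w) (by simp)

omit [Fact (1 ≤ q)] in
theorem curveTo_apply_one (x w : Spacetime) : curveTo q x w 1 = x := by
  rw [curveTo, smoothCurve_apply]
  simp

omit [Fact (1 ≤ q)] in
theorem velocity_curveTo (x w : Spacetime) {t : ℝ} (ht : t ∈ Set.Ioo (0 : ℝ) 1) :
    velocity (curveTo q x w) t = x + (2 * t - 1) • (w - x) :=
  (velocity_smoothCurve _ _ ht).trans (hasDerivAt_quadratic x w t).deriv

theorem sum_smul_translate_apply_one_eq_zero (hA : ∀ μ, Continuous (A μ))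
    (hf : ∀ ν, Continuous (f ν)) (h : ∀ σ : Curve q, transportedIntegral A f σ 1 = 0)
    (x w : Spacetime) : ∑ ν, w ν • translate A (f ν) (curveTo q x w) 1 = 0 := by
  have hvel (ν : Fin 4) : Continuous fun t : ℝ => (x + (2 * t - 1) • (w - x)) ν := by
    simp only [PiLp.add_apply, PiLp.smul_apply]
    fun_prop
  have hprim : IsPrimitive (0 : C(unitInterval, R)) fun t => ∑ ν,
      (x + (2 * t - 1) • (w - x)) ν • extend (translate A (f ν) (curveTo q x w)) t := by
    rw [← transportedIntegral_eq_zero hA hf h (curveTo q x w)]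
    refine (isPrimitive_transportedIntegral A f _).congr (.of_forall fun t ht => ?_)
    rw [velocity_curveTo x w ht]
  have hzero := hprim.eqOn_of_continuousOn (.const 0)
    (continuous_finsetSum _ fun ν _ => (hvel ν).smul (map_continuous _)).continuousOn
    continuousOn_const (Set.right_mem_Icc.2 zero_le_one)
  have hend : x + (2 * (1 : ℝ) - 1) • (w - x) = w := by norm_num
  simp only [hend, extend_of_mem _ (Set.right_mem_Icc.2 zero_le_one)] at hzero
  exact hzero

theorem eq_zero_of_transportedIntegral_apply_one_eq_zero (hA : ∀ μ, Continuous (A μ))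
    (hf : ∀ ν, Continuous (f ν)) (h : ∀ σ : Curve q, transportedIntegral A f σ 1 = 0)
    (ν : Fin 4) (x : Spacetime) : f ν x = 0 := by
  have hsum := sum_smul_translate_apply_one_eq_zero hA hf h x (p ν)
  simp only [p_apply, ite_smul, one_smul, zero_smul, Finset.sum_ite_eq', Finset.mem_univ,
    if_true, translate_apply_eq_zero_iff (hf ν), curveTo_apply_one] at hsum
  exact hsum

theorem transportedIntegral_apply_one_eq_zero_iff (hA : ∀ μ, Continuous (A μ))
    (hf : ∀ ν, Continuous (f ν)) :
    (∀ σ : Curve q, transportedIntegral A f σ 1 = 0) ↔ ∀ ν x, f ν x = 0 := by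
  refine ⟨eq_zero_of_transportedIntegral_apply_one_eq_zero hA hf, fun h σ => ?_⟩
  have htranslate (ν : Fin 4) : translate A (f ν) σ = 0 :=
    ContinuousMap.ext fun t => (translate_apply_eq_zero_iff (hf ν)).2 (h ν (σ t))
  simp only [transportedIntegral, htranslate, map_zero, Finset.sum_const_zero,
    ContinuousMap.zero_apply]

end TransportedIntegral

/-! ### The Yang–Mills current -/

section Current

variable {R : Type*} [NormedRing R] [NormedAlgebra ℝ R]

/-- The left-hand side `∇^μ F_{μν} - [φ, ∇_ν φ]` of the Yang–Mills equation, in any normed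
algebra. -/
def yangMillsCurrent (A : Fin 4 → Spacetime → R) (φ : Spacetime → R) (ν : Fin 4)
    (x : Spacetime) : R :=
  ∑ lam, ∑ μ, η lam μ • covDeriv A lam (fieldStrength A μ ν) x - ⁅φ x, covDeriv A ν φ x⁆

variable {A : Fin 4 → Spacetime → R} (hA : ∀ μ, ContDiff ℝ ∞ (A μ)) {φ : Spacetime → R}
  (hφ : ContDiff ℝ ∞ φ)
include hA hφ

theorem contDiff_yangMillsCurrent (ν : Fin 4) : ContDiff ℝ ∞ (yangMillsCurrent A φ ν) := by
  refine ContDiff.sub ?_ (contDiff_lie hφ (contDiff_covDeriv hA hφ ν))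
  exact ContDiff.sum fun lam _ => ContDiff.sum fun μ _ =>
    (contDiff_covDeriv hA (contDiff_fieldStrength hA μ ν) lam).const_smul (η lam μ)

variable {q : ℝ≥0∞} [Fact (1 ≤ q)]

theorem translate_yangMillsCurrent (ν : Fin 4) (σ : Curve q) (t : unitInterval) :
    translate A (yangMillsCurrent A φ ν) σ t
      = ∑ μ, η μ μ • translate A (covDeriv A μ (fieldStrength A μ ν)) σ t
        - translate A (fun x => ⁅φ x, covDeriv A ν φ x⁆) σ t := by
  have hF (μ : Fin 4) := (contDiff_covDeriv hA (contDiff_fieldStrength hA μ ν) μ).continuous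
  have hlie := (contDiff_lie hφ (contDiff_covDeriv hA hφ ν)).continuous
  simp only [translate_apply (contDiff_yangMillsCurrent hA hφ ν).continuous,
    translate_apply (hF _), translate_apply hlie, yangMillsCurrent, sum_η_smul, mul_sub, sub_mul,
    Finset.mul_sum, Finset.sum_mul, mul_smul_comm, smul_mul_assoc]

end Current

section LevyKernel

variable {q : ℝ≥0∞} [Fact (1 ≤ q)] {R : Type*} [NormedRing R] [NormedAlgebra ℝ R]

theorem sum_η_smul_levyKernel (A : Fin 4 → Spacetime → R) (σ : Curve q) (t : ℝ) :
    ∑ μ, ∑ ν, η μ ν • levyKernel A σ μ ν t = -(holonomy A σ * ∑ κ, velocity σ t κ •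
      ∑ μ, η μ μ • extend (translate A (covDeriv A μ (fieldStrength A μ κ)) σ) t) := by
  have hdiag (μ : Fin 4) : levyKernel A σ μ μ t = -(holonomy A σ * ∑ κ, velocity σ t κ •
      extend (translate A (covDeriv A μ (fieldStrength A μ κ)) σ) t) := by
    rw [levyKernel, ← two_smul ℝ, mul_smul_comm, smul_smul]
    norm_num
  simp only [sum_η_smul, hdiag, smul_neg, Finset.sum_neg_distrib, Finset.mul_sum, Finset.smul_sum,
    mul_smul_comm]
  rw [Finset.sum_comm]
  simp only [smul_comm (η _ _)]

end LevyKernel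

/-! ### Skew-adjoint connections -/

section SkewAdjoint

variable {q : ℝ≥0∞} [Fact (1 ≤ q)] {R : Type*} [NormedRing R] [NormedAlgebra ℝ R] [StarRing R]
  [StarModule ℝ R] {A : Fin 4 → Spacetime → R} (hA : ∀ μ, Continuous (A μ))
  (hskew : ∀ μ x, A μ x ∈ skewAdjoint R) (σ : Curve q)
include hA hskew

theorem star_connectionDensity (t : ℝ) :
    star (connectionDensity A σ t) = -connectionDensity A σ t := by
  simp only [connectionDensity, extend_pull (hA _), star_sum, star_smul, star_trivial,
    skewAdjoint.mem_iff.1 (hskew _ _), smul_neg, Finset.sum_neg_distrib]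

variable [CompleteSpace R] [ContinuousStar R]

theorem invTransport_eq_star : invTransport A σ = star (transportMap A σ) := by
  refine eq_of_isPrimitive_linear (b := 0) (B := fun ν => rightMul (pull (A ν) σ)) (σ := σ)
    ?_ ?_ ?_
  · refine (isPrimitive_invTransport A σ).congr (.of_forall fun t _ => ?_)
    rw [sum_velocity_smul_rightMul, Pi.zero_apply, zero_add]
  · refine ((isPrimitive_transportMap A σ).map (starL' ℝ : R ≃L[ℝ] R).toContinuousLinearMap
      (g := star (transportMap A σ)) fun t => rfl).congr (.of_forall fun t _ => ?_)
    change star (-(connectionDensity A σ t * extend (transportMap A σ) t)) = _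
    rw [sum_velocity_smul_rightMul, Pi.zero_apply, zero_add, star_neg, star_mul,
      star_connectionDensity hA hskew, mul_neg, neg_neg]
    rfl
  · rw [ContinuousMap.star_apply, transportMap_apply_zero, invTransport_apply_zero, star_one]

theorem transportMap_apply_mem_unitary (t : unitInterval) : transportMap A σ t ∈ unitary R := by
  have hstar : star (transportMap A σ t) = invTransport A σ t :=
    congrArg (· t) (invTransport_eq_star hA hskew σ).symm
  rw [Unitary.mem_iff, hstar]
  exact ⟨invTransport_mul_transportMap_apply t, transportMap_mul_invTransport_apply t⟩

theorem translate_apply_eq_star_mul_mul {f : Spacetime → R} (hf : Continuous f)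
    (t : unitInterval) :
    translate A f σ t = star (transportMap A σ t) * f (σ t) * transportMap A σ t := by
  rw [translate_apply hf, invTransport_eq_star hA hskew, ContinuousMap.star_apply]

end SkewAdjoint

/-! ### Carathéodory solutions -/

section Integrals

theorem IsPrimitive.intervalIntegrable_of_mem {V : Type*} [NormedAddCommGroup V]
    [NormedSpace ℝ V] {f : C(unitInterval, V)} {a : ℝ → V} (hf : IsPrimitive f a) {s t : ℝ}
    (hs : s ∈ Set.Icc (0 : ℝ) 1) (ht : t ∈ Set.Icc (0 : ℝ) 1) : IntervalIntegrable a volume s t :=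
  hf.intervalIntegrable.mono_set <| by
    rw [Set.uIcc_of_le zero_le_one]
    exact Set.uIcc_subset_Icc hs ht

theorem IsPrimitive.integral_eq_sub {V : Type*} [NormedAddCommGroup V] [NormedSpace ℝ V]
    {f : C(unitInterval, V)} {a : ℝ → V} (hf : IsPrimitive f a) {s t : ℝ}
    (hs : s ∈ Set.Icc (0 : ℝ) 1) (ht : t ∈ Set.Icc (0 : ℝ) 1) :
    ∫ τ in s..t, a τ = extend f t - extend f s := by
  have h0 : (0 : ℝ) ∈ Set.Icc (0 : ℝ) 1 := Set.left_mem_Icc.2 zero_le_one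
  rw [← intervalIntegral.integral_interval_sub_left (hf.intervalIntegrable_of_mem h0 ht)
      (hf.intervalIntegrable_of_mem h0 hs),
    extend_of_mem f ht, extend_of_mem f hs, hf.eq_add ⟨t, ht⟩, hf.eq_add ⟨s, hs⟩,
    add_sub_add_left_eq_sub]

variable {q : ℝ≥0∞} [Fact (1 ≤ q)] {R : Type*} [NormedRing R] [NormedAlgebra ℝ R]

theorem intervalIntegrable_connectionDensity_mul (A : Fin 4 → Spacetime → R) (σ : Curve q)
    (g : C(unitInterval, R)) :
    IntervalIntegrable (fun t => connectionDensity A σ t * extend g t) volume 0 1 := by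
  simp only [connectionDensity, Finset.sum_mul, smul_mul_assoc, ← extend_mul]
  exact intervalIntegrable_sum_velocity_smul σ _

variable [CompleteSpace R]

section

variable (A : Fin 4 → Spacetime → R) (σ : Curve q) {s t : ℝ} (hs : s ∈ Set.Icc (0 : ℝ) 1)
  (ht : t ∈ Set.Icc (0 : ℝ) 1) (x : R)
include hs ht

theorem integral_connectionDensity_mul_transportMap_mul :
    ∫ τ in s..t, connectionDensity A σ τ * (extend (transportMap A σ) τ * x)
      = (extend (transportMap A σ) s - extend (transportMap A σ) t) * x := by
  have hprim := isPrimitive_transportMap A σ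
  rw [← neg_sub, ← hprim.integral_eq_sub hs ht, neg_mul,
    ← integral_mul_const_of_intervalIntegrable (hprim.intervalIntegrable_of_mem hs ht),
    ← intervalIntegral.integral_neg]
  simp only [neg_mul, neg_neg, mul_assoc]

theorem integral_mul_invTransport_mul_connectionDensity :
    ∫ τ in s..t, x * extend (invTransport A σ) τ * connectionDensity A σ τ
      = x * (extend (invTransport A σ) t - extend (invTransport A σ) s) := by
  have hprim := isPrimitive_invTransport A σ
  rw [← hprim.integral_eq_sub hs ht,
    ← integral_const_mul_of_intervalIntegrable (hprim.intervalIntegrable_of_mem hs ht)]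
  simp only [mul_assoc]

end

theorem eq_transportMap_of_eq_one_sub_integral {A : Fin 4 → Spacetime → R} {σ : Curve q}
    {g : C(unitInterval, R)} (hg : ∀ t : unitInterval,
      g t = 1 - ∫ τ in (0 : ℝ)..t, connectionDensity A σ τ * extend g τ) :
    g = transportMap A σ := by
  have hg0 : g 0 = 1 := by simp [hg 0]
  have hprim : IsPrimitive g fun t => -(connectionDensity A σ t * extend g t) :=
    ⟨(intervalIntegrable_connectionDensity_mul A σ g).neg, fun t => by
      rw [intervalIntegral.integral_neg, hg0, ← sub_eq_add_neg, ← hg t]⟩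
  refine eq_of_isPrimitive_linear (b := 0) (B := fun ν => leftMul (-pull (A ν) σ)) (σ := σ)
    (hprim.congr (.of_forall fun t _ => ?_))
    ((isPrimitive_transportMap A σ).congr (.of_forall fun t _ => ?_))
    (hg0.trans (transportMap_apply_zero A σ).symm)
  all_goals rw [sum_velocity_smul_leftMul_neg, Pi.zero_apply, zero_add]

end Integrals

section MatrixTransport

variable {q : ℝ≥0∞} [Fact (1 ≤ q)] {N : ℕ} {A : Fin 4 → Spacetime → Mat N}
  (hA : ∀ μ, Continuous (A μ))
include hA

theorem connectionDensity_eq_connectionAlong (σ : Curve q) :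
    connectionDensity A σ = connectionAlong A σ := by
  funext t
  simp only [connectionDensity, connectionAlong, extend_pull (hA _)]

theorem isParallelTransport (σ : Curve q) : IsParallelTransport A σ fun t s =>
    extend (transportMap A σ) t * extend (invTransport A σ) s where
  continuousOn_left _ _ := ((map_continuous _).mul continuous_const).continuousOn
  continuousOn_right _ _ := (continuous_const.mul (map_continuous _)).continuousOn
  left_eq s t h0 hst h1 := by
    rw [← connectionDensity_eq_connectionAlong hA, integral_connectionDensity_mul_transportMap_mul
      A σ ⟨h0, hst.trans h1⟩ ⟨h0.trans hst, h1⟩, sub_mul, ← extend_mul,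
      transportMap_mul_invTransport, extend_one, sub_sub_cancel]
  right_eq s t h0 hst h1 := by
    rw [← connectionDensity_eq_connectionAlong hA, integral_mul_invTransport_mul_connectionDensity
      A σ ⟨h0, hst.trans h1⟩ ⟨h0.trans hst, h1⟩, mul_sub, ← extend_mul _ _ t,
      transportMap_mul_invTransport, extend_one, sub_sub_cancel]

theorem IsParallelTransport.eq_holonomy {σ : Curve q} {U : ℝ → ℝ → Mat N}
    (hU : IsParallelTransport A σ U) : U 1 0 = holonomy A σ := by
  let g : C(unitInterval, Mat N) := ⟨fun t => U t 0,
    continuousOn_iff_continuous_domRestrict.1 (hU.continuousOn_left 0 ⟨le_rfl, zero_le_one⟩)⟩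
  suffices h : g = transportMap A σ from congrArg (· 1) h
  refine eq_transportMap_of_eq_one_sub_integral fun t =>
    (hU.left_eq 0 t le_rfl t.2.1 t.2.2).trans ?_
  congr 1
  refine intervalIntegral.integral_congr fun s hs => ?_
  have hs' : s ∈ Set.Icc (0 : ℝ) 1 := by
    rw [← Set.uIcc_of_le zero_le_one]
    exact uIcc_zero_coe_subset t hs
  rw [connectionDensity_eq_connectionAlong hA, extend_of_mem g hs']
  rfl

theorem U10_eq : U10 (q := q) A = holonomy A := by
  funext σ
  have h : ∃ U, IsParallelTransport A σ U := ⟨_, isParallelTransport hA σ⟩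
  rw [U10, transport, dif_pos h]
  exact h.choose_spec.eq_holonomy hA

theorem U01_eq (σ : Curve q) : U01 A σ = invTransport A σ 1 := by
  rw [U01, U10_eq hA]
  exact Matrix.inv_eq_left_inv (invTransport_mul_transportMap_apply 1)

theorem Φ_eq {f : Spacetime → Mat N} (hf : Continuous f) :
    Φ (q := q) A f = fun σ => translate A f σ 1 := by
  funext σ
  rw [translate_apply hf, Φ, U01_eq hA, U10_eq hA]
  rfl

end MatrixTransport

section Unitary

variable {N : ℕ} {u : Mat N} (hu : u ∈ unitary (Mat N))
include hu

theorem trace_star_mul_mul (M : Mat N) : (star u * M * u).trace = M.trace := by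
  rw [Matrix.trace_mul_cycle, Unitary.mul_star_self_of_mem hu, one_mul]

theorem star_mul_mul_mem_su {M : Mat N} (hM : M ∈ su N) : star u * M * u ∈ su N := by
  refine ⟨?_, (trace_star_mul_mul hu M).trans hM.2⟩
  rw [← Matrix.star_eq_conjTranspose, star_mul, star_mul, star_star,
    Matrix.star_eq_conjTranspose M, hM.1, neg_mul, mul_neg, mul_assoc]

theorem trace_conjTranspose_mul_self_star_mul_mul (M : Mat N) :
    ((star u * M * u)ᴴ * (star u * M * u)).trace = (Mᴴ * M).trace := by
  rw [← trace_star_mul_mul hu (Mᴴ * M)]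
  congr 1
  calc (star u * M * u)ᴴ * (star u * M * u) = star u * Mᴴ * (u * star u) * M * u := by
        simp only [← Matrix.star_eq_conjTranspose, star_mul, star_star, mul_assoc]
    _ = star u * (Mᴴ * M) * u := by
        rw [Unitary.mul_star_self_of_mem hu, mul_one, mul_assoc (star u)]

end Unitary

section HolonomyConjugation

variable {q : ℝ≥0∞} [Fact (1 ≤ q)] {N : ℕ} {A : Fin 4 → Spacetime → Mat N}
  (hA : ∀ μ, Continuous (A μ)) (hskew : ∀ μ x, A μ x ∈ skewAdjoint (Mat N))
  {f : Spacetime → Mat N} (hf : Continuous f) (σ : Curve q)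
include hA hskew

theorem holonomy_mem_unitary : holonomy A σ ∈ unitary (Mat N) :=
  transportMap_apply_mem_unitary hA hskew σ 1

include hf

theorem Φ_eq_star_holonomy_mul_mul :
    Φ A f σ = star (holonomy A σ) * f (σ 1) * holonomy A σ := by
  rw [Φ_eq hA hf]
  exact translate_apply_eq_star_mul_mul hA hskew σ hf 1

theorem Φ_mem_su (hsu : ∀ x, f x ∈ su N) : Φ A f σ ∈ su N := by
  rw [Φ_eq_star_holonomy_mul_mul hA hskew hf]
  exact star_mul_mul_mem_su (holonomy_mem_unitary hA hskew σ) (hsu _)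

end HolonomyConjugation

/-! ### The equations of motion -/

section Current

variable {q : ℝ≥0∞} [Fact (1 ≤ q)] {N : ℕ} {A : Fin 4 → Spacetime → Mat N}
  (hA : ∀ μ, ContDiff ℝ ∞ (A μ)) {φ : Spacetime → Mat N} (hφ : ContDiff ℝ ∞ φ)
include hA hφ

theorem D_Φ (ν : Fin 4) : D ν (Φ (q := q) A φ) = Φ A (covDeriv A ν φ) := by
  have hAc (μ : Fin 4) := (hA μ).continuous
  rw [Φ_eq hAc hφ.continuous, Φ_eq hAc (contDiff_covDeriv hA hφ ν).continuous,
    D_translate hA hφ ν]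

theorem memDomEndpoint_Φ : MemDomEndpoint (Φ (q := q) A φ) := by
  rw [Φ_eq (fun μ => (hA μ).continuous) hφ.continuous]
  exact memDomEndpoint_translate hA hφ

omit hφ in
theorem memDomBox_U10 : MemDomBox (U10 (q := q) A) := by
  rw [U10_eq fun μ => (hA μ).continuous]
  exact ⟨contDiff_holonomy hA 2, fun σ => ⟨_, _, _, hasLevyKernels_holonomy hA σ⟩⟩

theorem currentIntegrand_Φ (σ : Curve q) : currentIntegrand (Φ A φ) σ = fun t =>
    ∑ ν, velocity σ t ν • extend (translate A (fun x => ⁅φ x, covDeriv A ν φ x⁆) σ) t := by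
  have hAc (μ : Fin 4) := (hA μ).continuous
  have hcov (ν : Fin 4) := (contDiff_covDeriv hA hφ ν).continuous
  funext t
  refine Finset.sum_congr rfl fun ν _ => ?_
  rw [D_Φ hA hφ, Φ_eq hAc hφ.continuous, Φ_eq hAc (hcov ν)]
  beta_reduce
  rw [extend_apply, translate_lie hφ.continuous (hcov ν),
    translate_rescale_apply_one hAc σ _ hφ.continuous,
    translate_rescale_apply_one hAc σ _ (hcov ν)]

theorem intervalIntegrable_currentIntegrand_Φ (σ : Curve q) :
    IntervalIntegrable (currentIntegrand (Φ A φ) σ) volume 0 1 := by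
  rw [currentIntegrand_Φ hA hφ]
  exact intervalIntegrable_sum_velocity_smul σ _

theorem sum_η_smul_levyKernel_add_mul_currentIntegrand (σ : Curve q) (t : ℝ) :
    ∑ μ, ∑ ν, η μ ν • levyKernel A σ μ ν t + holonomy A σ * currentIntegrand (Φ A φ) σ t
      = -(holonomy A σ *
        ∑ ν, velocity σ t ν • extend (translate A (yangMillsCurrent A φ ν) σ) t) := by
  simp only [sum_η_smul_levyKernel, currentIntegrand_Φ hA hφ, extend_apply,
    translate_yangMillsCurrent hA hφ, smul_sub, Finset.sum_sub_distrib, mul_sub, neg_sub]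
  abel

theorem levyBox_add_mul_integral (σ : Curve q) :
    levyBox (U10 A) σ + U10 A σ * ∫ r in (0 : ℝ)..1, currentIntegrand (Φ A φ) σ r
      = -(holonomy A σ * transportedIntegral A (yangMillsCurrent A φ) σ 1) := by
  have hprim := isPrimitive_transportedIntegral A (yangMillsCurrent A φ) σ
  have hcur := intervalIntegrable_currentIntegrand_Φ hA hφ σ
  have hlevy := (hasLevyKernels_holonomy hA σ).integrable_levy
  have htrace :
      IntervalIntegrable (fun t => ∑ μ, ∑ ν, η μ ν • levyKernel A σ μ ν t) volume 0 1 := by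
    rw [intervalIntegrable_iff_integrableOn_Icc_of_le zero_le_one]
    exact integrable_finsetSum _ fun μ _ => integrable_finsetSum _ fun ν _ =>
      (hlevy μ ν).smul (η μ ν)
  rw [U10_eq fun μ => (hA μ).continuous, levyBox, (hasLevyKernels_holonomy hA σ).levyTrace_eq,
    ← integral_const_mul_of_intervalIntegrable hcur,
    ← intervalIntegral.integral_add htrace (hcur.const_mul (holonomy A σ)),
    hprim.apply_one (transportedIntegral_apply_zero A _ σ),
    ← integral_const_mul_of_intervalIntegrable hprim.intervalIntegrable,
    ← intervalIntegral.integral_neg]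
  simp only [sum_η_smul_levyKernel_add_mul_currentIntegrand hA hφ]

theorem levyBox_equation_iff :
    (∀ σ : Curve q, levyBox (U10 A) σ
      + U10 A σ * (∫ r in (0 : ℝ)..1, currentIntegrand (Φ A φ) σ r) = 0) ↔
    ∀ ν x, yangMillsCurrent A φ ν x = 0 := by
  have hYM (ν : Fin 4) := (contDiff_yangMillsCurrent hA hφ ν).continuous
  rw [← transportedIntegral_apply_one_eq_zero_iff (q := q) (fun μ => (hA μ).continuous) hYM]
  refine forall_congr' fun σ => ?_
  have hunit : IsUnit (holonomy A σ) :=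
    IsUnit.of_mul_eq_one_right _ (invTransport_mul_transportMap_apply 1)
  rw [levyBox_add_mul_integral hA hφ, neg_eq_zero, hunit.mul_right_eq_zero]

end Current

section Higgs

variable {q : ℝ≥0∞} [Fact (1 ≤ q)] {N : ℕ}

/-- The left-hand side `∇^μ ∇_μ φ - (m² - l tr(φ* φ)) φ` of the equation of motion of the Higgs
field. -/
def higgsExpression (m l : ℝ) (A : Fin 4 → Spacetime → Mat N) (φ : Spacetime → Mat N)
    (x : Spacetime) : Mat N :=
  ∑ μ, ∑ ν, η μ ν • covDeriv A μ (covDeriv A ν φ) x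
    - ((m : ℂ) ^ 2 - (l : ℂ) * ((φ x)ᴴ * φ x).trace) • φ x

variable {A : Fin 4 → Spacetime → Mat N} (hA : ∀ μ, ContDiff ℝ ∞ (A μ)) {φ : Spacetime → Mat N}
  (hφ : ContDiff ℝ ∞ φ) (m l : ℝ)
include hA hφ

theorem continuous_higgsExpression : Continuous (higgsExpression m l A φ) := by
  have hcov (μ ν : Fin 4) : Continuous (covDeriv A μ (covDeriv A ν φ)) :=
    (contDiff_covDeriv hA (contDiff_covDeriv hA hφ ν) μ).continuous
  have hφc := hφ.continuous
  unfold higgsExpression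
  fun_prop

theorem Φ_higgsExpression (hskew : ∀ μ x, A μ x ∈ skewAdjoint (Mat N)) (σ : Curve q) :
    Φ A (higgsExpression m l A φ) σ = ∑ μ, ∑ ν, η μ ν • D μ (D ν (Φ A φ)) σ
      - ((m : ℂ) ^ 2 - (l : ℂ) * ((Φ A φ σ)ᴴ * Φ A φ σ).trace) • Φ A φ σ := by
  have hAc (μ : Fin 4) := (hA μ).continuous
  have hcov (ν : Fin 4) := contDiff_covDeriv hA hφ ν
  have hcovcov (μ ν : Fin 4) := (contDiff_covDeriv hA (hcov ν) μ).continuous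
  have hconj {f : Spacetime → Mat N} (hf : Continuous f) :=
    Φ_eq_star_holonomy_mul_mul hAc hskew hf σ
  simp only [D_Φ hA hφ, D_Φ hA (hcov _), hconj (continuous_higgsExpression hA hφ m l),
    hconj hφ.continuous, hconj (hcovcov _ _),
    trace_conjTranspose_mul_self_star_mul_mul (holonomy_mem_unitary hAc hskew σ),
    higgsExpression, mul_sub, sub_mul, Finset.mul_sum, Finset.sum_mul, mul_smul_comm,
    smul_mul_assoc]

theorem endpoint_equation_iff (hskew : ∀ μ x, A μ x ∈ skewAdjoint (Mat N)) :
    (∀ σ : Curve q, ∑ μ, ∑ ν, η μ ν • D μ (D ν (Φ A φ)) σ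
      - ((m : ℂ) ^ 2 - (l : ℂ) * ((Φ A φ σ)ᴴ * Φ A φ σ).trace) • Φ A φ σ = 0) ↔
    ∀ x, higgsExpression m l A φ x = 0 := by
  have hcont := continuous_higgsExpression hA hφ m l
  simp only [← Φ_higgsExpression hA hφ m l hskew, Φ_eq (fun μ => (hA μ).continuous) hcont,
    translate_apply_eq_zero_iff hcont]
  exact ⟨fun h x => curveTo_apply_one (q := q) x 0 ▸ h (curveTo q x 0), fun h σ => h (σ 1)⟩

end Higgs

end YMH

end

theorem mainTheorem4_general (q : ℝ≥0∞) [Fact (1 ≤ q)] (N : ℕ) (m l : ℝ)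
    (A : Fin 4 → Spacetime → Mat N) (hA : ∀ μ, ContDiff ℝ ∞ (A μ))
    (hskew : ∀ μ x, A μ x ∈ skewAdjoint (Mat N))
    (φ : Spacetime → Mat N) (hφ : IsSmoothSuField φ) :
    ((∀ σ : Curve q, Φ A φ σ ∈ su N) ∧
      MemDomBox (fun σ : Curve q => U10 A σ) ∧
      MemDomEndpoint (fun σ : Curve q => Φ A φ σ) ∧
      (∀ ν, MemDomEndpoint (D ν (fun σ : Curve q => Φ A φ σ))) ∧
      (∀ σ : Curve q, IntervalIntegrable (currentIntegrand (Φ A φ) σ) volume 0 1)) ∧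
    (SolvesYangMillsHiggs m l A φ ↔
      (∀ σ : Curve q,
        ∑ μ, ∑ ν, η μ ν • D μ (D ν (Φ A φ)) σ
          - ((m : ℂ) ^ 2 - (l : ℂ) * ((Φ A φ σ)ᴴ * Φ A φ σ).trace) • Φ A φ σ = 0) ∧
      (∀ σ : Curve q,
        levyBox (U10 A) σ
          + U10 A σ * (∫ r in (0 : ℝ)..1, currentIntegrand (Φ A φ) σ r) = 0)) := by
  have hAc (μ : Fin 4) := (hA μ).continuous
  have hdom : MemDomEndpoint (Φ (q := q) A φ) := memDomEndpoint_Φ hA hφ.1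
  have hdomD (ν : Fin 4) : MemDomEndpoint (D ν (Φ (q := q) A φ)) :=
    D_Φ (q := q) hA hφ.1 ν ▸ memDomEndpoint_Φ hA (contDiff_covDeriv hA hφ.1 ν)
  have hsu (σ : Curve q) : Φ A φ σ ∈ su N := Φ_mem_su hAc hskew hφ.1.continuous σ hφ.2
  exact ⟨⟨hsu, memDomBox_U10 hA, hdom, hdomD, intervalIntegrable_currentIntegrand_Φ hA hφ.1⟩,
    and_congr (endpoint_equation_iff hA hφ.1 m l hskew).symm (levyBox_equation_iff hA hφ.1).symm⟩

theorem mainTheorem4 (q : ℝ≥0∞) [Fact (1 ≤ q)] (hq : q = 1 ∨ q = 2) (N : ℕ)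
    (m l : ℝ) (hm : 0 ≤ m) (hl : 0 ≤ l)
    (A : Fin 4 → Spacetime → Mat N) (hA : ∀ μ, IsSmoothSuField (A μ))
    (φ : Spacetime → Mat N) (hφ : IsSmoothSuField φ) :
    -- the objects in the equations below are well defined
    ((∀ σ : Curve q, Φ A φ σ ∈ su N) ∧
      MemDomBox (fun σ : Curve q => U10 A σ) ∧
      MemDomEndpoint (fun σ : Curve q => Φ A φ σ) ∧
      (∀ ν, MemDomEndpoint (D ν (fun σ : Curve q => Φ A φ σ))) ∧
      (∀ σ : Curve q, IntervalIntegrable (currentIntegrand (Φ A φ) σ) volume 0 1)) ∧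
    -- the equivalence
    (SolvesYangMillsHiggs m l A φ ↔
      (∀ σ : Curve q,
        ∑ μ, ∑ ν, η μ ν • D μ (D ν (Φ A φ)) σ
          - ((m : ℂ) ^ 2 - (l : ℂ) * ((Φ A φ σ)ᴴ * Φ A φ σ).trace) • Φ A φ σ = 0) ∧
      (∀ σ : Curve q,
        levyBox (U10 A) σ
          + U10 A σ * (∫ r in (0 : ℝ)..1, currentIntegrand (Φ A φ) σ r) = 0)) :=
  mainTheorem4_general q N m l A (fun μ => (hA μ).1)
    (fun μ x => skewAdjoint.mem_iff.2 ((hA μ).2 x).1) φ hφ
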